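/- Let $k$ be a field of characteristic zero, let $H$ be a Hopf algebra over $k$ with bijective antipode $S$ and counit $\varepsilon$, and let $\mathcal D_H$ be a left $H$-category, i.e. a small $k$-linear category whose morphism spaces are left $H$-modules with $h(\mathrm{id}_X)=\varepsilon(h)\,\mathrm{id}_X$ and $h(gf)=(h_1g)(h_2f)$. Let $M$ be a right-left stable anti-Yetter–Drinfeld module over $H$, i.e. a right $H$-module and left $H$-comodule with $(mh)_{(-1)}\otimes (mh)_{(0)}=S(h_3)m_{(-1)}h_1\otimes m_{(0)}h_2$ and $m_{(0)}m_{(-1)}=m$. For $n\ge 0$ put $CN_n(\mathcal D_H)=\bigoplus_{(X_0,\dots,X_n)}\mathrm{Hom}(X_1,X_0)\otimes \mathrm{Hom}(X_2,X_1)\otimes\cdots\otimes\mathrm{Hom}(X_0,X_n)$ with the diagonal $H$-action, let $H$ act on the right of $M\otimes CN_n(\mathcal D_H)$ by $(m\otimes x)h=mh_1\otimes S(h_2)x$, and put $C^n_H(\mathcal D_H,M)=\mathrm{Hom}_H(M\otimes CN_n(\mathcal D_H),k)$, where $H$ acts on $k$ through $\varepsilon$. It has the structure maps $\delta_i\phi=\phi\circ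 d_i$, $\sigma_i\phi=\phi\circ s_i$, $\tau_n\phi=\phi\circ t_n$, where $$d_i(m\otimes f^0\otimes\cdots\otimes f^{n})=m\otimes f^0\otimes\cdots\otimes f^if^{i+1}\otimes\cdots\otimes f^{n}\ (0\le i<n),\qquad d_n(m\otimes f^0\otimes\cdots\otimes f^{n})=m_{(0)}\otimes (S^{-1}(m_{(-1)})f^{n})f^0\otimes f^1\otimes\cdots\otimes f^{n-1},$$ $s_i$ $(0\le i\le n)$ inserts an identity after $f^i$, and $t_n(m\otimes f^0\otimes\cdots\otimes f^n)=m_{(0)}\otimes S^{-1}(m_{(-1)})f^n\otimes f^0\otimes\cdots\otimes f^{n-1}$. On $C^n_H$ let $b=\sum_{i=0}^{n+1}(-1)^i\delta_i$, $b'=\sum_{i=0}^{n}(-1)^i\delta_i$, $\lambda=(-1)^n\tau_n$, $N=1+\lambda+\cdots+\lambda^n$. The Hochschild complex is $(C_H^\bullet(\mathcal D_H,M),b)$, with cohomology $HC_H^\bullet(\mathcal D_H,M)^{hoc}$. The cyclic double complex has $C_H^q(\mathcal D_H,M)$ in position $(p,q)$, $p,q\ge0$, vertical differentials $b$ ($p$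 even) and $-b'$ ($p$ odd), and horizontal differentials $1-\lambda$ ($p$ even) and $N$ ($p$ odd); the cohomology of its total complex is the Hopf-cyclic cohomology $HC^\bullet_H(\mathcal D_H,M)$. Let $r\ge1$ and let $\mathcal D_H\otimes M_r(k)$ be the left $H$-category with the objects of $\mathcal D_H$, morphism spaces $\mathrm{Hom}_{\mathcal D_H}(X,Y)\otimes M_r(k)$, composition $(g\otimes C)(f\otimes B)=gf\otimes CB$, and $h(f\otimes B)=hf\otimes B$. Consider $$(inc_1,M):\ m\otimes f^0\otimes\cdots\otimes f^n\mapsto m\otimes (f^0\otimes E_{11})\otimes\cdots\otimes (f^n\otimes E_{11}),$$ $$tr^M:\ m\otimes (f^0\otimes B^0)\otimes\cdots\otimes (f^n\otimes B^n)\mapsto \mathrm{trace}(B^0\cdots B^n)\; m\otimes f^0\otimes\cdots\otimes f^n .$$ Then the structure maps above are well defined on $H$-linear cochains, both for $\mathcal D_H$ and for $\mathcal D_H\otimes M_r(k)$, the Hochschild complexes and the cyclic double complexes of both are indeed (double) complexes (with anticommuting differentials), and: 1. $\phi\mapsto\phi\circ(inc_1,M)$ is a morphism of Hochschild complexes and a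 morphism of cyclic double complexes from those of $\mathcal D_H\otimes M_r(k)$ to those of $\mathcal D_H$. 2. $\phi\mapsto\phi\circ tr^M$ is a morphism of cocyclic modules $C^\bullet_H(\mathcal D_H,M)\to C^\bullet_H(\mathcal D_H\otimes M_r(k),M)$ (it commutes with all $\delta_i,\sigma_i,\tau_n$); in particular it is a morphism of Hochschild complexes and of cyclic double complexes. 3. For every $n$, the induced maps $HC^n_H(\mathcal D_H\otimes M_r(k),M)^{hoc}\to HC^n_H(\mathcal D_H,M)^{hoc}$ and $HC^n_H(\mathcal D_H,M)^{hoc}\to HC^n_H(\mathcal D_H\otimes M_r(k),M)^{hoc}$ are mutually inverse isomorphisms of Hochschild cohomologies. 4. For every $n$, the induced maps $HC^n_H(inc_1,M):HC^n_H(\mathcal D_H\otimes M_r(k),M)\to HC^n_H(\mathcal D_H,M)$ and $HC^n_H(tr^M):HC^n_H(\mathcal D_H,M)\to HC^n_H(\mathcal D_H\otimes M_r(k),M)$ are mutually inverse isomorphisms of Hopf-cyclic cohomologies. -/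

import Mathlib

noncomputable section

open CategoryTheory
open scoped TensorProduct DirectSum Coalgebra

universe u v w

namespace HopfCyclic

/-! ## Hopf-module categories and stable anti-Yetter-Drinfeld modules -/

/-- The antipode of the Hopf algebra `H` is bijective. -/
class BijectiveAntipode (k : Type u) [Field k] (H : Type v) [Ring H] [HopfAlgebra k H] :
    Prop where
  bijective : Function.Bijective (HopfAlgebra.antipode k (A := H))

/-- The inverse `S⁻¹` of the antipode. -/
def antipodeInv (k : Type u) [Field k] (H : Type v) [Ring H] [HopfAlgebra k H]
    [BijectiveAntipode k H] : H →ₗ[k] H :=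
  (LinearEquiv.ofBijective (HopfAlgebra.antipode k (A := H))
    BijectiveAntipode.bijective).symm.toLinearMap

/-- A left `H`-category: a small `k`-linear category whose morphism spaces are left `H`-modules
(given by algebra maps `H → End_k (Hom (X, Y))`), such that `h (id_X) = ε(h) id_X` and
`h (g ∘ f) = (h₁ g) ∘ (h₂ f)`.  Note that `f ≫ g` is the composite `g ∘ f`, and that `ℛ k h` is a
presentation of `Δ(h) = ∑ h₁ ⊗ h₂` as a finite sum of pure tensors. -/
class HCategory (k : Type u) [Field k] (H : Type v) [Ring H] [HopfAlgebra k H]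
    (D : Type u) [SmallCategory D] [Preadditive D] [Linear k D] where
  act : ∀ X Y : D, H →ₐ[k] Module.End k (X ⟶ Y)
  act_id : ∀ (X : D) (h : H), act X X h (𝟙 X) = Coalgebra.counit (R := k) h • 𝟙 X
  act_comp : ∀ {X Y Z : D} (f : X ⟶ Y) (g : Y ⟶ Z) (h : H),
    act X Z h (f ≫ g) =
      ∑ i ∈ (ℛ k h).index, act X Y ((ℛ k h).right i) f ≫ act Y Z ((ℛ k h).left i) g

/-- A right-left stable anti-Yetter-Drinfeld module over `H`: a right `H`-module
(an algebra map `Hᵐᵒᵖ → End_k M`), which is a left `H`-comodule through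
`ρ(m) = m₍₋₁₎ ⊗ m₍₀₎`, with `ρ(m h) = S(h₃) m₍₋₁₎ h₁ ⊗ m₍₀₎ h₂` and `m₍₀₎ m₍₋₁₎ = m`. -/
class SAYDModule (k : Type u) [Field k] (H : Type v) [Ring H] [HopfAlgebra k H]
    (M : Type w) [AddCommGroup M] [Module k M] where
  /-- the right action, `act (op h) m = m h` -/
  act : Hᵐᵒᵖ →ₐ[k] Module.End k M
  coact : M →ₗ[k] H ⊗[k] M
  coassoc : (TensorProduct.assoc k H H M).toLinearMap ∘ₗ
      (Coalgebra.comul (R := k) (A := H)).rTensor M ∘ₗ coact = coact.lTensor H ∘ₗ coact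
  counit_coact : (TensorProduct.lid k M).toLinearMap ∘ₗ
      (Coalgebra.counit (R := k) (A := H)).rTensor M ∘ₗ coact = LinearMap.id
  antiYetterDrinfeld : ∀ (m : M) (h : H),
    coact (act (.op h) m) =
      ∑ i ∈ (ℛ k h).index, ∑ j ∈ (ℛ k ((ℛ k h).right i)).index,
        TensorProduct.map
          (LinearMap.mulLeft k (HopfAlgebra.antipode k ((ℛ k ((ℛ k h).right i)).right j)) ∘ₗ
            LinearMap.mulRight k ((ℛ k h).left i))
          (act (.op ((ℛ k ((ℛ k h).right i)).left j))) (coact m)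
  stable : ∀ m : M,
    TensorProduct.lift
      ((act.toLinearMap ∘ₗ (MulOpposite.opLinearEquiv k : H ≃ₗ[k] Hᵐᵒᵖ).toLinearMap))
      (coact m) = m

/-- The right action as a linear map `h ↦ (m ↦ m h)`. -/
def rightAct (k : Type u) [Field k] (H : Type v) [Ring H] [HopfAlgebra k H]
    (M : Type w) [AddCommGroup M] [Module k M] [SAYDModule k H M] :
    H →ₗ[k] M →ₗ[k] M :=
  (SAYDModule.act (k := k) (H := H) (M := M)).toLinearMap ∘ₗ
    (MulOpposite.opLinearEquiv k : H ≃ₗ[k] Hᵐᵒᵖ).toLinearMap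

/-! ## The additive cyclic nerve -/

section Nerve

variable (k : Type u) [Field k] {D : Type u} [SmallCategory D] [Preadditive D] [Linear k D]

/-- The space of strings `f⁰ ⊗ ⋯ ⊗ fⁿ` of `n + 1` composable morphisms from `Z` to `X`:
`⨁ Hom(X₁, X) ⊗ Hom(X₂, X₁) ⊗ ⋯ ⊗ Hom(Z, Xₙ)`, the sum running over all `X₁, …, Xₙ`. -/
def stringMod : ℕ → D → D → ModuleCat.{u} k
  | 0, X, Z => ModuleCat.of k (Z ⟶ X)
  | n + 1, X, Z => ModuleCat.of k (⨁ Y : D, (Y ⟶ X) ⊗[k] (stringMod n Y Z))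

abbrev Str (n : ℕ) (X Z : D) : Type u := stringMod k n X Z

def strZero (X Z : D) : Str k 0 X Z ≃ₗ[k] (Z ⟶ X) :=
  LinearEquiv.refl k (Z ⟶ X)

def strSucc (n : ℕ) (X Z : D) : Str k (n + 1) X Z ≃ₗ[k] ⨁ Y : D, (Y ⟶ X) ⊗[k] Str k n Y Z :=
  LinearEquiv.refl k (⨁ Y : D, (Y ⟶ X) ⊗[k] Str k n Y Z)

/-- The additive cyclic nerve
`CNₙ(D) = ⨁ Hom(X₁, X₀) ⊗ Hom(X₂, X₁) ⊗ ⋯ ⊗ Hom(X₀, Xₙ)`, over all `(X₀, …, Xₙ)`. -/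
abbrev CN (D : Type u) [SmallCategory D] [Preadditive D] [Linear k D] (n : ℕ) : Type u :=
  ⨁ X : D, Str k n X X

open Classical in
/-- Linear maps out of `Str k (n + 1) X Z`, one summand and one first arrow at a time. -/
def strLift {n : ℕ} {X Z : D} {N : Type*} [AddCommGroup N] [Module k N]
    (φ : ∀ Y : D, (Y ⟶ X) ⊗[k] Str k n Y Z →ₗ[k] N) : Str k (n + 1) X Z →ₗ[k] N :=
  DirectSum.toModule k D N φ ∘ₗ (strSucc k n X Z).toLinearMap

open Classical in
/-- `f⁰ ⊗ p ↦ f⁰ ⊗ p`, prepending an arrow to a string. -/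
def strCons (n : ℕ) (X Y Z : D) : (Y ⟶ X) ⊗[k] Str k n Y Z →ₗ[k] Str k (n + 1) X Z :=
  (strSucc k n X Z).symm.toLinearMap ∘ₗ
    DirectSum.lof k D (fun Y : D => (Y ⟶ X) ⊗[k] Str k n Y Z) Y

open Classical in
/-- The inclusion of the summand of closed strings at `X`. -/
def cnOf (n : ℕ) (X : D) : Str k n X X →ₗ[k] CN k D n :=
  DirectSum.lof k D (fun X : D => Str k n X X) X

open Classical in
/-- Linear maps out of `CNₙ(D)`. -/
def cnLift {n : ℕ} {N : Type*} [AddCommGroup N] [Module k N]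
    (φ : ∀ X : D, Str k n X X →ₗ[k] N) : CN k D n →ₗ[k] N :=
  DirectSum.toModule k D N φ

/-- Bilinear version of `strLift`. -/
def strLift₂ {n : ℕ} {X Z : D} {A N : Type*} [AddCommGroup A] [Module k A]
    [AddCommGroup N] [Module k N]
    (φ : ∀ Y : D, A →ₗ[k] (Y ⟶ X) ⊗[k] Str k n Y Z →ₗ[k] N) :
    A →ₗ[k] Str k (n + 1) X Z →ₗ[k] N :=
  (strLift k fun Y => (φ Y).flip).flip

/-- Bilinear version of `cnLift`. -/
def cnLift₂ {n : ℕ} {A N : Type*} [AddCommGroup A] [Module k A] [AddCommGroup N] [Module k N]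
    (φ : ∀ X : D, A →ₗ[k] Str k n X X →ₗ[k] N) : A →ₗ[k] CN k D n →ₗ[k] N :=
  (cnLift k fun X => (φ X).flip).flip

/-- `g ↦ (f⁰ ⊗ ⋯ ⊗ fⁿ ↦ g f⁰ ⊗ f¹ ⊗ ⋯ ⊗ fⁿ)`. -/
def strMul : (n : ℕ) → (X Y Z : D) → (Y ⟶ X) →ₗ[k] Str k n Y Z →ₗ[k] Str k n X Z
  | 0, X, Y, Z =>
      ((Linear.comp (S := k) Z Y X).flip.compl₂ (strZero k Y Z).toLinearMap).compr₂
        (strZero k X Z).symm.toLinearMap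
  | n + 1, X, Y, Z => strLift₂ k fun W =>
      LinearMap.llcomp k _ _ _ (strCons k n X W Z) ∘ₗ
        LinearMap.rTensorHom (Str k n W Z) ∘ₗ (Linear.comp (S := k) W Y X).flip

/-- `f⁰ ⊗ ⋯ ⊗ fⁿ⁺¹ ↦ f⁰ ⊗ ⋯ ⊗ fⁱ fⁱ⁺¹ ⊗ ⋯ ⊗ fⁿ⁺¹`, for `0 ≤ i ≤ n` (other `i` are not used). -/
def strFace : (n i : ℕ) → (X Z : D) → Str k (n + 1) X Z →ₗ[k] Str k n X Z
  | n, 0, X, Z => strLift k fun Y => TensorProduct.lift (strMul k n X Y Z)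
  | 0, _ + 1, _, _ => 0
  | n + 1, i + 1, X, Z => strLift k fun Y =>
      strCons k n X Y Z ∘ₗ (strFace n i Y Z).lTensor (Y ⟶ X)

/-- `f⁰ ⊗ ⋯ ⊗ fⁿ ↦ f⁰ ⊗ ⋯ ⊗ fⁱ ⊗ id ⊗ fⁱ⁺¹ ⊗ ⋯ ⊗ fⁿ`, for `0 ≤ i ≤ n` (other `i` are not
used). -/
def strDegen : (n i : ℕ) → (X Z : D) → Str k n X Z →ₗ[k] Str k (n + 1) X Z
  | 0, 0, X, Z =>
      strCons k 0 X Z Z ∘ₗ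
        (TensorProduct.mk k (Z ⟶ X) (Str k 0 Z Z)).flip ((strZero k Z Z).symm (𝟙 Z)) ∘ₗ
          (strZero k X Z).toLinearMap
  | 0, _ + 1, _, _ => 0
  | n + 1, 0, X, Z => strLift k fun Y =>
      strCons k (n + 1) X Y Z ∘ₗ
        (strCons k n Y Y Z ∘ₗ TensorProduct.mk k (Y ⟶ Y) (Str k n Y Z) (𝟙 Y)).lTensor (Y ⟶ X)
  | n + 1, i + 1, X, Z => strLift k fun Y =>
      strCons k (n + 1) X Y Z ∘ₗ (strDegen n i Y Z).lTensor (Y ⟶ X)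

open Classical in
/-- `f⁰ ⊗ ⋯ ⊗ fⁿ ⊗ fⁿ⁺¹ ↦ (f⁰ ⊗ ⋯ ⊗ fⁿ) ⊗ fⁿ⁺¹`, splitting off the last arrow of a string. -/
def strUnsnoc : (n : ℕ) → (X Z : D) →
    Str k (n + 1) X Z →ₗ[k] ⨁ Y : D, Str k n X Y ⊗[k] (Z ⟶ Y)
  | 0, X, Z => strLift k fun Y =>
      DirectSum.lof k D (fun Y : D => Str k 0 X Y ⊗[k] (Z ⟶ Y)) Y ∘ₗ
        TensorProduct.map (strZero k X Y).symm.toLinearMap (strZero k Y Z).toLinearMap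
  | n + 1, X, Z => strLift k fun Y =>
      (DirectSum.toModule k D (⨁ W : D, Str k (n + 1) X W ⊗[k] (Z ⟶ W)) fun W =>
        DirectSum.lof k D (fun W : D => Str k (n + 1) X W ⊗[k] (Z ⟶ W)) W ∘ₗ
          (strCons k n X Y W).rTensor (Z ⟶ W) ∘ₗ
            (TensorProduct.assoc k (Y ⟶ X) (Str k n Y W) (Z ⟶ W)).symm.toLinearMap) ∘ₗ
        (TensorProduct.directSumRight k k (Y ⟶ X)
          (fun W : D => Str k n Y W ⊗[k] (Z ⟶ W))).toLinearMap ∘ₗ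
          (strUnsnoc n Y Z).lTensor (Y ⟶ X)

variable (H : Type v) [Ring H] [HopfAlgebra k H] [HCategory k H D]

/-- The diagonal action `h ↦ (f⁰ ⊗ ⋯ ⊗ fⁿ ↦ h₁ f⁰ ⊗ ⋯ ⊗ hₙ₊₁ fⁿ)` on strings. -/
def strAct : (n : ℕ) → (X Z : D) → H →ₗ[k] Str k n X Z →ₗ[k] Str k n X Z
  | 0, X, Z =>
      ((HCategory.act (k := k) (H := H) Z X).toLinearMap.compl₂
        (strZero k X Z).toLinearMap).compr₂ (strZero k X Z).symm.toLinearMap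
  | n + 1, X, Z => strLift₂ k fun Y =>
      LinearMap.llcomp k _ _ _ (strCons k n X Y Z) ∘ₗ
        TensorProduct.map₂ (HCategory.act (k := k) (H := H) Y X).toLinearMap (strAct n Y Z) ∘ₗ
          Coalgebra.comul

/-- The diagonal action of `H` on `CNₙ(D)`. -/
def cnAct (n : ℕ) : H →ₗ[k] CN k D n →ₗ[k] CN k D n :=
  cnLift₂ k fun X => (strAct k H n X X).compr₂ (cnOf k n X)

open Classical in
/-- `h ↦ (f⁰ ⊗ ⋯ ⊗ fⁿ ↦ h fⁿ ⊗ f⁰ ⊗ ⋯ ⊗ fⁿ⁻¹)`. -/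
def cnRot : (n : ℕ) → H →ₗ[k] CN k D n →ₗ[k] CN k D n
  | 0 => cnAct k H 0
  | n + 1 => cnLift₂ k fun X =>
      ((DirectSum.toModule k D (H →ₗ[k] CN k D (n + 1)) fun Y =>
        (LinearMap.llcomp k _ _ _
          (cnOf k (n + 1) Y ∘ₗ strCons k n Y X Y ∘ₗ
            (TensorProduct.comm k (Str k n X Y) (X ⟶ Y)).toLinearMap) ∘ₗ
          LinearMap.lTensorHom (Str k n X Y) ∘ₗ
            (HCategory.act (k := k) (H := H) X Y).toLinearMap).flip) ∘ₗ
        strUnsnoc k n X X).flip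

end Nerve

/-! ## Chains, cochains and their structure maps -/

section Cochains

variable (k : Type u) [Field k] (H : Type v) [Ring H] [HopfAlgebra k H]
  (D : Type u) [SmallCategory D] [Preadditive D] [Linear k D] [HCategory k H D]
  (M : Type w) [AddCommGroup M] [Module k M] [SAYDModule k H M]

/-- `Cₙ(D, M) = M ⊗ CNₙ(D)`. -/
abbrev Chain (k : Type u) [Field k] (D : Type u) [SmallCategory D] [Preadditive D] [Linear k D]
    (M : Type w) [AddCommGroup M] [Module k M] (n : ℕ) : Type (max u w) :=
  M ⊗[k] CN k D n

/-- The right action `(m ⊗ x) h = m h₁ ⊗ S(h₂) x` on `M ⊗ CNₙ(D)`. -/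
def chainAct (n : ℕ) : H →ₗ[k] Chain k D M n →ₗ[k] Chain k D M n :=
  TensorProduct.map₂ (rightAct k H M) (cnAct k H n ∘ₗ HopfAlgebra.antipode k) ∘ₗ Coalgebra.comul

/-- `tₙ (m ⊗ f⁰ ⊗ ⋯ ⊗ fⁿ) = m₍₀₎ ⊗ S⁻¹(m₍₋₁₎) fⁿ ⊗ f⁰ ⊗ ⋯ ⊗ fⁿ⁻¹`. -/
def chainT [BijectiveAntipode k H] (n : ℕ) : Chain k D M n →ₗ[k] Chain k D M n :=
  TensorProduct.lift (LinearMap.lTensorHom M ∘ₗ cnRot k H n ∘ₗ antipodeInv k H) ∘ₗ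
    (TensorProduct.assoc k H M (CN k D n)).toLinearMap ∘ₗ
      (SAYDModule.coact (k := k) (H := H) (M := M)).rTensor (CN k D n)

/-- The faces `d₀, …, dₙ₊₁ : Cₙ₊₁(D, M) → Cₙ(D, M)`: for `i ≤ n`, `dᵢ` composes `fⁱ` and `fⁱ⁺¹`, and
`dₙ₊₁ (m ⊗ f⁰ ⊗ ⋯ ⊗ fⁿ⁺¹) = m₍₀₎ ⊗ (S⁻¹(m₍₋₁₎) fⁿ⁺¹) f⁰ ⊗ f¹ ⊗ ⋯ ⊗ fⁿ`
(the composite of `tₙ₊₁` and the face `0`). -/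
def chainFace [BijectiveAntipode k H] (n : ℕ) (i : Fin (n + 2)) :
    Chain k D M (n + 1) →ₗ[k] Chain k D M n :=
  if (i : ℕ) ≤ n then
    (cnLift k fun X => cnOf k n X ∘ₗ strFace k n i X X).lTensor M
  else
    (cnLift k fun X => cnOf k n X ∘ₗ strFace k n 0 X X).lTensor M ∘ₗ chainT k H D M (n + 1)

/-- The degeneracies `s₀, …, sₙ : Cₙ(D, M) → Cₙ₊₁(D, M)`; `sᵢ` inserts an identity after `fⁱ`. -/
def chainDegen (k : Type u) [Field k] (D : Type u) [SmallCategory D] [Preadditive D] [Linear k D]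
    (M : Type w) [AddCommGroup M] [Module k M] (n : ℕ) (i : Fin (n + 1)) :
    Chain k D M n →ₗ[k] Chain k D M (n + 1) :=
  (cnLift k fun X => cnOf k (n + 1) X ∘ₗ strDegen k n i X X).lTensor M

/-- `Cⁿ(D, M) = Hom_k (M ⊗ CNₙ(D), k)`. -/
abbrev Cochain (k : Type u) [Field k] (D : Type u) [SmallCategory D] [Preadditive D] [Linear k D]
    (M : Type w) [AddCommGroup M] [Module k M] (n : ℕ) : Type (max u w) :=
  Module.Dual k (Chain k D M n)

/-- `Cⁿ_H(D, M) = Hom_H (M ⊗ CNₙ(D), k)`, where `H` acts on `k` through the counit. -/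
def HCochain (n : ℕ) : Submodule k (Cochain k D M n) where
  carrier := {φ | ∀ (h : H) (x : Chain k D M n),
    φ (chainAct k H D M n h x) = Coalgebra.counit (R := k) h * φ x}
  add_mem' := by
    intro a b ha hb h x
    simp [ha h x, hb h x, mul_add]
  zero_mem' := by
    intro h x
    simp
  smul_mem' := by
    intro c a ha h x
    simp [ha h x, mul_left_comm]

variable [BijectiveAntipode k H]

/-- `δᵢ φ = φ ∘ dᵢ`. -/
def coface (n : ℕ) (i : Fin (n + 2)) : Cochain k D M n →ₗ[k] Cochain k D M (n + 1) :=
  (chainFace k H D M n i).dualMap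

/-- `σᵢ φ = φ ∘ sᵢ`. -/
def codegen (k : Type u) [Field k] (D : Type u) [SmallCategory D] [Preadditive D] [Linear k D]
    (M : Type w) [AddCommGroup M] [Module k M] (n : ℕ) (i : Fin (n + 1)) :
    Cochain k D M (n + 1) →ₗ[k] Cochain k D M n :=
  (chainDegen k D M n i).dualMap

/-- `τₙ φ = φ ∘ tₙ`. -/
def cocyc (n : ℕ) : Cochain k D M n →ₗ[k] Cochain k D M n :=
  (chainT k H D M n).dualMap

/-- The Hochschild differential `b = ∑_{i=0}^{n+1} (-1)^i δᵢ`. -/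
def hochB (n : ℕ) : Cochain k D M n →ₗ[k] Cochain k D M (n + 1) :=
  ∑ i : Fin (n + 2), (-1 : k) ^ (i : ℕ) • coface k H D M n i

/-- `b' = ∑_{i=0}^{n} (-1)^i δᵢ`. -/
def hochB' (n : ℕ) : Cochain k D M n →ₗ[k] Cochain k D M (n + 1) :=
  ∑ i : Fin (n + 1), (-1 : k) ^ (i : ℕ) • coface k H D M n i.castSucc

/-- `λ = (-1)ⁿ τₙ`. -/
def lam (n : ℕ) : Module.End k (Cochain k D M n) :=
  (-1 : k) ^ n • cocyc k H D M n

/-- `N = 1 + λ + ⋯ + λⁿ`. -/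
def normN (n : ℕ) : Module.End k (Cochain k D M n) :=
  ∑ i ∈ Finset.range (n + 1), lam k H D M n ^ i

/-- The vertical differentials of the cyclic double complex, `b` in even columns and `-b'` in odd
columns. -/
def cyV (p q : ℕ) : Cochain k D M q →ₗ[k] Cochain k D M (q + 1) :=
  if Even p then hochB k H D M q else -hochB' k H D M q

/-- The horizontal differentials of the cyclic double complex, `1 - λ` from even to odd columns and
`N` from odd to even columns. -/
def cyH (p q : ℕ) : Cochain k D M q →ₗ[k] Cochain k D M q :=
  if Even p then 1 - lam k H D M q else normN k H D M q

end Cochains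

/-! ## Cohomology of complexes and of double complexes

A complex is presented by subspaces `S n` of spaces `C n` and maps `d n : C n → C (n + 1)`
with `d (S n) ⊆ S (n + 1)` and `d d = 0` on `S n`. -/

section Complexes

variable {k : Type u} [Field k]
  {C C' : ℕ → Type w} [∀ n, AddCommGroup (C n)] [∀ n, Module k (C n)]
  [∀ n, AddCommGroup (C' n)] [∀ n, Module k (C' n)]

def IsComplex (S : ∀ n, Submodule k (C n)) (d : ∀ n, C n →ₗ[k] C (n + 1)) : Prop :=
  ∀ n, ∀ x ∈ S n, d n x ∈ S (n + 1) ∧ d (n + 1) (d n x) = 0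

def cocycles (S : ∀ n, Submodule k (C n)) (d : ∀ n, C n →ₗ[k] C (n + 1)) (n : ℕ) :
    Submodule k (C n) :=
  S n ⊓ LinearMap.ker (d n)

def coboundaries (S : ∀ n, Submodule k (C n)) (d : ∀ n, C n →ₗ[k] C (n + 1)) :
    (n : ℕ) → Submodule k (C n)
  | 0 => ⊥
  | n + 1 => (S n).map (d n)

/-- The cohomology `Zⁿ / Bⁿ`. -/
abbrev Cohomology (S : ∀ n, Submodule k (C n)) (d : ∀ n, C n →ₗ[k] C (n + 1)) (n : ℕ) : Type w :=
  cocycles S d n ⧸ (coboundaries S d n).submoduleOf (cocycles S d n)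

/-- `f` is a morphism from the complex `(S, d)` to the complex `(S', d')`. -/
structure IsComplexMap (S : ∀ n, Submodule k (C n)) (d : ∀ n, C n →ₗ[k] C (n + 1))
    (S' : ∀ n, Submodule k (C' n)) (d' : ∀ n, C' n →ₗ[k] C' (n + 1))
    (f : ∀ n, C n →ₗ[k] C' n) : Prop where
  mem : ∀ n, ∀ x ∈ S n, f n x ∈ S' n
  comm : ∀ n, ∀ x ∈ S n, f (n + 1) (d n x) = d' n (f n x)

variable {S : ∀ n, Submodule k (C n)} {d : ∀ n, C n →ₗ[k] C (n + 1)}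
  {S' : ∀ n, Submodule k (C' n)} {d' : ∀ n, C' n →ₗ[k] C' (n + 1)}
  {f : ∀ n, C n →ₗ[k] C' n}

theorem IsComplexMap.mem_cocycles (hf : IsComplexMap S d S' d' f) (n : ℕ) :
    ∀ x ∈ cocycles S d n, f n x ∈ cocycles S' d' n := by
  rintro x ⟨hx, hx'⟩
  refine ⟨hf.mem n x hx, ?_⟩
  rw [SetLike.mem_coe, LinearMap.mem_ker] at hx' ⊢
  rw [← hf.comm n x hx, hx', map_zero]

theorem IsComplexMap.mem_coboundaries (hf : IsComplexMap S d S' d' f) (n : ℕ) :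
    ∀ x ∈ coboundaries S d n, f n x ∈ coboundaries S' d' n := by
  cases n with
  | zero =>
    intro x hx
    rw [coboundaries, Submodule.mem_bot] at hx ⊢
    rw [hx, map_zero]
  | succ n =>
    rintro _ ⟨y, hy, rfl⟩
    exact ⟨f n y, hf.mem n y hy, (hf.comm n y hy).symm⟩

/-- The map `Hⁿ(f)` induced on cohomology by a morphism `f` of complexes, `[z] ↦ [f z]`. -/
def IsComplexMap.cohomologyMap (hf : IsComplexMap S d S' d' f) (n : ℕ) :
    Cohomology S d n →ₗ[k] Cohomology S' d' n :=
  Submodule.mapQ _ _ ((f n).restrict (hf.mem_cocycles n)) (by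
    intro x hx
    exact hf.mem_coboundaries n x hx)

end Complexes

section DoubleComplexes

variable {k : Type u} [Field k]
  {C C' : ℕ → ℕ → Type w} [∀ p q, AddCommGroup (C p q)] [∀ p q, Module k (C p q)]
  [∀ p q, AddCommGroup (C' p q)] [∀ p q, Module k (C' p q)]

/-- The part of total degree `n` of a double complex, the families supported on `p + q = n`. -/
def totSub (S : ∀ p q, Submodule k (C p q)) (n : ℕ) : Submodule k (∀ p q, C p q) where
  carrier := {x | (∀ p q, x p q ∈ S p q) ∧ ∀ p q, p + q ≠ n → x p q = 0}
  add_mem' := by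
    rintro a b ⟨ha, ha'⟩ ⟨hb, hb'⟩
    refine ⟨fun p q => add_mem (ha p q) (hb p q), fun p q h => ?_⟩
    simp [ha' p q h, hb' p q h]
  zero_mem' := ⟨fun p q => zero_mem _, fun p q _ => rfl⟩
  smul_mem' := by
    rintro c a ⟨ha, ha'⟩
    refine ⟨fun p q => Submodule.smul_mem _ _ (ha p q), fun p q h => ?_⟩
    simp [ha' p q h]

/-- The sum over all `p`, `q` of the maps `v p q`. -/
def totV (v : ∀ p q, C p q →ₗ[k] C p (q + 1)) : (∀ p q, C p q) →ₗ[k] (∀ p q, C p q) :=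
  LinearMap.pi fun p => LinearMap.pi fun
    | 0 => 0
    | q + 1 => v p q ∘ₗ LinearMap.proj q ∘ₗ LinearMap.proj p

/-- The sum over all `p`, `q` of the maps `h p q`. -/
def totH (h : ∀ p q, C p q →ₗ[k] C (p + 1) q) : (∀ p q, C p q) →ₗ[k] (∀ p q, C p q) :=
  LinearMap.pi fun
    | 0 => 0
    | p + 1 => LinearMap.pi fun q => h p q ∘ₗ LinearMap.proj q ∘ₗ LinearMap.proj p

/-- The differential of the total complex. -/
def totD (v : ∀ p q, C p q →ₗ[k] C p (q + 1)) (h : ∀ p q, C p q →ₗ[k] C (p + 1) q) (_n : ℕ) :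
    (∀ p q, C p q) →ₗ[k] (∀ p q, C p q) :=
  totV v + totH h

/-- `(S, v, h)` is a double complex, with anticommuting differentials. -/
structure IsDoubleComplex (S : ∀ p q, Submodule k (C p q))
    (v : ∀ p q, C p q →ₗ[k] C p (q + 1)) (h : ∀ p q, C p q →ₗ[k] C (p + 1) q) : Prop where
  v_mem : ∀ p q, ∀ x ∈ S p q, v p q x ∈ S p (q + 1)
  h_mem : ∀ p q, ∀ x ∈ S p q, h p q x ∈ S (p + 1) q
  v_v : ∀ p q, ∀ x ∈ S p q, v p (q + 1) (v p q x) = 0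
  h_h : ∀ p q, ∀ x ∈ S p q, h (p + 1) q (h p q x) = 0
  v_h : ∀ p q, ∀ x ∈ S p q, v (p + 1) q (h p q x) + h p (q + 1) (v p q x) = 0

/-- `f` is a morphism from the double complex `(S, v, h)` to the double complex `(S', v', h')`. -/
structure IsDoubleComplexMap (S : ∀ p q, Submodule k (C p q))
    (v : ∀ p q, C p q →ₗ[k] C p (q + 1)) (h : ∀ p q, C p q →ₗ[k] C (p + 1) q)
    (S' : ∀ p q, Submodule k (C' p q))
    (v' : ∀ p q, C' p q →ₗ[k] C' p (q + 1)) (h' : ∀ p q, C' p q →ₗ[k] C' (p + 1) q)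
    (f : ∀ p q, C p q →ₗ[k] C' p q) : Prop where
  mem : ∀ p q, ∀ x ∈ S p q, f p q x ∈ S' p q
  comm_v : ∀ p q, ∀ x ∈ S p q, f p (q + 1) (v p q x) = v' p q (f p q x)
  comm_h : ∀ p q, ∀ x ∈ S p q, f (p + 1) q (h p q x) = h' p q (f p q x)

/-- The map of total spaces with components `f p q`. -/
def totMap (f : ∀ p q, C p q →ₗ[k] C' p q) (_n : ℕ) : (∀ p q, C p q) →ₗ[k] (∀ p q, C' p q) :=
  LinearMap.pi fun p => LinearMap.pi fun q => f p q ∘ₗ LinearMap.proj q ∘ₗ LinearMap.proj p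

theorem IsDoubleComplexMap.isComplexMap {S : ∀ p q, Submodule k (C p q)}
    {v : ∀ p q, C p q →ₗ[k] C p (q + 1)} {h : ∀ p q, C p q →ₗ[k] C (p + 1) q}
    {S' : ∀ p q, Submodule k (C' p q)}
    {v' : ∀ p q, C' p q →ₗ[k] C' p (q + 1)} {h' : ∀ p q, C' p q →ₗ[k] C' (p + 1) q}
    {f : ∀ p q, C p q →ₗ[k] C' p q} (hf : IsDoubleComplexMap S v h S' v' h' f) :
    IsComplexMap (totSub S) (totD v h) (totSub S') (totD v' h') (totMap f) where
  mem := by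
    rintro n x ⟨hx, hx'⟩
    refine ⟨fun p q => hf.mem p q _ (hx p q), fun p q hpq => ?_⟩
    simp [totMap, hx' p q hpq]
  comm := by
    rintro n x ⟨hx, -⟩
    funext p q
    rcases p with _ | p <;> rcases q with _ | q <;>
      simp [totMap, totD, totV, totH, hf.comm_v _ _ _ (hx _ _), hf.comm_h _ _ _ (hx _ _)]

end DoubleComplexes

/-! ## Hochschild and Hopf-cyclic cohomology -/

section HopfCyclicCohomology

variable (k : Type u) [Field k] (H : Type v) [Ring H] [HopfAlgebra k H] [BijectiveAntipode k H]
  (D : Type u) [SmallCategory D] [Preadditive D] [Linear k D] [HCategory k H D]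
  (M : Type w) [AddCommGroup M] [Module k M] [SAYDModule k H M]

/-- The structure maps `δᵢ`, `σᵢ`, `τₙ` restrict to the subspaces `C^n_H(D, M)`. -/
structure StructureMapsRestrict : Prop where
  coface_mem : ∀ n i, ∀ φ ∈ HCochain k H D M n, coface k H D M n i φ ∈ HCochain k H D M (n + 1)
  codegen_mem : ∀ n i, ∀ φ ∈ HCochain k H D M (n + 1), codegen k D M n i φ ∈ HCochain k H D M n
  cocyc_mem : ∀ n, ∀ φ ∈ HCochain k H D M n, cocyc k H D M n φ ∈ HCochain k H D M n

/-- `f` is a morphism of cocyclic modules from `C^•_H(D, M)` to `C^•_H(D', M)`. -/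
structure IsCocyclicMap (D' : Type u) [SmallCategory D'] [Preadditive D'] [Linear k D']
    [HCategory k H D'] (f : ∀ n, Cochain k D M n →ₗ[k] Cochain k D' M n) : Prop where
  mem : ∀ n, ∀ φ ∈ HCochain k H D M n, f n φ ∈ HCochain k H D' M n
  comm_coface : ∀ n i, ∀ φ ∈ HCochain k H D M n,
    f (n + 1) (coface k H D M n i φ) = coface k H D' M n i (f n φ)
  comm_codegen : ∀ n i, ∀ φ ∈ HCochain k H D M (n + 1),
    f n (codegen k D M n i φ) = codegen k D' M n i (f (n + 1) φ)
  comm_cocyc : ∀ n, ∀ φ ∈ HCochain k H D M n,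
    f n (cocyc k H D M n φ) = cocyc k H D' M n (f n φ)

/-- The Hochschild cohomology, of the complex `(C^•_H(D, M), b)`. -/
abbrev HH (n : ℕ) : Type (max u w) :=
  Cohomology (HCochain k H D M) (hochB k H D M) n

/-- The subspaces `C^q_H(D, M)` in position `(p, q)` of the cyclic double complex. -/
def cyS (_p q : ℕ) : Submodule k (Cochain k D M q) := HCochain k H D M q

/-- The Hopf-cyclic cohomology `HC^n_H(D, M)`, the cohomology of the cocyclic module
`C^•_H(D, M)`, i.e. of the total complex of its cyclic double complex. -/
abbrev HC (n : ℕ) : Type (max u w) :=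
  Cohomology (totSub (cyS k H D M)) (totD (cyV k H D M) (cyH k H D M)) n

end HopfCyclicCohomology

/-! ## Linearization by matrices -/

section Matrices

/-- The objects of the category `D ⊗ M_r(k)`, which are those of `D`. -/
structure MatCat (k : Type u) (D : Type u) (r : ℕ) : Type u where
  obj : D

variable {k : Type u} [Field k] {D : Type u} [SmallCategory D] [Preadditive D] [Linear k D] {r : ℕ}

/-- The composition `(f ⊗ B, g ⊗ C) ↦ g f ⊗ C B` of morphisms of `D ⊗ M_r(k)`. -/
def matComp (X Y Z : D) :
    (X ⟶ Y) ⊗[k] Matrix (Fin r) (Fin r) k →ₗ[k] (Y ⟶ Z) ⊗[k] Matrix (Fin r) (Fin r) k →ₗ[k]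
      (X ⟶ Z) ⊗[k] Matrix (Fin r) (Fin r) k :=
  TensorProduct.map₂ (Linear.comp (S := k) X Y Z)
    (LinearMap.mul k (Matrix (Fin r) (Fin r) k)).flip

theorem matComp_tmul {X Y Z : D} (f : X ⟶ Y) (g : Y ⟶ Z) (B C : Matrix (Fin r) (Fin r) k) :
    matComp X Y Z (f ⊗ₜ B) (g ⊗ₜ C) = (f ≫ g) ⊗ₜ (C * B) := rfl

theorem id_matComp {X Y : D} (f : (X ⟶ Y) ⊗[k] Matrix (Fin r) (Fin r) k) :
    matComp X X Y (𝟙 X ⊗ₜ 1) f = f := by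
  induction f with
  | zero => simp
  | tmul f B => simp [matComp_tmul]
  | add a b ha hb => rw [map_add, ha, hb]

theorem matComp_id {X Y : D} (f : (X ⟶ Y) ⊗[k] Matrix (Fin r) (Fin r) k) :
    matComp X Y Y f (𝟙 Y ⊗ₜ 1) = f := by
  induction f with
  | zero => simp
  | tmul f B => simp [matComp_tmul]
  | add a b ha hb => rw [map_add, LinearMap.add_apply, ha, hb]

theorem matComp_assoc {X Y Z W : D} (f : (X ⟶ Y) ⊗[k] Matrix (Fin r) (Fin r) k)
    (g : (Y ⟶ Z) ⊗[k] Matrix (Fin r) (Fin r) k) (h : (Z ⟶ W) ⊗[k] Matrix (Fin r) (Fin r) k) :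
    matComp X Z W (matComp X Y Z f g) h = matComp X Y W f (matComp Y Z W g h) := by
  induction f with
  | zero => simp
  | add a b ha hb => simp only [map_add, LinearMap.add_apply, ha, hb]
  | tmul f B =>
    induction g with
    | zero => simp
    | add a b ha hb => simp only [map_add, LinearMap.add_apply, ha, hb]
    | tmul g C =>
      induction h with
      | zero => simp
      | add a b ha hb => simp only [map_add, ha, hb]
      | tmul h E => simp [matComp_tmul, mul_assoc]

/-- The linearization `D ⊗ M_r(k)`. -/
instance : SmallCategory (MatCat k D r) where
  Hom X Y := (X.obj ⟶ Y.obj) ⊗[k] Matrix (Fin r) (Fin r) k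
  id X := 𝟙 X.obj ⊗ₜ 1
  comp {X Y Z} f g := matComp X.obj Y.obj Z.obj f g
  id_comp f := id_matComp f
  comp_id f := matComp_id f
  assoc f g h := matComp_assoc f g h

instance : Preadditive (MatCat k D r) where
  homGroup X Y := inferInstanceAs (AddCommGroup ((X.obj ⟶ Y.obj) ⊗[k] Matrix (Fin r) (Fin r) k))
  add_comp X Y Z f g h := DFunLike.congr_fun (LinearMap.map_add (matComp X.obj Y.obj Z.obj) f g) h
  comp_add X Y Z f g h := LinearMap.map_add (matComp X.obj Y.obj Z.obj f) g h

instance : Linear k (MatCat k D r) where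
  homModule X Y := inferInstanceAs (Module k ((X.obj ⟶ Y.obj) ⊗[k] Matrix (Fin r) (Fin r) k))
  smul_comp X Y Z c f g := DFunLike.congr_fun (LinearMap.map_smul (matComp X.obj Y.obj Z.obj) c f) g
  comp_smul X Y Z f c g := LinearMap.map_smul (matComp X.obj Y.obj Z.obj f) c g

/-- The morphism spaces of `D ⊗ M_r(k)`. -/
def matHom (X Y : MatCat k D r) :
    (X ⟶ Y) ≃ₗ[k] (X.obj ⟶ Y.obj) ⊗[k] Matrix (Fin r) (Fin r) k :=
  LinearEquiv.refl k ((X.obj ⟶ Y.obj) ⊗[k] Matrix (Fin r) (Fin r) k)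

section Action

variable {H : Type v} [Ring H] [HopfAlgebra k H] [HCategory k H D]

/-- `h (f ⊗ B) = h f ⊗ B`. -/
def matAct (X Y : D) : H →ₐ[k] Module.End k ((X ⟶ Y) ⊗[k] Matrix (Fin r) (Fin r) k) :=
  (Module.End.rTensorAlgHom k (X ⟶ Y) (Matrix (Fin r) (Fin r) k)).comp
    (HCategory.act (k := k) (H := H) X Y)

theorem matAct_tmul {X Y : D} (h : H) (f : X ⟶ Y) (B : Matrix (Fin r) (Fin r) k) :
    matAct X Y h (f ⊗ₜ[k] B) = HCategory.act (k := k) (H := H) X Y h f ⊗ₜ B := rfl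

theorem matAct_id (X : D) (h : H) :
    matAct X X h (𝟙 X ⊗ₜ[k] (1 : Matrix (Fin r) (Fin r) k)) =
      Coalgebra.counit (R := k) h • (𝟙 X ⊗ₜ[k] (1 : Matrix (Fin r) (Fin r) k)) := by
  rw [matAct_tmul, HCategory.act_id, TensorProduct.smul_tmul']

theorem matAct_comp {X Y Z : D} (f : (X ⟶ Y) ⊗[k] Matrix (Fin r) (Fin r) k)
    (g : (Y ⟶ Z) ⊗[k] Matrix (Fin r) (Fin r) k) (h : H) :
    matAct X Z h (matComp X Y Z f g) =
      ∑ i ∈ (ℛ k h).index, matComp X Y Z (matAct X Y ((ℛ k h).right i) f)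
        (matAct Y Z ((ℛ k h).left i) g) := by
  induction f with
  | zero => simp
  | add a b ha hb => simp only [map_add, LinearMap.add_apply, ha, hb, Finset.sum_add_distrib]
  | tmul f B =>
    induction g with
    | zero => simp
    | add a b ha hb => simp only [map_add, ha, hb, Finset.sum_add_distrib]
    | tmul g C =>
      simp only [matComp_tmul, matAct_tmul, HCategory.act_comp, TensorProduct.sum_tmul]

instance : HCategory k H (MatCat k D r) where
  act X Y := matAct X.obj Y.obj
  act_id X h := matAct_id X.obj h
  act_comp f g h := matAct_comp f g h

end Action

/-- `inc_p` on morphisms, `f ↦ f ⊗ E_pp`. -/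
def incHom (p : Fin r) (X Y : D) : (X ⟶ Y) →ₗ[k] ((⟨X⟩ : MatCat k D r) ⟶ ⟨Y⟩) :=
  (matHom (⟨X⟩ : MatCat k D r) ⟨Y⟩).symm.toLinearMap ∘ₗ
    (TensorProduct.mk k (X ⟶ Y) (Matrix (Fin r) (Fin r) k)).flip (Matrix.single p p 1)

/-- `f⁰ ⊗ ⋯ ⊗ fⁿ ↦ (f⁰ ⊗ E_pp) ⊗ ⋯ ⊗ (fⁿ ⊗ E_pp)`. -/
def strInc (p : Fin r) : (n : ℕ) → (X Z : D) →
    Str k n X Z →ₗ[k] Str k n (⟨X⟩ : MatCat k D r) (⟨Z⟩ : MatCat k D r)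
  | 0, X, Z => (strZero k (⟨X⟩ : MatCat k D r) ⟨Z⟩).symm.toLinearMap ∘ₗ incHom p Z X ∘ₗ
      (strZero k X Z).toLinearMap
  | n + 1, X, Z => strLift k fun Y =>
      strCons k n (⟨X⟩ : MatCat k D r) ⟨Y⟩ ⟨Z⟩ ∘ₗ
        TensorProduct.map (incHom p Y X) (strInc p n Y Z)

/-- `(f⁰ ⊗ B⁰) ⊗ ⋯ ⊗ (fⁿ ⊗ Bⁿ) ↦ (f⁰ ⊗ ⋯ ⊗ fⁿ) ⊗ B⁰ ⋯ Bⁿ`. -/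
def strMat : (n : ℕ) → (X Z : MatCat k D r) →
    Str k n X Z →ₗ[k] Str k n X.obj Z.obj ⊗[k] Matrix (Fin r) (Fin r) k
  | 0, X, Z => (strZero k X.obj Z.obj).symm.toLinearMap.rTensor (Matrix (Fin r) (Fin r) k) ∘ₗ
      (matHom Z X).toLinearMap ∘ₗ (strZero k X Z).toLinearMap
  | n + 1, X, Z => strLift k fun Y =>
      TensorProduct.map (strCons k n X.obj Y.obj Z.obj)
          (LinearMap.mul' k (Matrix (Fin r) (Fin r) k)) ∘ₗ
        (TensorProduct.tensorTensorTensorComm k (Y.obj ⟶ X.obj) (Matrix (Fin r) (Fin r) k)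
          (Str k n Y.obj Z.obj) (Matrix (Fin r) (Fin r) k)).toLinearMap ∘ₗ
          TensorProduct.map (matHom Y X).toLinearMap (strMat n Y Z)

variable (k D) (M : Type w) [AddCommGroup M] [Module k M]

/-- The inclusion `m ⊗ f⁰ ⊗ ⋯ ⊗ fⁿ ↦ m ⊗ (f⁰ ⊗ E_pp) ⊗ ⋯ ⊗ (fⁿ ⊗ E_pp)`. -/
def chainInc (p : Fin r) (n : ℕ) : Chain k D M n →ₗ[k] Chain k (MatCat k D r) M n :=
  (cnLift k fun X => cnOf k n (⟨X⟩ : MatCat k D r) ∘ₗ strInc p n X X).lTensor M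

/-- The trace map
`m ⊗ (f⁰ ⊗ B⁰) ⊗ ⋯ ⊗ (fⁿ ⊗ Bⁿ) ↦ trace (B⁰ ⋯ Bⁿ) (m ⊗ f⁰ ⊗ ⋯ ⊗ fⁿ)`. -/
def chainTr (r n : ℕ) : Chain k (MatCat k D r) M n →ₗ[k] Chain k D M n :=
  (cnLift k fun X : MatCat k D r => cnOf k n X.obj ∘ₗ
    (TensorProduct.rid k (Str k n X.obj X.obj)).toLinearMap ∘ₗ
      (Matrix.traceLinearMap (Fin r) k k).lTensor (Str k n X.obj X.obj) ∘ₗ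
        strMat n X X).lTensor M

/-- `Hom (inc_p, k)`, that is `φ ↦ φ ∘ inc_p`. -/
def cochainInc (p : Fin r) (n : ℕ) : Cochain k (MatCat k D r) M n →ₗ[k] Cochain k D M n :=
  (chainInc k D M p n).dualMap

/-- `Hom (tr^M, k)`, that is `φ ↦ φ ∘ tr^M`. -/
def cochainTr (r n : ℕ) : Cochain k D M n →ₗ[k] Cochain k (MatCat k D r) M n :=
  (chainTr k D M r n).dualMap

end Matrices

end HopfCyclic

/-!
Everything is reduced to identities between linear maps on the additive cyclic nerve `CN`, which
are checked on strings of arrows by induction on the first arrow (`str_cons_induction`) or on the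
last one (`str_snoc_induction`).

*Structure maps.* The module `M` enters only through the operation `twist M G`, which sends
`m ⊗ x` to `m₍₀₎ ⊗ G(S⁻¹(m₍₋₁₎)) x`; twists compose by convolution (`twist_comp_twist`). The
cyclic operator is the twist of the rotation of strings, and the last face is the twist of
`cnLast`, so the simplicial and cyclic identities become statements about rotations twisted by an
element of `H` (`cnFace_succ_rot`, `conv_cnLast_rot`, `rotPow_full`). A cochain is `H`-linear if
and only if it is balanced over `H` (`mem_HCochain_iff`); that the cyclic operator preserves such
cochains is the anti-Yetter-Drinfeld condition, and that its power `n + 1` is the identity on them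
is stability.

*Hochschild cohomology.* On cochains `inc ∘ tr` is the identity. For `tr ∘ inc`, let
`e_q = id ⊗ E_qp` and `ε_q = id ⊗ E_pq`. They satisfy `∑ e_q ε_q = 1`, and `H` acts on them
through the counit. Inserting them between the arrows of a string gives a homotopy (`strHomotopy`)
that contracts the bar part of the Hochschild complex and that commutes with the last face up to
one summand. That summand is `∑ ε_c f⁰ e_{q₀} ⊗ ε_{q₀} f¹ e_{q₁} ⊗ ⋯ ⊗ ε_{qₙ₋₁} fⁿ e_c`, which is
the trace of the string followed by the inclusion (`cnConj_matCol_matRow`). Hence `tr ∘ inc` is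
homotopic to the identity of the Hochschild complex (`hochB_homotopy`).

*Hopf-cyclic cohomology.* The homotopy does not respect the cyclic operators, but this is not
needed. As `tr` is a section of `inc`, the map `1 - tr ∘ inc` projects the double complex of
`D ⊗ M_r(k)` onto the kernel of `inc`. Each column of this kernel is acyclic: the even columns by
the homotopy above, the odd ones because the complex of `b'` is contracted by inserting an
identity in front of a string (`cocycles_hochB'_le`). A first quadrant double complex with acyclic
columns has an acyclic total complex (`IsDoubleComplex.cocycles_totSub_le`), so every total
cocycle `z` differs from `tr (inc z)` by a coboundary.
-/

namespace HopfCyclic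

/-! ### Sweedler sums, the inverse antipode and twisting by the coaction -/

section Sweedler

variable {k : Type u} [Field k] {H : Type v} [Ring H] [HopfAlgebra k H]

/-- Evaluation of a bilinear map on `Δ(h)`, as a Sweedler sum. -/
theorem lift_comul {N : Type*} [AddCommGroup N] [Module k N] (F : H →ₗ[k] H →ₗ[k] N) (h : H) :
    TensorProduct.lift F (Coalgebra.comul (R := k) h) =
      ∑ i ∈ (ℛ k h).index, F ((ℛ k h).left i) ((ℛ k h).right i) := by
  conv_lhs => rw [← (ℛ k h).eq]
  simp

/-- Coassociativity for Sweedler sums of a trilinear expression `F h₁ h₂ h₃`. -/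
theorem sum_coassoc {N : Type*} [AddCommGroup N] [Module k N] (F : H →ₗ[k] H →ₗ[k] H →ₗ[k] N)
    (h : H) :
    ∑ i ∈ (ℛ k h).index, ∑ j ∈ (ℛ k ((ℛ k h).left i)).index,
      F ((ℛ k ((ℛ k h).left i)).left j) ((ℛ k ((ℛ k h).left i)).right j) ((ℛ k h).right i) =
    ∑ i ∈ (ℛ k h).index, ∑ j ∈ (ℛ k ((ℛ k h).right i)).index,
      F ((ℛ k h).left i) ((ℛ k ((ℛ k h).right i)).left j) ((ℛ k ((ℛ k h).right i)).right j) := by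
  have := congrArg (TensorProduct.lift (TensorProduct.uncurry (.id k) H H N ∘ₗ F))
    (Coalgebra.sum_tmul_tmul_eq (ℛ k h) (fun i => ℛ k ((ℛ k h).left i))
      (fun i => ℛ k ((ℛ k h).right i)))
  simpa using this

theorem sum_counit_smul_left (h : H) :
    ∑ i ∈ (ℛ k h).index, Coalgebra.counit (R := k) ((ℛ k h).right i) • (ℛ k h).left i = h := by
  have := congrArg (TensorProduct.rid k H) (Coalgebra.sum_tmul_counit_eq (ℛ k h))
  simpa only [map_sum, TensorProduct.rid_tmul, one_smul] using this

/-- A trilinear map, given by a function that is linear in each variable. -/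
def mkTrilinear {A B C N : Type*} [AddCommMonoid A] [Module k A] [AddCommMonoid B] [Module k B]
    [AddCommMonoid C] [Module k C] [AddCommMonoid N] [Module k N] (F : A → B → C → N)
    (h₁ : ∀ a a' b c, F (a + a') b c = F a b c + F a' b c)
    (h₂ : ∀ (r : k) a b c, F (r • a) b c = r • F a b c)
    (h₃ : ∀ a b b' c, F a (b + b') c = F a b c + F a b' c)
    (h₄ : ∀ (r : k) a b c, F a (r • b) c = r • F a b c)
    (h₅ : ∀ a b c c', F a b (c + c') = F a b c + F a b c')
    (h₆ : ∀ (r : k) a b c, F a b (r • c) = r • F a b c) : A →ₗ[k] B →ₗ[k] C →ₗ[k] N where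
  toFun a := LinearMap.mk₂ k (F a) (h₃ a) (fun r b c => h₄ r a b c) (h₅ a)
    (fun r b c => h₆ r a b c)
  map_add' a a' := by ext b c; exact h₁ a a' b c
  map_smul' r a := by ext b c; exact h₂ r a b c

/-- The linear map out of `A ⊗ (B ⊗ C)` given by a trilinear map. -/
def lift₃ {A B C N : Type*} [AddCommMonoid A] [Module k A] [AddCommMonoid B] [Module k B]
    [AddCommMonoid C] [Module k C] [AddCommMonoid N] [Module k N]
    (F : A →ₗ[k] B →ₗ[k] C →ₗ[k] N) : A ⊗[k] (B ⊗[k] C) →ₗ[k] N :=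
  TensorProduct.lift (TensorProduct.uncurry (.id k) B C N ∘ₗ F)

@[simp]
theorem lift₃_tmul {A B C N : Type*} [AddCommMonoid A] [Module k A] [AddCommMonoid B]
    [Module k B] [AddCommMonoid C] [Module k C] [AddCommMonoid N] [Module k N]
    (F : A →ₗ[k] B →ₗ[k] C →ₗ[k] N) (a : A) (b : B) (c : C) :
    lift₃ F (a ⊗ₜ (b ⊗ₜ c)) = F a b c := by
  simp [lift₃]

/-- The antipode is an anti-morphism of coalgebras: both sides are convolution inverses of `Δ`. -/
theorem comul_antipode (h : H) :
    Coalgebra.comul (R := k) (HopfAlgebra.antipode k h) =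
      TensorProduct.map (HopfAlgebra.antipode k) (HopfAlgebra.antipode k)
        (TensorProduct.comm k H H (Coalgebra.comul (R := k) h)) := by
  let G : H →ₗ[k] H ⊗[k] H :=
    TensorProduct.map (HopfAlgebra.antipode k) (HopfAlgebra.antipode k) ∘ₗ
      (TensorProduct.comm k H H).toLinearMap ∘ₗ Coalgebra.comul
  have hG : WithConv.toConv G * WithConv.toConv (Coalgebra.comul (R := k) (A := H)) = 1 := by
    ext h
    rw [(ℛ k h).convMul_apply]
    simp only [LinearMap.convOne_apply, G, LinearMap.comp_apply,
      LinearEquiv.coe_coe]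
    let F : H →ₗ[k] H →ₗ[k] H →ₗ[k] H ⊗[k] H :=
      mkTrilinear (fun a b c =>
        (HopfAlgebra.antipode k b ⊗ₜ[k] HopfAlgebra.antipode k a) * Coalgebra.comul (R := k) c)
        (by simp [TensorProduct.tmul_add, add_mul]) (by simp)
        (by simp [TensorProduct.add_tmul, add_mul])
        (fun r a b c => by rw [map_smul, ← TensorProduct.smul_tmul', smul_mul_assoc])
        (by simp [mul_add]) (by simp)
    have hF : ∀ a b c, F a b c =
        (HopfAlgebra.antipode k b ⊗ₜ[k] HopfAlgebra.antipode k a) *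
          Coalgebra.comul (R := k) c := fun _ _ _ => rfl
    have h₁ : ∀ a b : H, TensorProduct.map (HopfAlgebra.antipode k) (HopfAlgebra.antipode k)
        (TensorProduct.comm k H H (Coalgebra.comul (R := k) a)) * Coalgebra.comul (R := k) b =
        ∑ j ∈ (ℛ k a).index, F ((ℛ k a).left j) ((ℛ k a).right j) b := by
      intro a b
      conv_lhs => rw [← (ℛ k a).eq]
      simp [hF, Finset.sum_mul]
    have h₂ : ∀ a b : H, ∑ j ∈ (ℛ k b).index, F a ((ℛ k b).left j) ((ℛ k b).right j) =
        1 ⊗ₜ (HopfAlgebra.antipode k a * b) := by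
      intro a b
      let F' : H →ₗ[k] H →ₗ[k] H →ₗ[k] H ⊗[k] H :=
        mkTrilinear (fun b c d =>
          (HopfAlgebra.antipode k b * c) ⊗ₜ[k] (HopfAlgebra.antipode k a * d))
          (by simp [TensorProduct.add_tmul, add_mul]) (by simp [TensorProduct.smul_tmul'])
          (by simp [TensorProduct.add_tmul, mul_add]) (by simp [TensorProduct.smul_tmul'])
          (by simp [TensorProduct.tmul_add, mul_add]) (by simp)
      have hF' : ∀ b c d, F' b c d =
          (HopfAlgebra.antipode k b * c) ⊗ₜ[k] (HopfAlgebra.antipode k a * d) := fun _ _ _ => rfl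
      calc _ = ∑ j ∈ (ℛ k b).index, ∑ l ∈ (ℛ k ((ℛ k b).right j)).index,
            F' ((ℛ k b).left j) ((ℛ k ((ℛ k b).right j)).left l)
              ((ℛ k ((ℛ k b).right j)).right l) := by
            refine Finset.sum_congr rfl fun j _ => ?_
            simp only [hF]
            conv_lhs => rw [← (ℛ k ((ℛ k b).right j)).eq]
            simp [hF', Finset.mul_sum]
        _ = 1 ⊗ₜ (HopfAlgebra.antipode k a * b) := by
            rw [← sum_coassoc]
            simp only [hF', ← TensorProduct.sum_tmul,
              HopfAlgebra.sum_antipode_mul_eq_smul, ← TensorProduct.smul_tmul',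
              ← TensorProduct.tmul_smul, ← mul_smul_comm, ← TensorProduct.tmul_sum,
              ← Finset.mul_sum, Coalgebra.sum_counit_smul]
    simp only [h₁]
    rw [sum_coassoc F h]
    simp only [h₂, ← TensorProduct.tmul_sum, HopfAlgebra.sum_antipode_mul_eq_smul]
    simp [Algebra.algebraMap_eq_smul_one, Algebra.TensorProduct.one_def]
  exact (LinearMap.congr_fun (WithConv.toConv_injective
    (left_inv_eq_right_inv hG LinearMap.comul_right_inv)) h).symm

variable [BijectiveAntipode k H]

variable (k) in
theorem antipode_antipodeInv (h : H) : HopfAlgebra.antipode k (antipodeInv k H h) = h :=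
  LinearEquiv.apply_symm_apply (LinearEquiv.ofBijective (HopfAlgebra.antipode k (A := H))
    BijectiveAntipode.bijective) h

variable (k) in
theorem antipodeInv_antipode (h : H) : antipodeInv k H (HopfAlgebra.antipode k h) = h :=
  LinearEquiv.symm_apply_apply (LinearEquiv.ofBijective (HopfAlgebra.antipode k (A := H))
    BijectiveAntipode.bijective) h

variable (k) in
theorem counit_antipodeInv (h : H) :
    Coalgebra.counit (R := k) (antipodeInv k H h) = Coalgebra.counit (R := k) h := by
  rw [← HopfAlgebra.counit_antipode, antipode_antipodeInv]

variable (k) in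
theorem antipodeInv_mul (g h : H) :
    antipodeInv k H (g * h) = antipodeInv k H h * antipodeInv k H g := by
  apply (BijectiveAntipode.bijective (k := k) (H := H)).injective
  rw [HopfAlgebra.antipode_mul_antidistrib]
  simp only [antipode_antipodeInv]

theorem comul_antipodeInv (h : H) :
    Coalgebra.comul (R := k) (antipodeInv k H h) =
      TensorProduct.map (antipodeInv k H) (antipodeInv k H)
        (TensorProduct.comm k H H (Coalgebra.comul (R := k) h)) := by
  conv_rhs => rw [← antipode_antipodeInv k h, comul_antipode]
  generalize Coalgebra.comul (R := k) (antipodeInv k H h) = t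
  induction t with
  | zero => simp
  | add a b ha hb => simp only [map_add, ← ha, ← hb]
  | tmul a b => simp [antipodeInv_antipode]

/-- The identity `h₂ S⁻¹(h₁) = ε(h)`. -/
theorem sum_mul_antipodeInv (h : H) :
    ∑ i ∈ (ℛ k h).index, (ℛ k h).right i * antipodeInv k H ((ℛ k h).left i) =
      Coalgebra.counit (R := k) h • (1 : H) := by
  apply (BijectiveAntipode.bijective (k := k) (H := H)).injective
  simp only [map_sum, HopfAlgebra.antipode_mul_antidistrib, antipode_antipodeInv, map_smul,
    HopfAlgebra.antipode_one]
  exact HopfAlgebra.sum_mul_antipode_eq_smul _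

end Sweedler

section RightAction

variable {k : Type u} [Field k] {H : Type v} [Ring H] [HopfAlgebra k H]
  {M : Type w} [AddCommGroup M] [Module k M] [SAYDModule k H M]

theorem rightAct_apply (h : H) (m : M) :
    rightAct k H M h m = SAYDModule.act (k := k) (H := H) (.op h) m := rfl

theorem rightAct_mul (g h : H) (m : M) :
    rightAct k H M (g * h) m = rightAct k H M h (rightAct k H M g m) := by
  simp [rightAct_apply]

theorem rightAct_one (m : M) : rightAct k H M 1 m = m := by
  simp [rightAct_apply]

end RightAction

section Twist

variable {k : Type u} [Field k] {H : Type v} [Ring H] [HopfAlgebra k H]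
  {A B C : Type*} [AddCommGroup A] [Module k A] [AddCommGroup B] [Module k B]
  [AddCommGroup C] [Module k C]

/-- The convolution product `h ↦ F(h₁) ∘ G(h₂)` of families of linear maps indexed by `H`. -/
def conv (F : H →ₗ[k] B →ₗ[k] C) (G : H →ₗ[k] A →ₗ[k] B) : H →ₗ[k] A →ₗ[k] C :=
  TensorProduct.lift ((LinearMap.llcomp k A B C).compl₁₂ F G) ∘ₗ Coalgebra.comul

theorem conv_apply (F : H →ₗ[k] B →ₗ[k] C) (G : H →ₗ[k] A →ₗ[k] B) (h : H) (x : A) :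
    conv F G h x = ∑ i ∈ (ℛ k h).index, F ((ℛ k h).left i) (G ((ℛ k h).right i) x) := by
  rw [conv, LinearMap.comp_apply, lift_comul]
  simp

variable [BijectiveAntipode k H] {M : Type w} [AddCommGroup M] [Module k M]

/-- `m ⊗ x ↦ m₍₀₎ ⊗ G(S⁻¹(m₍₋₁₎)) x`. -/
def twist (M : Type w) [AddCommGroup M] [Module k M] [SAYDModule k H M]
    (G : H →ₗ[k] A →ₗ[k] B) : M ⊗[k] A →ₗ[k] M ⊗[k] B :=
  TensorProduct.lift (LinearMap.lTensorHom M ∘ₗ G ∘ₗ antipodeInv k H) ∘ₗ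
    (TensorProduct.assoc k H M A).toLinearMap ∘ₗ
      (SAYDModule.coact (k := k) (H := H) (M := M)).rTensor A

/-- The value of `twist` on pure tensors, as a linear map applied to the coaction. -/
def twistAux (M : Type w) [AddCommGroup M] [Module k M]
    (G : H →ₗ[k] A →ₗ[k] B) (x : A) : H ⊗[k] M →ₗ[k] M ⊗[k] B :=
  TensorProduct.lift ((TensorProduct.mk k M B).flip ∘ₗ (G.flip x) ∘ₗ antipodeInv k H)

@[simp]
theorem twistAux_tmul (G : H →ₗ[k] A →ₗ[k] B) (x : A) (h : H) (m : M) :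
    twistAux M G x (h ⊗ₜ m) = m ⊗ₜ G (antipodeInv k H h) x := by
  simp [twistAux]

variable [SAYDModule k H M]

theorem twist_tmul (G : H →ₗ[k] A →ₗ[k] B) (m : M) (x : A) :
    twist M G (m ⊗ₜ x) = twistAux M G x (SAYDModule.coact (k := k) (H := H) m) := by
  rw [twist, LinearMap.comp_apply, LinearMap.comp_apply, LinearMap.rTensor_tmul]
  generalize SAYDModule.coact (k := k) (H := H) m = t
  induction t with
  | zero => simp
  | add a b ha hb => rw [TensorProduct.add_tmul, map_add, map_add, map_add, ha, hb]
  | tmul h m => simp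

theorem twist_comp_lTensor (G : H →ₗ[k] B →ₗ[k] C) (f : A →ₗ[k] B) :
    twist M G ∘ₗ f.lTensor M = twist M (G.compl₂ f) := by
  ext m x
  simp only [TensorProduct.AlgebraTensorModule.curry_apply, TensorProduct.curry_apply,
    LinearMap.coe_restrictScalars, LinearMap.comp_apply, LinearMap.lTensor_tmul, twist_tmul]
  generalize SAYDModule.coact (k := k) (H := H) m = t
  induction t with
  | zero => simp
  | add a b ha hb => rw [map_add, map_add, ha, hb]
  | tmul h m => simp

theorem lTensor_comp_twist (G : H →ₗ[k] A →ₗ[k] B) (f : B →ₗ[k] C) :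
    f.lTensor M ∘ₗ twist M G = twist M (G.compr₂ f) := by
  ext m x
  simp only [TensorProduct.AlgebraTensorModule.curry_apply, TensorProduct.curry_apply,
    LinearMap.coe_restrictScalars, LinearMap.comp_apply, twist_tmul]
  generalize SAYDModule.coact (k := k) (H := H) m = t
  induction t with
  | zero => simp
  | add a b ha hb => rw [map_add, map_add, map_add, ha, hb]
  | tmul h m => simp

theorem twist_add (F G : H →ₗ[k] A →ₗ[k] B) : twist M (F + G) = twist M F + twist M G := by
  ext m x
  simp only [TensorProduct.AlgebraTensorModule.curry_apply, TensorProduct.curry_apply,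
    LinearMap.coe_restrictScalars, LinearMap.add_apply, twist_tmul]
  generalize SAYDModule.coact (k := k) (H := H) m = t
  induction t with
  | zero => simp
  | add a b ha hb => rw [map_add, map_add, map_add, ha, hb, add_add_add_comm]
  | tmul h m => simp [TensorProduct.tmul_add]

theorem twist_smul (c : k) (G : H →ₗ[k] A →ₗ[k] B) : twist M (c • G) = c • twist M G := by
  ext m x
  simp only [TensorProduct.AlgebraTensorModule.curry_apply, TensorProduct.curry_apply,
    LinearMap.coe_restrictScalars, LinearMap.smul_apply, twist_tmul]
  generalize SAYDModule.coact (k := k) (H := H) m = t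
  induction t with
  | zero => simp
  | add a b ha hb => rw [map_add, map_add, ha, hb, smul_add]
  | tmul h m => simp

/-- Twisting by `h ↦ ε(h) f` does nothing to `M`, by counitality of the coaction. -/
theorem twist_counit (f : A →ₗ[k] B) :
    twist M ((Coalgebra.counit (R := k) (A := H)).smulRight f) = f.lTensor M := by
  ext m x
  simp only [TensorProduct.AlgebraTensorModule.curry_apply, TensorProduct.curry_apply,
    LinearMap.coe_restrictScalars, twist_tmul, LinearMap.lTensor_tmul]
  conv_rhs => rw [← LinearMap.id_apply (R := k) m, ← SAYDModule.counit_coact (k := k) (H := H)]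
  simp only [LinearMap.comp_apply]
  generalize SAYDModule.coact (k := k) (H := H) m = t
  induction t with
  | zero => simp
  | add a b ha hb => rw [map_add, map_add, map_add, ha, hb, TensorProduct.add_tmul]
  | tmul h m => simp [counit_antipodeInv, TensorProduct.smul_tmul]

/-- Coassociativity of the coaction turns composition of twists into convolution; the two factors
keep their order because `S⁻¹` reverses the comultiplication. -/
theorem twist_comp_twist (F : H →ₗ[k] B →ₗ[k] C) (G : H →ₗ[k] A →ₗ[k] B) :
    twist M F ∘ₗ twist M G = twist M (conv F G) := by
  ext m x
  simp only [TensorProduct.AlgebraTensorModule.curry_apply, TensorProduct.curry_apply,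
    LinearMap.coe_restrictScalars, LinearMap.comp_apply, twist_tmul]
  let Θ : H ⊗[k] (H ⊗[k] M) →ₗ[k] M ⊗[k] C :=
    lift₃ (mkTrilinear (fun a b m => m ⊗ₜ[k] F (antipodeInv k H b) (G (antipodeInv k H a) x))
      (by simp [TensorProduct.tmul_add]) (by simp) (by simp [TensorProduct.tmul_add]) (by simp)
      (by simp [TensorProduct.add_tmul]) (by simp [TensorProduct.smul_tmul']))
  have hΘ : ∀ a b m, Θ (a ⊗ₜ (b ⊗ₜ m)) =
      m ⊗ₜ[k] F (antipodeInv k H b) (G (antipodeInv k H a) x) := fun a b m =>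
    lift₃_tmul _ a b m
  have h₁ : ∀ t : H ⊗[k] M, twist M F (twistAux M G x t) =
      Θ ((SAYDModule.coact (k := k) (H := H) (M := M)).lTensor H t) := by
    intro t
    induction t with
    | zero => simp
    | add a b ha hb => simp only [map_add, ha, hb]
    | tmul h m =>
      rw [twistAux_tmul, twist_tmul, LinearMap.lTensor_tmul]
      generalize SAYDModule.coact (k := k) (H := H) m = t
      induction t with
      | zero => simp
      | add a b ha hb => simp only [TensorProduct.tmul_add, map_add, ha, hb]
      | tmul h m => rw [hΘ, twistAux_tmul]
  have h₂ : ∀ t : H ⊗[k] M, twistAux M (conv F G) x t =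
      Θ (TensorProduct.assoc k H H M
        ((Coalgebra.comul (R := k) (A := H)).rTensor M t)) := by
    intro t
    induction t with
    | zero => simp
    | add a b ha hb => simp only [map_add, ha, hb]
    | tmul h m =>
      rw [twistAux_tmul, LinearMap.rTensor_tmul, conv, LinearMap.comp_apply, comul_antipodeInv]
      generalize Coalgebra.comul (R := k) h = t
      induction t with
      | zero => simp
      | add a b ha hb =>
        simp only [TensorProduct.tmul_add, TensorProduct.add_tmul, map_add, LinearMap.add_apply,
          ha, hb]
      | tmul a b => simp [hΘ]
  rw [h₁, h₂]
  have := LinearMap.congr_fun (SAYDModule.coassoc (k := k) (H := H) (M := M)) m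
  simp only [LinearMap.comp_apply, LinearEquiv.coe_coe] at this
  rw [this]

/-- Stability in its inverse form `m₍₀₎ S⁻¹(m₍₋₁₎) = m`. -/
theorem stable_antipodeInv (m : M) :
    TensorProduct.lift (rightAct k H M ∘ₗ antipodeInv k H)
      (SAYDModule.coact (k := k) (H := H) m) = m := by
  let Θ : H ⊗[k] (H ⊗[k] M) →ₗ[k] M :=
    lift₃ (mkTrilinear (fun a b m => rightAct k H M (antipodeInv k H a) (rightAct k H M b m))
      (by simp) (by simp) (by simp) (by simp) (by simp) (by simp))
  have hΘ : ∀ a b m, Θ (a ⊗ₜ (b ⊗ₜ m)) =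
      rightAct k H M (antipodeInv k H a) (rightAct k H M b m) := fun a b m =>
    lift₃_tmul _ a b m
  have h₁ : ∀ t : H ⊗[k] M, TensorProduct.lift (rightAct k H M ∘ₗ antipodeInv k H) t =
      Θ ((SAYDModule.coact (k := k) (H := H) (M := M)).lTensor H t) := by
    intro t
    induction t with
    | zero => simp
    | add a b ha hb => simp only [map_add, ha, hb]
    | tmul h m =>
      rw [LinearMap.lTensor_tmul, TensorProduct.lift.tmul]
      conv_lhs => rw [← SAYDModule.stable (k := k) (H := H) m]
      generalize SAYDModule.coact (k := k) (H := H) m = t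
      induction t with
      | zero => simp
      | add a b ha hb => simp only [TensorProduct.tmul_add, map_add, ha, hb]
      | tmul g m => rw [hΘ]; simp [rightAct_apply]
  have h₂ : ∀ t : H ⊗[k] M, TensorProduct.lid k M
      ((Coalgebra.counit (R := k) (A := H)).rTensor M t) =
      Θ (TensorProduct.assoc k H H M
        ((Coalgebra.comul (R := k) (A := H)).rTensor M t)) := by
    intro t
    induction t with
    | zero => simp
    | add a b ha hb => simp only [map_add, ha, hb]
    | tmul h m =>
      rw [LinearMap.rTensor_tmul, LinearMap.rTensor_tmul, TensorProduct.lid_tmul,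
        ← (ℛ k h).eq]
      simp only [TensorProduct.sum_tmul, map_sum, TensorProduct.assoc_tmul, hΘ,
        ← rightAct_mul]
      rw [← LinearMap.sum_apply, ← map_sum, sum_mul_antipodeInv, map_smul, LinearMap.smul_apply,
        rightAct_one]
  have h₃ := LinearMap.congr_fun (SAYDModule.coassoc (k := k) (H := H) (M := M)) m
  have h₄ := LinearMap.congr_fun (SAYDModule.counit_coact (k := k) (H := H) (M := M)) m
  simp only [LinearMap.comp_apply, LinearEquiv.coe_coe, LinearMap.id_apply] at h₃ h₄
  rw [h₁, ← h₃, ← h₂, h₄]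

end Twist

/-! ### Strings of composable morphisms -/

section Strings

variable (k : Type u) [Field k] {D : Type u} [SmallCategory D] [Preadditive D] [Linear k D]

variable {k} in
@[simp]
theorem strLift_cons {n : ℕ} {X Y Z : D} {N : Type*} [AddCommGroup N] [Module k N]
    (φ : ∀ Y : D, (Y ⟶ X) ⊗[k] Str k n Y Z →ₗ[k] N) (t : (Y ⟶ X) ⊗[k] Str k n Y Z) :
    strLift k φ (strCons k n X Y Z t) = φ Y t := by
  simp [strLift, strCons]

variable {k} in
@[simp]
theorem cnLift_of {n : ℕ} {N : Type*} [AddCommGroup N] [Module k N]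
    (φ : ∀ X : D, Str k n X X →ₗ[k] N) (X : D) (x : Str k n X X) :
    cnLift k φ (cnOf k n X x) = φ X x := by
  simp [cnLift, cnOf]

variable {k} in
theorem str_zero_induction {X Z : D} {P : Str k 0 X Z → Prop}
    (h : ∀ f : Z ⟶ X, P ((strZero k X Z).symm f)) (x : Str k 0 X Z) : P x := by
  simpa using h (strZero k X Z x)

variable {k} in
theorem str_cons_induction {n : ℕ} {X Z : D} {P : Str k (n + 1) X Z → Prop}
    (add : ∀ x y, P x → P y → P (x + y))
    (cons : ∀ (Y : D) (f : Y ⟶ X) (p : Str k n Y Z), P (strCons k n X Y Z (f ⊗ₜ p)))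
    (x : Str k (n + 1) X Z) : P x := by
  classical
  have zero : P 0 := by simpa using cons X 0 0
  suffices ∀ y : ⨁ Y : D, (Y ⟶ X) ⊗[k] Str k n Y Z, P ((strSucc k n X Z).symm y) by
    simpa using this (strSucc k n X Z x)
  intro y
  induction y using DirectSum.induction_on with
  | zero => simpa using zero
  | add a b ha hb => rw [map_add]; exact add _ _ ha hb
  | of Y t =>
    induction t with
    | zero => simpa using zero
    | add a b ha hb => rw [map_add, map_add]; exact add _ _ ha hb
    | tmul f p =>
      convert cons Y f p using 1
      simp only [strCons, LinearMap.comp_apply, LinearEquiv.coe_coe]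
      congr!

variable {k} in
theorem cn_induction {n : ℕ} {P : CN k D n → Prop} (zero : P 0)
    (add : ∀ x y, P x → P y → P (x + y))
    (of : ∀ (X : D) (x : Str k n X X), P (cnOf k n X x)) (x : CN k D n) : P x := by
  classical
  induction x using DirectSum.induction_on with
  | zero => exact zero
  | add a b ha hb => exact add _ _ ha hb
  | of X t =>
    convert of X t using 1
    simp only [cnOf, DirectSum.lof_eq_of]

variable {k} in
theorem cn_hom_ext {n : ℕ} {N : Type*} [AddCommGroup N] [Module k N] {f g : CN k D n →ₗ[k] N}
    (h : ∀ (X : D) (x : Str k n X X), f (cnOf k n X x) = g (cnOf k n X x)) : f = g := by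
  ext1 x
  induction x using cn_induction with
  | zero => simp
  | add x y hx hy => rw [map_add, map_add, hx, hy]
  | of X x => exact h X x

@[simp]
theorem strMul_zero {X Y Z : D} (f : Y ⟶ X) (g : Z ⟶ Y) :
    strMul k 0 X Y Z f ((strZero k Y Z).symm g) = (strZero k X Z).symm (g ≫ f) := by
  simp [strMul]

@[simp]
theorem strMul_cons (n : ℕ) {X Y W Z : D} (f : Y ⟶ X) (g : W ⟶ Y) (p : Str k n W Z) :
    strMul k (n + 1) X Y Z f (strCons k n Y W Z (g ⊗ₜ p)) =
      strCons k n X W Z ((g ≫ f) ⊗ₜ p) := by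
  simp [strMul, strLift₂]

@[simp]
theorem strFace_zero_cons (n : ℕ) {X Y Z : D} (f : Y ⟶ X) (p : Str k n Y Z) :
    strFace k n 0 X Z (strCons k n X Y Z (f ⊗ₜ p)) = strMul k n X Y Z f p := by
  cases n <;> simp [strFace]

@[simp]
theorem strFace_succ_cons (n i : ℕ) {X Y Z : D} (f : Y ⟶ X) (p : Str k (n + 1) Y Z) :
    strFace k (n + 1) (i + 1) X Z (strCons k (n + 1) X Y Z (f ⊗ₜ p)) =
      strCons k n X Y Z (f ⊗ₜ strFace k n i Y Z p) := by
  simp [strFace]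

@[simp]
theorem strDegen_zero_zero {X Z : D} (f : Z ⟶ X) :
    strDegen k 0 0 X Z ((strZero k X Z).symm f) =
      strCons k 0 X Z Z (f ⊗ₜ (strZero k Z Z).symm (𝟙 Z)) := by
  simp [strDegen]

@[simp]
theorem strDegen_zero_cons (n : ℕ) {X Y Z : D} (f : Y ⟶ X) (p : Str k n Y Z) :
    strDegen k (n + 1) 0 X Z (strCons k n X Y Z (f ⊗ₜ p)) =
      strCons k (n + 1) X Y Z (f ⊗ₜ strCons k n Y Y Z (𝟙 Y ⊗ₜ p)) := by
  simp [strDegen]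

@[simp]
theorem strDegen_succ_cons (n i : ℕ) {X Y Z : D} (f : Y ⟶ X) (p : Str k n Y Z) :
    strDegen k (n + 1) (i + 1) X Z (strCons k n X Y Z (f ⊗ₜ p)) =
      strCons k (n + 1) X Y Z (f ⊗ₜ strDegen k n i Y Z p) := by
  simp [strDegen]

/-- `f⁰ ⊗ ⋯ ⊗ fⁿ ↦ (fⁿ⁺¹ ↦ f⁰ ⊗ ⋯ ⊗ fⁿ ⊗ fⁿ⁺¹)`, appending an arrow to a string. -/
def strSnoc : (n : ℕ) → (X Y Z : D) → Str k n X Y →ₗ[k] (Z ⟶ Y) →ₗ[k] Str k (n + 1) X Z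
  | 0, X, Y, Z => ((TensorProduct.mk k (Y ⟶ X) (Str k 0 Y Z)).compr₂ (strCons k 0 X Y Z)).compl₁₂
      (strZero k X Y).toLinearMap (strZero k Y Z).symm.toLinearMap
  | n + 1, X, Y, Z => strLift k fun W => TensorProduct.lift
      ((LinearMap.llcomp k _ _ _ ∘ₗ
        (TensorProduct.mk k (W ⟶ X) (Str k (n + 1) W Z)).compr₂ (strCons k (n + 1) X W Z)).compl₂
          (strSnoc n W Y Z))

@[simp]
theorem strSnoc_zero {X Y Z : D} (f : Y ⟶ X) (g : Z ⟶ Y) :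
    strSnoc k 0 X Y Z ((strZero k X Y).symm f) g =
      strCons k 0 X Y Z (f ⊗ₜ (strZero k Y Z).symm g) := by
  simp [strSnoc]

@[simp]
theorem strSnoc_cons (n : ℕ) {X Y W Z : D} (f : W ⟶ X) (p : Str k n W Y) (g : Z ⟶ Y) :
    strSnoc k (n + 1) X Y Z (strCons k n X W Y (f ⊗ₜ p)) g =
      strCons k (n + 1) X W Z (f ⊗ₜ strSnoc k n W Y Z p g) := by
  simp [strSnoc]

/-- `f⁰ ⊗ ⋯ ⊗ fⁿ ↦ (g ↦ f⁰ ⊗ ⋯ ⊗ fⁿ g)`. -/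
def strMulR : (n : ℕ) → (X Y Z : D) → Str k n X Y →ₗ[k] (Z ⟶ Y) →ₗ[k] Str k n X Z
  | 0, X, Y, Z => ((Linear.comp (S := k) Z Y X).flip.compr₂ (strZero k X Z).symm.toLinearMap) ∘ₗ
      (strZero k X Y).toLinearMap
  | n + 1, X, Y, Z => strLift k fun W => TensorProduct.lift
      ((LinearMap.llcomp k _ _ _ ∘ₗ
        (TensorProduct.mk k (W ⟶ X) (Str k n W Z)).compr₂ (strCons k n X W Z)).compl₂
          (strMulR n W Y Z))

@[simp]
theorem strMulR_zero {X Y Z : D} (f : Y ⟶ X) (g : Z ⟶ Y) :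
    strMulR k 0 X Y Z ((strZero k X Y).symm f) g = (strZero k X Z).symm (g ≫ f) := by
  simp [strMulR]

@[simp]
theorem strMulR_cons (n : ℕ) {X Y W Z : D} (f : W ⟶ X) (p : Str k n W Y) (g : Z ⟶ Y) :
    strMulR k (n + 1) X Y Z (strCons k n X W Y (f ⊗ₜ p)) g =
      strCons k n X W Z (f ⊗ₜ strMulR k n W Y Z p g) := by
  simp [strMulR]

open Classical in
theorem strUnsnoc_snoc (n : ℕ) {X Y Z : D} (p : Str k n X Y) (f : Z ⟶ Y) :
    strUnsnoc k n X Z (strSnoc k n X Y Z p f) =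
      DirectSum.lof k D (fun Y : D => Str k n X Y ⊗[k] (Z ⟶ Y)) Y (p ⊗ₜ f) := by
  induction n generalizing X with
  | zero =>
    induction p using str_zero_induction with
    | h g => simp [strUnsnoc]
  | succ n ih =>
    induction p using str_cons_induction with
    | add x y hx hy => simp only [map_add, LinearMap.add_apply, TensorProduct.add_tmul, hx, hy]
    | cons W g p => simp [strUnsnoc, ih]

variable {k} in
theorem str_snoc_induction {n : ℕ} {X Z : D} {P : Str k (n + 1) X Z → Prop}
    (add : ∀ x y, P x → P y → P (x + y))
    (snoc : ∀ (Y : D) (p : Str k n X Y) (f : Z ⟶ Y), P (strSnoc k n X Y Z p f))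
    (x : Str k (n + 1) X Z) : P x := by
  induction n generalizing X with
  | zero =>
    induction x using str_cons_induction with
    | add x y hx hy => exact add x y hx hy
    | cons Y f p =>
      induction p using str_zero_induction with
      | h g => simpa using snoc Y ((strZero k X Y).symm f) g
  | succ n ih =>
    induction x using str_cons_induction with
    | add x y hx hy => exact add x y hx hy
    | cons Y f p =>
      refine ih (P := fun p => P (strCons k (n + 1) X Y Z (f ⊗ₜ p))) ?_ ?_ p
      · intro x y hx hy
        rw [TensorProduct.tmul_add, map_add]
        exact add _ _ hx hy
      · intro W q g
        simpa using snoc W (strCons k n X Y W (f ⊗ₜ q)) g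

theorem strMul_strMul (n : ℕ) {X Y W Z : D} (f : Y ⟶ X) (g : W ⟶ Y) (p : Str k n W Z) :
    strMul k n X Y Z f (strMul k n Y W Z g p) = strMul k n X W Z (g ≫ f) p := by
  cases n with
  | zero =>
    induction p using str_zero_induction with
    | h h => simp
  | succ n =>
    induction p using str_cons_induction with
    | add x y hx hy => simp only [map_add, hx, hy]
    | cons V h p => simp

@[simp]
theorem strMul_one (n : ℕ) {X Z : D} (p : Str k n X Z) : strMul k n X X Z (𝟙 X) p = p := by
  cases n with
  | zero =>
    induction p using str_zero_induction with
    | h h => simp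
  | succ n =>
    induction p using str_cons_induction with
    | add x y hx hy => simp only [map_add, hx, hy]
    | cons V h p => simp

theorem strMul_snoc (n : ℕ) {X Y W Z : D} (f : Y ⟶ X) (p : Str k n Y W) (g : Z ⟶ W) :
    strMul k (n + 1) X Y Z f (strSnoc k n Y W Z p g) =
      strSnoc k n X W Z (strMul k n X Y W f p) g := by
  cases n with
  | zero =>
    induction p using str_zero_induction with
    | h h => simp
  | succ n =>
    induction p using str_cons_induction with
    | add x y hx hy => simp only [map_add, LinearMap.add_apply, hx, hy]
    | cons V h p => simp

theorem strMulR_snoc (n : ℕ) {X Y W Z : D} (p : Str k n X Y) (f : W ⟶ Y) (g : Z ⟶ W) :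
    strMulR k (n + 1) X W Z (strSnoc k n X Y W p f) g = strSnoc k n X Y Z p (g ≫ f) := by
  induction n generalizing X with
  | zero =>
    induction p using str_zero_induction with
    | h h => simp
  | succ n ih =>
    induction p using str_cons_induction with
    | add x y hx hy => simp only [map_add, LinearMap.add_apply, hx, hy]
    | cons V h p => simp [ih]

theorem strFace_mul (n i : ℕ) {X Y Z : D} (f : Y ⟶ X) (x : Str k (n + 1) Y Z) :
    strFace k n i X Z (strMul k (n + 1) X Y Z f x) = strMul k n X Y Z f (strFace k n i Y Z x) := by
  induction x using str_cons_induction with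
  | add x y hx hy => simp only [map_add, hx, hy]
  | cons W g p =>
    rcases i with _ | i
    · simp [strMul_strMul]
    · rcases n with _ | n
      · simp [strFace]
      · simp

theorem strFace_snoc (n i : ℕ) (hi : i ≤ n) {X Y Z : D} (p : Str k (n + 1) X Y) (f : Z ⟶ Y) :
    strFace k (n + 1) i X Z (strSnoc k (n + 1) X Y Z p f) =
      strSnoc k n X Y Z (strFace k n i X Y p) f := by
  induction n generalizing X i with
  | zero =>
    obtain rfl : i = 0 := by omega
    induction p using str_cons_induction with
    | add x y hx hy => simp only [map_add, LinearMap.add_apply, hx, hy]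
    | cons W g p => simp [strMul_snoc]
  | succ n ih =>
    induction p using str_cons_induction with
    | add x y hx hy => simp only [map_add, LinearMap.add_apply, hx, hy]
    | cons W g p =>
      rcases i with _ | i
      · simp [strMul_snoc]
      · simp [ih i (by omega)]

theorem strFace_last_snoc (n : ℕ) {X Y Z : D} (p : Str k n X Y) (f : Z ⟶ Y) :
    strFace k n n X Z (strSnoc k n X Y Z p f) = strMulR k n X Y Z p f := by
  induction n generalizing X with
  | zero =>
    induction p using str_zero_induction with
    | h g => simp
  | succ n ih =>
    induction p using str_cons_induction with
    | add x y hx hy => simp only [map_add, LinearMap.add_apply, hx, hy]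
    | cons W g p => simp [ih]

end Strings

/-! ### The diagonal action on strings -/

section Action

variable (k : Type u) [Field k] {D : Type u} [SmallCategory D] [Preadditive D] [Linear k D]
  {H : Type v} [Ring H] [HopfAlgebra k H] [HCategory k H D]

theorem strAct_zero {X Z : D} (h : H) (f : Z ⟶ X) :
    strAct k H 0 X Z h ((strZero k X Z).symm f) =
      (strZero k X Z).symm (HCategory.act (k := k) (H := H) Z X h f) := by
  simp [strAct]

/-- The diagonal action on `f ⊗ p`, before choosing a presentation of `Δ(h)`. -/
theorem strAct_cons_comul (n : ℕ) {X Y Z : D} (h : H) (t : (Y ⟶ X) ⊗[k] Str k n Y Z) :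
    strAct k H (n + 1) X Z h (strCons k n X Y Z t) =
      strCons k n X Y Z (TensorProduct.map₂ (HCategory.act (k := k) (H := H) Y X).toLinearMap
        (strAct k H n Y Z) (Coalgebra.comul (R := k) h) t) := by
  simp [strAct, strLift₂]

theorem strAct_cons (n : ℕ) {X Y Z : D} (h : H) (f : Y ⟶ X) (p : Str k n Y Z) :
    strAct k H (n + 1) X Z h (strCons k n X Y Z (f ⊗ₜ p)) =
      ∑ i ∈ (ℛ k h).index, strCons k n X Y Z
        (HCategory.act (k := k) (H := H) Y X ((ℛ k h).left i) f ⊗ₜ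
          strAct k H n Y Z ((ℛ k h).right i) p) := by
  rw [strAct_cons_comul, ← (ℛ k h).eq]
  simp

theorem strAct_one (n : ℕ) {X Z : D} (x : Str k n X Z) : strAct k H n X Z 1 x = x := by
  induction n generalizing X with
  | zero =>
    induction x using str_zero_induction with
    | h f => simp [strAct_zero]
  | succ n ih =>
    induction x using str_cons_induction with
    | add x y hx hy => rw [map_add, hx, hy]
    | cons Y f p => simp [strAct_cons_comul, Algebra.TensorProduct.one_def, ih]

theorem strAct_mul (n : ℕ) {X Z : D} (g h : H) (x : Str k n X Z) :
    strAct k H n X Z (g * h) x = strAct k H n X Z g (strAct k H n X Z h x) := by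
  induction n generalizing X g h with
  | zero =>
    induction x using str_zero_induction with
    | h f => simp [strAct_zero]
  | succ n ih =>
    induction x using str_cons_induction with
    | add x y hx hy => simp only [map_add, hx, hy]
    | cons Y f p =>
      rw [strAct_cons_comul, strAct_cons_comul, strAct_cons_comul, Bialgebra.comul_mul]
      generalize Coalgebra.comul (R := k) g = s
      generalize Coalgebra.comul (R := k) h = t
      congr 1
      induction s with
      | zero => simp
      | add a b ha hb => simp only [add_mul, map_add, LinearMap.add_apply, ha, hb]
      | tmul a b =>
        induction t with
        | zero => simp
        | add a b ha hb => simp only [mul_add, map_add, LinearMap.add_apply, ha, hb]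
        | tmul c d => simp [ih]

theorem strAct_snoc (n : ℕ) {X Y Z : D} (h : H) (p : Str k n X Y) (f : Z ⟶ Y) :
    strAct k H (n + 1) X Z h (strSnoc k n X Y Z p f) =
      ∑ i ∈ (ℛ k h).index, strSnoc k n X Y Z (strAct k H n X Y ((ℛ k h).left i) p)
        (HCategory.act (k := k) (H := H) Z Y ((ℛ k h).right i) f) := by
  induction n generalizing X h with
  | zero =>
    induction p using str_zero_induction with
    | h g => simp [strAct_cons, strAct_zero]
  | succ n ih =>
    induction p using str_cons_induction with
    | add x y hx hy =>
      simp only [map_add, LinearMap.add_apply, hx, hy, Finset.sum_add_distrib]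
    | cons W g p =>
      simp only [strSnoc_cons, strAct_cons, ih, TensorProduct.tmul_sum, map_sum,
        LinearMap.sum_apply]
      exact (sum_coassoc (mkTrilinear (fun a b c => strCons k (n + 1) X W Z
        (HCategory.act (k := k) (H := H) W X a g ⊗ₜ strSnoc k n W Y Z (strAct k H n W Y b p)
          (HCategory.act (k := k) (H := H) Z Y c f)))
        (by simp [TensorProduct.add_tmul]) (by simp [← TensorProduct.smul_tmul'])
        (by simp [TensorProduct.tmul_add]) (by simp)
        (by simp [TensorProduct.tmul_add]) (by simp)) h).symm

theorem strAct_strMul (n : ℕ) {X Y Z : D} (h : H) (f : Y ⟶ X) (p : Str k n Y Z) :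
    strAct k H n X Z h (strMul k n X Y Z f p) =
      ∑ i ∈ (ℛ k h).index, strMul k n X Y Z
        (HCategory.act (k := k) (H := H) Y X ((ℛ k h).left i) f)
          (strAct k H n Y Z ((ℛ k h).right i) p) := by
  cases n with
  | zero =>
    induction p using str_zero_induction with
    | h g => simp [strAct_zero, HCategory.act_comp]
  | succ n =>
    induction p using str_cons_induction with
    | add x y hx hy => simp only [map_add, hx, hy, Finset.sum_add_distrib]
    | cons W g p =>
      simp only [strMul_cons, strAct_cons, HCategory.act_comp, TensorProduct.sum_tmul, map_sum]
      exact sum_coassoc (mkTrilinear (fun a b c => strCons k n X W Z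
        ((HCategory.act (k := k) (H := H) W Y b g ≫ HCategory.act (k := k) (H := H) Y X a f) ⊗ₜ
          strAct k H n W Z c p))
        (by simp [TensorProduct.add_tmul]) (by simp [← TensorProduct.smul_tmul'])
        (by simp [TensorProduct.add_tmul]) (by simp [← TensorProduct.smul_tmul'])
        (by simp [TensorProduct.tmul_add]) (by simp)) h

theorem strFace_act (n i : ℕ) {X Z : D} (h : H) (x : Str k (n + 1) X Z) :
    strFace k n i X Z (strAct k H (n + 1) X Z h x) =
      strAct k H n X Z h (strFace k n i X Z x) := by
  induction n generalizing X i h with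
  | zero =>
    induction x using str_cons_induction with
    | add x y hx hy => simp only [map_add, hx, hy]
    | cons Y f p =>
      rcases i with _ | i
      · simp [strAct_cons, strAct_strMul]
      · simp [strFace]
  | succ n ih =>
    induction x using str_cons_induction with
    | add x y hx hy => simp only [map_add, hx, hy]
    | cons Y f p =>
      rcases i with _ | i
      · simp [strAct_cons, strAct_strMul]
      · simp [strAct_cons, ih]

/-- Inserting an identity commutes with the diagonal action, as `H` acts on identities through the
counit. -/
theorem strAct_cons_one (n : ℕ) {X Z : D} (h : H) (p : Str k n X Z) :
    strAct k H (n + 1) X Z h (strCons k n X X Z (𝟙 X ⊗ₜ p)) =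
      strCons k n X X Z (𝟙 X ⊗ₜ strAct k H n X Z h p) := by
  conv_rhs => rw [← Coalgebra.sum_counit_smul (R := k) (ℛ k h)]
  simp [strAct_cons, HCategory.act_id, TensorProduct.tmul_sum, ← TensorProduct.smul_tmul']

theorem strDegen_act (n i : ℕ) {X Z : D} (h : H) (x : Str k n X Z) :
    strDegen k n i X Z (strAct k H n X Z h x) =
      strAct k H (n + 1) X Z h (strDegen k n i X Z x) := by
  induction n generalizing X i h with
  | zero =>
    rcases i with _ | i
    · induction x using str_zero_induction with
      | h f =>
        conv_lhs => rw [← sum_counit_smul_left (k := k) h]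
        simp [strAct_zero, strAct_cons, HCategory.act_id]
    · simp [strDegen]
  | succ n ih =>
    induction x using str_cons_induction with
    | add x y hx hy => simp only [map_add, hx, hy]
    | cons Y f p =>
      rcases i with _ | i
      · rw [strAct_cons, map_sum, strDegen_zero_cons, strAct_cons]
        simp only [strDegen_zero_cons, strAct_cons_one]
      · simp [strAct_cons, ih]

theorem cnAct_of (n : ℕ) (X : D) (h : H) (x : Str k n X X) :
    cnAct k H n h (cnOf k n X x) = cnOf k n X (strAct k H n X X h x) := by
  simp [cnAct, cnLift₂]

theorem cnAct_one (n : ℕ) (x : CN k D n) : cnAct k H n 1 x = x := by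
  induction x using cn_induction with
  | zero => simp
  | add x y hx hy => rw [map_add, hx, hy]
  | of X x => rw [cnAct_of, strAct_one]

theorem cnAct_mul (n : ℕ) (g h : H) (x : CN k D n) :
    cnAct k H n (g * h) x = cnAct k H n g (cnAct k H n h x) := by
  induction x using cn_induction with
  | zero => simp
  | add x y hx hy => simp only [map_add, hx, hy]
  | of X x => simp only [cnAct_of, strAct_mul]

theorem cnRot_zero (h : H) (x : CN k D 0) : cnRot k H 0 h x = cnAct k H 0 h x := rfl

theorem cnRot_snoc (n : ℕ) {X Y : D} (h : H) (p : Str k n X Y) (f : X ⟶ Y) :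
    cnRot k H (n + 1) h (cnOf k (n + 1) X (strSnoc k n X Y X p f)) =
      cnOf k (n + 1) Y (strCons k n Y X Y
        (HCategory.act (k := k) (H := H) X Y h f ⊗ₜ p)) := by
  simp [cnRot, cnLift₂, strUnsnoc_snoc]

end Action

/-! ### Concatenation and the twisted rotation -/

section Concat

variable (k : Type u) [Field k] {D : Type u} [SmallCategory D] [Preadditive D] [Linear k D]

/-- Concatenation of a string of `a + 1` arrows and a string of `b + 1` arrows. The degree `n + 1`
of the result is a variable tied to `a` and `b` by an equation, so that the identities below need
no transport between `Str k (a + 1 + b) X Z` and `Str k (a + (b + 1)) X Z`. The equation excludes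
the third case. -/
def strConcat : (a b n : ℕ) → n = a + b → (X Y Z : D) →
    Str k a X Y →ₗ[k] Str k b Y Z →ₗ[k] Str k (n + 1) X Z
  | 0, b, n, h, X, Y, Z =>
      Eq.rec (motive := fun n _ => Str k 0 X Y →ₗ[k] Str k b Y Z →ₗ[k] Str k (n + 1) X Z)
        ((TensorProduct.mk k (Y ⟶ X) (Str k b Y Z)).compr₂ (strCons k b X Y Z) ∘ₗ
          (strZero k X Y).toLinearMap) (show b = n by omega)
  | a + 1, b, 0, _, X, Y, Z => 0
  | a + 1, b, n + 1, h, X, Y, Z => strLift k fun W => TensorProduct.lift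
      ((LinearMap.llcomp k _ _ _ ∘ₗ
        (TensorProduct.mk k (W ⟶ X) (Str k (n + 1) W Z)).compr₂ (strCons k (n + 1) X W Z)).compl₂
          (strConcat a b n (by omega) W Y Z))

theorem strConcat_zero (b : ℕ) (h : b = 0 + b) {X Y Z : D} (f : Y ⟶ X) (q : Str k b Y Z) :
    strConcat k 0 b b h X Y Z ((strZero k X Y).symm f) q = strCons k b X Y Z (f ⊗ₜ q) := rfl

theorem strConcat_cons (a b n : ℕ) (h : n + 1 = a + 1 + b) {X W Y Z : D} (f : W ⟶ X)
    (p : Str k a W Y) (q : Str k b Y Z) :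
    strConcat k (a + 1) b (n + 1) h X Y Z (strCons k a X W Y (f ⊗ₜ p)) q =
      strCons k (n + 1) X W Z (f ⊗ₜ strConcat k a b n (by omega) W Y Z p q) := by
  simp [strConcat]

theorem strConcat_snoc_left (a b n : ℕ) (h : n = a + (b + 1)) {X Y W Z : D} (p : Str k a X Y)
    (g : W ⟶ Y) (q : Str k b W Z) :
    strConcat k a (b + 1) n h X Y Z p (strCons k b Y W Z (g ⊗ₜ q)) =
      strConcat k (a + 1) b n (by omega) X W Z (strSnoc k a X Y W p g) q := by
  induction a generalizing X n with
  | zero =>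
    obtain rfl : n = b + 1 := by omega
    induction p using str_zero_induction with
    | h f =>
      rw [strConcat_zero, strSnoc_zero, strConcat_cons, strConcat_zero]
  | succ a ih =>
    obtain ⟨n, rfl⟩ : ∃ m, n = m + 1 := ⟨n - 1, by omega⟩
    induction p using str_cons_induction with
    | add x y hx hy => simp only [map_add, LinearMap.add_apply, hx, hy]
    | cons V f p => rw [strConcat_cons, strSnoc_cons, strConcat_cons, ih]

theorem strConcat_zero_right (a : ℕ) (h : a = a + 0) {X Y Z : D} (p : Str k a X Y) (f : Z ⟶ Y) :
    strConcat k a 0 a h X Y Z p ((strZero k Y Z).symm f) = strSnoc k a X Y Z p f := by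
  induction a generalizing X with
  | zero =>
    induction p using str_zero_induction with
    | h g => rw [strConcat_zero, strSnoc_zero]
  | succ a ih =>
    induction p using str_cons_induction with
    | add x y hx hy => simp only [map_add, LinearMap.add_apply, hx, hy]
    | cons V g p => rw [strConcat_cons, strSnoc_cons, ih]

theorem strConcat_snoc_right (a b n : ℕ) (h : n = a + b) {X Y W Z : D} (p : Str k a X Y)
    (q : Str k b Y W) (f : Z ⟶ W) :
    strConcat k a (b + 1) (n + 1) (by omega) X Y Z p (strSnoc k b Y W Z q f) =
      strSnoc k (n + 1) X W Z (strConcat k a b n h X Y W p q) f := by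
  induction a generalizing X n with
  | zero =>
    obtain rfl : n = b := by omega
    induction p using str_zero_induction with
    | h g => rw [strConcat_zero, strConcat_zero, strSnoc_cons]
  | succ a ih =>
    obtain ⟨n, rfl⟩ : ∃ m, n = m + 1 := ⟨n - 1, by omega⟩
    induction p using str_cons_induction with
    | add x y hx hy => simp only [map_add, LinearMap.add_apply, hx, hy]
    | cons V g p => rw [strConcat_cons, strConcat_cons, strSnoc_cons, ih n (by omega)]

end Concat

section Rotation

variable (k : Type u) [Field k] {D : Type u} [SmallCategory D] [Preadditive D] [Linear k D]

/-- The face `dᵢ`, for `i ≤ n`, on the additive cyclic nerve. -/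
def cnFace (n i : ℕ) : CN k D (n + 1) →ₗ[k] CN k D n :=
  cnLift k fun X => cnOf k n X ∘ₗ strFace k n i X X

@[simp]
theorem cnFace_of (n i : ℕ) (X : D) (x : Str k (n + 1) X X) :
    cnFace k n i (cnOf k (n + 1) X x) = cnOf k n X (strFace k n i X X x) := by
  simp [cnFace]

/-- The degeneracy `sᵢ` on the additive cyclic nerve. -/
def cnDegen (n i : ℕ) : CN k D n →ₗ[k] CN k D (n + 1) :=
  cnLift k fun X => cnOf k (n + 1) X ∘ₗ strDegen k n i X X

@[simp]
theorem cnDegen_of (n i : ℕ) (X : D) (x : Str k n X X) :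
    cnDegen k n i (cnOf k n X x) = cnOf k (n + 1) X (strDegen k n i X X x) := by
  simp [cnDegen]

variable {k} in
theorem cn_snoc_induction {n : ℕ} {P : CN k D (n + 1) → Prop} (zero : P 0)
    (add : ∀ x y, P x → P y → P (x + y))
    (snoc : ∀ (X Y : D) (p : Str k n X Y) (f : X ⟶ Y),
      P (cnOf k (n + 1) X (strSnoc k n X Y X p f)))
    (x : CN k D (n + 1)) : P x := by
  induction x using cn_induction with
  | zero => exact zero
  | add x y hx hy => exact add x y hx hy
  | of X x =>
    induction x using str_snoc_induction with
    | add x y hx hy => rw [map_add]; exact add _ _ hx hy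
    | snoc Y p f => exact snoc X Y p f

variable {H : Type v} [Ring H] [HopfAlgebra k H] [HCategory k H D]

theorem cnFace_act (n i : ℕ) (h : H) (x : CN k D (n + 1)) :
    cnFace k n i (cnAct k H (n + 1) h x) = cnAct k H n h (cnFace k n i x) := by
  induction x using cn_induction with
  | zero => simp
  | add x y hx hy => simp only [map_add, hx, hy]
  | of X x => simp only [cnAct_of, cnFace_of, strFace_act]

theorem cnDegen_act (n i : ℕ) (h : H) (x : CN k D n) :
    cnDegen k n i (cnAct k H n h x) = cnAct k H (n + 1) h (cnDegen k n i x) := by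
  induction x using cn_induction with
  | zero => simp
  | add x y hx hy => simp only [map_add, hx, hy]
  | of X x => simp only [cnAct_of, cnDegen_of, strDegen_act]

/-- `dᵢ₊₁ t = t dᵢ` for the faces that do not involve the last arrow. -/
theorem cnFace_succ_rot (n i : ℕ) (hi : i < n) (h : H) (x : CN k D (n + 1)) :
    cnFace k n (i + 1) (cnRot k H (n + 1) h x) = cnRot k H n h (cnFace k n i x) := by
  obtain ⟨n, rfl⟩ : ∃ m, n = m + 1 := ⟨n - 1, by omega⟩
  induction x using cn_snoc_induction with
  | zero => simp
  | add x y hx hy => simp only [map_add, hx, hy]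
  | snoc X Y p f =>
    rw [cnRot_snoc, cnFace_of, strFace_succ_cons, cnFace_of, strFace_snoc _ _ _ (by omega),
      cnRot_snoc]

/-- The last face `f⁰ ⊗ ⋯ ⊗ fⁿ⁺¹ ↦ (h fⁿ⁺¹) f⁰ ⊗ ⋯ ⊗ fⁿ`, twisted by `h`. -/
def cnLast (n : ℕ) : H →ₗ[k] CN k D (n + 1) →ₗ[k] CN k D n :=
  (cnRot k H (n + 1)).compr₂ (cnFace k n 0)

theorem cnLast_snoc (n : ℕ) {X Y : D} (h : H) (p : Str k n X Y) (f : X ⟶ Y) :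
    cnLast k n h (cnOf k (n + 1) X (strSnoc k n X Y X p f)) =
      cnOf k n Y (strMul k n Y X Y (HCategory.act (k := k) (H := H) X Y h f) p) := by
  simp [cnLast, cnRot_snoc]

/-- `d₀ t t = t dₙ` for the face `dₙ` that composes the last two arrows: this is where the
compatibility of the action with composition enters. -/
theorem conv_cnLast_rot (n : ℕ) (h : H) (x : CN k D (n + 1)) :
    conv (cnLast k n) (cnRot k H (n + 1)) h x = cnRot k H n h (cnFace k n n x) := by
  induction x using cn_snoc_induction with
  | zero => simp
  | add x y hx hy => simp only [map_add, hx, hy]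
  | snoc X Y p f =>
    simp only [conv_apply, cnRot_snoc, cnFace_of, strFace_last_snoc]
    cases n with
    | zero =>
      induction p using str_zero_induction with
      | h g =>
        simp [← strSnoc_zero, cnLast_snoc, cnRot_zero, cnAct_of, strAct_zero, HCategory.act_comp]
    | succ n =>
      induction p using str_snoc_induction with
      | add x y hx hy =>
        simp only [TensorProduct.tmul_add, map_add, LinearMap.add_apply, Finset.sum_add_distrib,
          hx, hy]
      | snoc W p g =>
        simp [← strSnoc_cons, cnLast_snoc, strMulR_snoc, cnRot_snoc, HCategory.act_comp,
          TensorProduct.sum_tmul]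

/-- The convolution powers of the twisted rotation. -/
def rotPow (H : Type v) [Ring H] [HopfAlgebra k H] [HCategory k H D] (n : ℕ) :
    ℕ → H →ₗ[k] CN k D n →ₗ[k] CN k D n
  | 0 => (Coalgebra.counit (R := k) (A := H)).smulRight LinearMap.id
  | j + 1 => conv (rotPow H n j) (cnRot k H n)

theorem rotPow_one (n : ℕ) (h : H) (x : CN k D n) : rotPow k H n 1 h x = cnRot k H n h x := by
  conv_rhs => rw [← Coalgebra.sum_counit_smul (R := k) (ℛ k h)]
  simp [rotPow, conv_apply]

theorem rotPow_succ (n j : ℕ) (h : H) (x : CN k D n) : rotPow k H n (j + 1) h x =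
    ∑ i ∈ (ℛ k h).index, rotPow k H n j ((ℛ k h).left i) (cnRot k H n ((ℛ k h).right i) x) := by
  rw [rotPow, conv_apply]

/-- Rotating a string `p ⊗ q` as often as `q` has arrows gives `h q ⊗ p`. -/
theorem rotPow_concat (a b n : ℕ) (hn : n = a + b) {X Y : D} (h : H) (p : Str k a X Y)
    (q : Str k b Y X) :
    rotPow k H (n + 1) (b + 1) h (cnOf k (n + 1) X (strConcat k a b n hn X Y X p q)) =
      cnOf k (n + 1) Y
        (strConcat k b a n (by omega) Y X Y (strAct k H b Y X h q) p) := by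
  induction b generalizing a n X h with
  | zero =>
    obtain rfl : n = a := by omega
    induction q using str_zero_induction with
    | h f =>
      rw [strConcat_zero_right, rotPow_one, cnRot_snoc, strAct_zero, strConcat_zero]
  | succ b ih =>
    obtain ⟨n, rfl⟩ : ∃ m, n = m + 1 := ⟨n - 1, by omega⟩
    induction q using str_snoc_induction with
    | add x y hx hy => simp only [map_add, LinearMap.add_apply, hx, hy]
    | snoc W q f =>
      rw [strConcat_snoc_right k a b n (by omega), rotPow_succ]
      simp only [cnRot_snoc]
      simp only [← strConcat_cons k a b n (by omega), ih (a + 1) (n + 1) (by omega),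
        strConcat_snoc_left, strAct_snoc, map_sum, LinearMap.sum_apply]

/-- The full rotation is the diagonal action. -/
theorem rotPow_full (n : ℕ) (h : H) (x : CN k D n) :
    rotPow k H n (n + 1) h x = cnAct k H n h x := by
  cases n with
  | zero => rw [rotPow_one, cnRot_zero]
  | succ n =>
    induction x using cn_snoc_induction with
    | zero => simp
    | add x y hx hy => simp only [map_add, hx, hy]
    | snoc X Y p f =>
      rw [rotPow_succ]
      simp only [cnRot_snoc]
      simp only [← strConcat_zero k n (by omega), rotPow_concat, strConcat_zero_right, cnAct_of,
        strAct_snoc, map_sum]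

/-- `h₁ (t_{a h₂} x) = t_{h₁ a} (h₂ x)`, where `t_a` is the rotation twisted by `a`. -/
theorem sum_act_rot (n : ℕ) (a h : H) (x : CN k D n) :
    ∑ i ∈ (ℛ k h).index,
      cnAct k H n ((ℛ k h).left i) (cnRot k H n (a * (ℛ k h).right i) x) =
    ∑ i ∈ (ℛ k h).index,
      cnRot k H n ((ℛ k h).left i * a) (cnAct k H n ((ℛ k h).right i) x) := by
  cases n with
  | zero => simp only [cnRot_zero, ← cnAct_mul, mul_assoc]
  | succ n =>
    induction x using cn_snoc_induction with
    | zero => simp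
    | add x y hx hy => simp only [map_add, Finset.sum_add_distrib, hx, hy]
    | snoc X Y p f =>
      simp only [cnRot_snoc, cnAct_of, strAct_cons, strAct_snoc, map_sum]
      refine Eq.trans ?_ ((sum_coassoc (mkTrilinear (k := k) (fun b c d => cnOf k (n + 1) Y
        (strCons k n Y X Y (HCategory.act (k := k) (H := H) X Y (b * a * d) f ⊗ₜ
          strAct k H n X Y c p)))
        (by simp [TensorProduct.add_tmul, add_mul]) (by simp [← TensorProduct.smul_tmul'])
        (by simp [TensorProduct.tmul_add]) (by simp)
        (by simp [TensorProduct.add_tmul, mul_add]) (by simp [← TensorProduct.smul_tmul'])) h).trans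
          ?_)
      · simp [mkTrilinear, mul_assoc]
      · simp [mkTrilinear]

variable [BijectiveAntipode k H]

/-- `h₂ (t_{S⁻¹(h₁) a h₃} x) = t_a (h x)`. -/
theorem sum_act_rot_antipodeInv (n : ℕ) (a h : H) (x : CN k D n) :
    ∑ i ∈ (ℛ k h).index, ∑ j ∈ (ℛ k ((ℛ k h).right i)).index,
      cnAct k H n ((ℛ k ((ℛ k h).right i)).left j)
        (cnRot k H n (antipodeInv k H ((ℛ k h).left i) * a *
          (ℛ k ((ℛ k h).right i)).right j) x) =
    cnRot k H n a (cnAct k H n h x) := by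
  simp only [sum_act_rot]
  refine (sum_coassoc (mkTrilinear (fun b c d =>
    cnRot k H n (c * (antipodeInv k H b * a)) (cnAct k H n d x))
    (by simp [add_mul, mul_add]) (by simp) (by simp [add_mul]) (by simp) (by simp) (by simp))
      h).symm.trans ?_
  simp only [mkTrilinear, LinearMap.coe_mk, AddHom.coe_mk, LinearMap.mk₂_apply, ← mul_assoc,
    ← LinearMap.sum_apply, ← map_sum, ← Finset.sum_mul, sum_mul_antipodeInv]
  conv_rhs => rw [← Coalgebra.sum_counit_smul (R := k) (ℛ k h)]
  simp

end Rotation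

/-! ### Cochains and their structure maps -/

section Chains

variable (k : Type u) [Field k] {H : Type v} [Ring H] [HopfAlgebra k H]
  (D : Type u) [SmallCategory D] [Preadditive D] [Linear k D] [HCategory k H D]
  (M : Type w) [AddCommGroup M] [Module k M] [SAYDModule k H M]

variable {k D M} in
/-- `H`-linearity of a cochain means that it is balanced, i.e. factors through `M ⊗_H CNₙ(D)`. -/
theorem mem_HCochain_iff {n : ℕ} (φ : Cochain k D M n) :
    φ ∈ HCochain k H D M n ↔ ∀ (h : H) (m : M) (x : CN k D n),
      φ (rightAct k H M h m ⊗ₜ x) = φ (m ⊗ₜ cnAct k H n h x) := by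
  have hact : ∀ (h : H) (m : M) (x : CN k D n), chainAct k H D M n h (m ⊗ₜ x) =
      ∑ i ∈ (ℛ k h).index, rightAct k H M ((ℛ k h).left i) m ⊗ₜ
        cnAct k H n (HopfAlgebra.antipode k ((ℛ k h).right i)) x := by
    intro h m x
    rw [chainAct, LinearMap.comp_apply, ← (ℛ k h).eq]
    simp
  constructor
  · intro hφ h m x
    have hφ' : ∀ (h : H) (m : M) (x : CN k D n), φ (chainAct k H D M n h (m ⊗ₜ x)) =
        Coalgebra.counit (R := k) h * φ (m ⊗ₜ x) := fun h m x => hφ h _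
    -- evaluate `φ ((m ⊗ h₂ x) h₁)` in two ways
    have h₁ : ∑ i ∈ (ℛ k h).index, φ (chainAct k H D M n ((ℛ k h).left i)
        (m ⊗ₜ cnAct k H n ((ℛ k h).right i) x)) = φ (m ⊗ₜ cnAct k H n h x) := by
      conv_rhs => rw [← Coalgebra.sum_counit_smul (R := k) (ℛ k h)]
      simp [hφ', TensorProduct.tmul_sum]
    rw [← h₁]
    simp only [hact, map_sum]
    refine Eq.trans ?_ (sum_coassoc (mkTrilinear (k := k) (fun a b c =>
      φ (rightAct k H M a m ⊗ₜ cnAct k H n (HopfAlgebra.antipode k b * c) x))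
      (by simp [TensorProduct.add_tmul]) (by simp [← TensorProduct.smul_tmul'])
      (by simp [TensorProduct.tmul_add, add_mul]) (by simp)
      (by simp [TensorProduct.tmul_add, mul_add]) (by simp)) h).symm |>.trans ?_
    · simp only [mkTrilinear, LinearMap.coe_mk, AddHom.coe_mk, LinearMap.mk₂_apply, ← map_sum,
        ← TensorProduct.tmul_sum, ← LinearMap.sum_apply,
        HopfAlgebra.sum_antipode_mul_eq_smul]
      conv_lhs => rw [← sum_counit_smul_left (k := k) h]
      simp [TensorProduct.sum_tmul, cnAct_one]
      simp [TensorProduct.smul_tmul]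
    · simp [mkTrilinear, cnAct_mul]
  · intro hφ h z
    induction z using TensorProduct.induction_on with
    | zero => simp
    | add a b ha hb => rw [map_add, map_add, map_add, ha, hb, mul_add]
    | tmul m x =>
      simp only [hact, map_sum, hφ, ← cnAct_mul]
      simp only [← map_sum, ← TensorProduct.tmul_sum, ← LinearMap.sum_apply,
        HopfAlgebra.sum_mul_antipode_eq_smul]
      simp [cnAct_one]

variable {k D M} in
/-- Precomposition with an `H`-linear map of the nerves preserves `H`-linear cochains. -/
theorem lTensor_mem_HCochain {D' : Type u} [SmallCategory D'] [Preadditive D'] [Linear k D']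
    [HCategory k H D'] {n n' : ℕ} (f : CN k D' n' →ₗ[k] CN k D n)
    (hf : ∀ (h : H) x, f (cnAct k H n' h x) = cnAct k H n h (f x)) {φ : Cochain k D M n}
    (hφ : φ ∈ HCochain k H D M n) : φ ∘ₗ f.lTensor M ∈ HCochain k H D' M n' := by
  rw [mem_HCochain_iff] at hφ ⊢
  intro h m x
  simp [hφ, hf]

variable [BijectiveAntipode k H]

theorem chainT_eq_twist (n : ℕ) : chainT k H D M n = twist M (cnRot k H n) := rfl

theorem chainFace_of_le (n : ℕ) (i : Fin (n + 2)) (hi : (i : ℕ) ≤ n) :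
    chainFace k H D M n i = (cnFace k n i).lTensor M := if_pos hi

theorem chainFace_of_lt (n : ℕ) (i : Fin (n + 2)) (hi : n < (i : ℕ)) :
    chainFace k H D M n i = twist M (cnLast (H := H) k n) := by
  rw [chainFace, if_neg (by omega), chainT_eq_twist, ← cnFace, lTensor_comp_twist]
  rfl

theorem chainDegen_eq (n : ℕ) (i : Fin (n + 1)) :
    chainDegen k D M n i = (cnDegen k n i).lTensor M := rfl

theorem chainT_pow (n j : ℕ) : chainT k H D M n ^ j = twist M (rotPow k H n j) := by
  induction j with
  | zero => rw [rotPow, twist_counit, LinearMap.lTensor_id]; rfl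
  | succ j ih => rw [pow_succ, ih, chainT_eq_twist, Module.End.mul_eq_comp, twist_comp_twist]; rfl

variable {k D M}

theorem cocyc_mem {n : ℕ} {φ : Cochain k D M n} (hφ : φ ∈ HCochain k H D M n) :
    cocyc k H D M n φ ∈ HCochain k H D M n := by
  rw [mem_HCochain_iff] at hφ ⊢
  intro h m x
  simp only [cocyc, LinearMap.dualMap_apply, chainT_eq_twist, twist_tmul, rightAct_apply,
    SAYDModule.antiYetterDrinfeld]
  generalize SAYDModule.coact (k := k) (H := H) m = t
  induction t with
  | zero => simp
  | add a b ha hb => simp only [map_add, Finset.sum_add_distrib, ha, hb]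
  | tmul g m =>
    simp only [map_sum, TensorProduct.map_tmul, twistAux_tmul, ← rightAct_apply, hφ,
      LinearMap.comp_apply, LinearMap.mulLeft_apply, LinearMap.mulRight_apply, antipodeInv_mul,
      antipodeInv_antipode]
    rw [← sum_act_rot_antipodeInv k n (antipodeInv k H g) h x]
    simp only [TensorProduct.tmul_sum, map_sum]

/-- `τₙⁿ⁺¹ = 1` on `H`-linear cochains, by stability. -/
theorem cocyc_pow {n : ℕ} {φ : Cochain k D M n} (hφ : φ ∈ HCochain k H D M n) :
    (cocyc k H D M n ^ (n + 1)) φ = φ := by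
  have hpow : ∀ j, (cocyc k H D M n ^ j) φ = φ ∘ₗ (chainT k H D M n ^ j) := by
    intro j
    induction j with
    | zero => rfl
    | succ j ih =>
      rw [pow_succ', Module.End.mul_apply, ih, pow_succ]
      rfl
  rw [hpow, chainT_pow]
  rw [mem_HCochain_iff] at hφ
  ext m x
  simp only [TensorProduct.AlgebraTensorModule.curry_apply, TensorProduct.curry_apply,
    LinearMap.coe_restrictScalars, LinearMap.comp_apply, twist_tmul]
  conv_rhs => rw [← stable_antipodeInv (k := k) (H := H) m]
  generalize SAYDModule.coact (k := k) (H := H) m = t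
  induction t with
  | zero => simp
  | add a b ha hb => simp only [map_add, ha, hb, TensorProduct.add_tmul]
  | tmul g m => simp [rotPow_full, hφ]

theorem coface_zero_cocyc (n : ℕ) (φ : Cochain k D M n) :
    cocyc k H D M (n + 1) (coface k H D M n 0 φ) = coface k H D M n (Fin.last (n + 1)) φ := by
  simp only [cocyc, coface, chainFace_of_lt k D M n (Fin.last (n + 1)) (by simp),
    chainFace_of_le k D M n 0 (by simp), chainT_eq_twist]
  refine LinearMap.ext fun x => ?_
  rw [LinearMap.dualMap_apply, LinearMap.dualMap_apply, LinearMap.dualMap_apply,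
    ← LinearMap.comp_apply ((cnFace k n _).lTensor M), lTensor_comp_twist]
  rfl

theorem cocyc_coface_succ (n : ℕ) (i : Fin (n + 1)) (φ : Cochain k D M n) :
    cocyc k H D M (n + 1) (coface k H D M n i.succ φ) =
      coface k H D M n i.castSucc (cocyc k H D M n φ) := by
  refine LinearMap.ext fun x => ?_
  simp only [cocyc, coface, LinearMap.dualMap_apply]
  congr 1
  simp only [chainFace_of_le k D M n i.castSucc (by simp; omega), chainT_eq_twist,
    ← LinearMap.comp_apply, twist_comp_lTensor]
  rcases (show (i : ℕ) < n ∨ (i : ℕ) = n by omega) with h | h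
  · rw [chainFace_of_le k D M n i.succ (by simp; omega), lTensor_comp_twist]
    congr 2
    ext1 h'
    refine LinearMap.ext fun x => ?_
    simpa using cnFace_succ_rot k n i h h' x
  · rw [chainFace_of_lt k D M n i.succ (by simp; omega), twist_comp_twist]
    congr 2
    ext1 h'
    refine LinearMap.ext fun x => ?_
    simpa [h] using conv_cnLast_rot k n h' x

theorem coface_mem {n : ℕ} (i : Fin (n + 2)) {φ : Cochain k D M n}
    (hφ : φ ∈ HCochain k H D M n) : coface k H D M n i φ ∈ HCochain k H D M (n + 1) := by
  have h0 : ∀ i : Fin (n + 2), (i : ℕ) ≤ n → coface k H D M n i φ ∈ HCochain k H D M (n + 1) := by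
    intro i hi
    rw [coface, chainFace_of_le k D M n i hi]
    exact lTensor_mem_HCochain _ (cnFace_act k n i) hφ
  by_cases hi : (i : ℕ) ≤ n
  · exact h0 i hi
  · obtain rfl : i = Fin.last (n + 1) := by ext; simp; omega
    rw [← coface_zero_cocyc]
    exact cocyc_mem (h0 0 (by simp))

theorem structureMapsRestrict : StructureMapsRestrict k H D M where
  coface_mem _ i _ hφ := coface_mem i hφ
  codegen_mem n i _ hφ := lTensor_mem_HCochain _ (cnDegen_act k n i) hφ
  cocyc_mem _ _ hφ := cocyc_mem hφ

end Chains

/-! ### The Hochschild complex and the cyclic double complex -/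

section CyclicOperators

variable {k : Type*} [Field k] {V W : Type*} [AddCommGroup V] [Module k V]
  [AddCommGroup W] [Module k W] {n : ℕ} {δ : ℕ → V →ₗ[k] W} {l : Module.End k V}
  {l' : Module.End k W}

/-- If `l' δᵢ₊₁ = δᵢ l` and `l' δ₀ = δₙ₊₁`, then `(1 - l') b = b' (1 - l)`. -/
theorem sum_sub_cyclic (h₁ : ∀ i ≤ n, ∀ x, l' (δ (i + 1) x) = δ i (l x))
    (h₀ : ∀ x, l' (δ 0 x) = δ (n + 1) x) (x : V) :
    ∑ i ∈ Finset.range (n + 2), δ i x - l' (∑ i ∈ Finset.range (n + 2), δ i x) =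
      ∑ i ∈ Finset.range (n + 1), δ i (x - l x) := by
  rw [map_sum, Finset.sum_range_succ' (fun i => l' (δ i x)), h₀, Finset.sum_range_succ,
    add_sub_add_right_eq_sub, ← Finset.sum_sub_distrib]
  refine Finset.sum_congr rfl fun i hi => ?_
  rw [h₁ i (by simpa [Nat.lt_succ_iff] using hi), map_sub]

theorem sum_pow_sub_apply (l : Module.End k V) (m : ℕ) (x : V) :
    ∑ i ∈ Finset.range m, (l ^ i) (x - l x) = x - (l ^ m) x := by
  simp only [map_sub, ← Module.End.mul_apply, ← pow_succ]
  exact Finset.sum_range_sub' (fun i => (l ^ i) x) m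

theorem sum_pow_sub_map (l : Module.End k V) (m : ℕ) (x : V) :
    ∑ i ∈ Finset.range m, (l ^ i) x - l (∑ i ∈ Finset.range m, (l ^ i) x) = x - (l ^ m) x := by
  simp only [map_sum, ← Finset.sum_sub_distrib, ← Module.End.mul_apply, ← pow_succ']
  exact Finset.sum_range_sub' (fun i => (l ^ i) x) m

theorem cyclic_pow_apply (h₁ : ∀ i ≤ n, ∀ x, l' (δ (i + 1) x) = δ i (l x)) (j i : ℕ)
    (hij : i + j ≤ n + 1) (x : V) : (l' ^ j) (δ (i + j) x) = δ i ((l ^ j) x) := by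
  induction j generalizing x with
  | zero => rfl
  | succ j ih =>
    rw [pow_succ, Module.End.mul_apply, ← add_assoc, h₁ _ (by omega), ih (by omega), pow_succ,
      Module.End.mul_apply]

/-- If `l' δᵢ₊₁ = δᵢ l` and `l' δ₀ = δₙ₊₁`, then `b N = N b'`: each side is the sum of the same
`(n + 1) (n + 2)` operators `δᵢ lʲ`. -/
theorem sum_norm_cyclic (h₁ : ∀ i ≤ n, ∀ x, l' (δ (i + 1) x) = δ i (l x))
    (h₀ : ∀ x, l' (δ 0 x) = δ (n + 1) x) (x : V) :
    ∑ i ∈ Finset.range (n + 2), δ i (∑ j ∈ Finset.range (n + 1), (l ^ j) x) =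
      ∑ j ∈ Finset.range (n + 2), (l' ^ j) (∑ i ∈ Finset.range (n + 1), δ i x) := by
  simp only [map_sum]
  rw [← Finset.sum_product', ← Finset.sum_product']
  -- `δᵢ lʲ = l'ʲ δᵢ₊ⱼ` while `i + j ≤ n`; beyond that, one more factor `l'` is spent on passing
  -- from `δₙ₊₁` to `δ₀`
  refine Finset.sum_nbij'
    (fun a => if a.1 + a.2 ≤ n then (a.2, a.1 + a.2) else (a.2 + 1, a.1 + a.2 - n - 1))
    (fun b => if b.1 ≤ b.2 then (b.2 - b.1, b.1) else (n + 2 + b.2 - b.1, b.1 - 1)) ?_ ?_ ?_ ?_ ?_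
  · rintro ⟨i, j⟩ h
    simp only [Finset.mem_product, Finset.mem_range] at h ⊢
    split_ifs <;> simp <;> omega
  · rintro ⟨i, j⟩ h
    simp only [Finset.mem_product, Finset.mem_range] at h ⊢
    split_ifs <;> simp <;> omega
  · rintro ⟨i, j⟩ h
    simp only [Finset.mem_product, Finset.mem_range] at h ⊢
    by_cases hij : i + j ≤ n
    · rw [if_pos hij, if_pos (by simp)]
      simp
    · rw [if_neg hij, if_neg (by simp; omega)]
      ext <;> simp
      omega
  · rintro ⟨j, i⟩ h
    simp only [Finset.mem_product, Finset.mem_range] at h ⊢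
    by_cases hij : j ≤ i
    · rw [if_pos hij, if_pos (by simp; omega)]
      ext <;> simp
      omega
    · rw [if_neg hij, if_neg (by simp; omega)]
      ext <;> simp <;> omega
  · rintro ⟨i, j⟩ h
    simp only [Finset.mem_product, Finset.mem_range] at h ⊢
    split_ifs with hij
    · exact (cyclic_pow_apply h₁ j i (by omega) x).symm
    · obtain ⟨m, hm⟩ : ∃ m, i + j = m + (n + 1) := ⟨i + j - (n + 1), by omega⟩
      obtain ⟨a, ha⟩ : ∃ a, i + a = n + 1 := ⟨n + 1 - i, by omega⟩
      obtain rfl : j = a + m := by omega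
      have e₁ : i + (a + m) - n - 1 = 0 + m := by omega
      have e₂ : a + m + 1 = a + (1 + m) := by omega
      simp only [e₁, e₂]
      rw [pow_add l', Module.End.mul_apply, pow_add l', Module.End.mul_apply,
        cyclic_pow_apply h₁ m 0 (by omega), pow_one, h₀, ← ha, cyclic_pow_apply h₁ a i (by omega),
        pow_add, Module.End.mul_apply]

end CyclicOperators

section Boundary

variable (k : Type u) [Field k] {D : Type u} [SmallCategory D] [Preadditive D] [Linear k D]

/-- The bar differential `∑ (-1)ⁱ dᵢ` of strings, over the faces that compose two arrows. -/
def strBd (n : ℕ) (X Z : D) : Str k (n + 1) X Z →ₗ[k] Str k n X Z :=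
  ∑ i ∈ Finset.range (n + 1), (-1 : k) ^ i • strFace k n i X Z

theorem strBd_zero_cons {X Y Z : D} (f : Y ⟶ X) (p : Str k 0 Y Z) :
    strBd k 0 X Z (strCons k 0 X Y Z (f ⊗ₜ p)) = strMul k 0 X Y Z f p := by
  simp [strBd]

theorem strBd_cons (n : ℕ) {X Y Z : D} (f : Y ⟶ X) (p : Str k (n + 1) Y Z) :
    strBd k (n + 1) X Z (strCons k (n + 1) X Y Z (f ⊗ₜ p)) =
      strMul k (n + 1) X Y Z f p - strCons k n X Y Z (f ⊗ₜ strBd k n Y Z p) := by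
  rw [strBd, Finset.sum_range_succ', strBd]
  simp [pow_succ, TensorProduct.tmul_sum, ← sub_eq_neg_add]

theorem strBd_mul (n : ℕ) {X Y Z : D} (f : Y ⟶ X) (x : Str k (n + 1) Y Z) :
    strBd k n X Z (strMul k (n + 1) X Y Z f x) = strMul k n X Y Z f (strBd k n Y Z x) := by
  simp [strBd, strFace_mul]

theorem strBd_snoc (n : ℕ) {X Y Z : D} (p : Str k (n + 1) X Y) (f : Z ⟶ Y) :
    strBd k (n + 1) X Z (strSnoc k (n + 1) X Y Z p f) =
      strSnoc k n X Y Z (strBd k n X Y p) f +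
        (-1 : k) ^ (n + 1) • strMulR k (n + 1) X Y Z p f := by
  rw [strBd, Finset.sum_range_succ, LinearMap.add_apply, LinearMap.smul_apply,
    strFace_last_snoc, strBd]
  simp only [LinearMap.sum_apply, LinearMap.smul_apply, map_sum, map_smul]
  congr 1
  refine Finset.sum_congr rfl fun i hi => ?_
  rw [strFace_snoc k n i (by simpa [Nat.lt_succ_iff] using hi)]

theorem strBd_strBd (n : ℕ) {X Z : D} (x : Str k (n + 2) X Z) :
    strBd k n X Z (strBd k (n + 1) X Z x) = 0 := by
  induction n generalizing X with
  | zero =>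
    induction x using str_cons_induction with
    | add x y hx hy => simp only [map_add, hx, hy, add_zero]
    | cons Y f p => rw [strBd_cons, map_sub, strBd_mul, strBd_zero_cons, sub_self]
  | succ n ih =>
    induction x using str_cons_induction with
    | add x y hx hy => simp only [map_add, hx, hy, add_zero]
    | cons Y f p =>
      rw [strBd_cons, map_sub, strBd_mul, strBd_cons, ih, TensorProduct.tmul_zero, map_zero,
        sub_zero, sub_self]

/-- The bar differential of the additive cyclic nerve, without the last face. -/
def cnBd (n : ℕ) : CN k D (n + 1) →ₗ[k] CN k D n :=
  ∑ i ∈ Finset.range (n + 1), (-1 : k) ^ i • cnFace k n i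

theorem cnBd_of (n : ℕ) {X : D} (x : Str k (n + 1) X X) :
    cnBd k n (cnOf k (n + 1) X x) = cnOf k n X (strBd k n X X x) := by
  simp [cnBd, strBd]

theorem cnBd_cnBd (n : ℕ) : cnBd k n ∘ₗ cnBd k (n + 1) = (0 : CN k D (n + 2) →ₗ[k] CN k D n) :=
  cn_hom_ext fun X x => by simp [cnBd_of, strBd_strBd]

variable {H : Type v} [Ring H] [HopfAlgebra k H] [HCategory k H D]

/-- Commutation of the twisted last face with the bar differential, the form that the simplicial
identities involving the last face take. -/
theorem cnLast_cnBd (n : ℕ) (h : H) (x : CN k D (n + 2)) :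
    cnLast k n h (cnBd k (n + 1) x) = cnBd k n (cnLast k (n + 1) h x) +
      (-1 : k) ^ (n + 1) • conv (cnLast k n) (cnLast k (n + 1)) h x := by
  induction x using cn_snoc_induction with
  | zero => simp
  | add x y hx hy =>
    simp only [map_add, hx, hy, smul_add]
    exact add_add_add_comm _ _ _ _
  | snoc X Y p f =>
    rw [cnBd_of, strBd_snoc, map_add, map_smul, map_add, map_smul, cnLast_snoc, cnLast_snoc,
      cnBd_of, strBd_mul]
    congr 2
    simp only [conv_apply, cnLast_snoc]
    induction p using str_snoc_induction with
    | add x y hx hy =>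
      simp only [map_add, LinearMap.add_apply, Finset.sum_add_distrib, hx, hy]
    | snoc W p g =>
      simp [strMulR_snoc, cnLast_snoc, strMul_snoc, strMul_strMul, HCategory.act_comp]

end Boundary

section Complexes

variable (k : Type u) [Field k] {H : Type v} [Ring H] [HopfAlgebra k H] [BijectiveAntipode k H]
  (D : Type u) [SmallCategory D] [Preadditive D] [Linear k D] [HCategory k H D]
  (M : Type w) [AddCommGroup M] [Module k M] [SAYDModule k H M]

theorem hochB'_eq (n : ℕ) : hochB' k H D M n = ((cnBd k n).lTensor M).dualMap := by
  have h : (cnBd (D := D) k n).lTensor M =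
      ∑ i : Fin (n + 1), (-1 : k) ^ (i : ℕ) • chainFace k H D M n i.castSucc := by
    rw [← LinearMap.coe_lTensorHom, cnBd, map_sum, ← Fin.sum_univ_eq_sum_range
      (fun i => LinearMap.lTensorHom M ((-1 : k) ^ i • cnFace (D := D) k n i)) (n + 1)]
    refine Finset.sum_congr rfl fun i _ => ?_
    rw [map_smul, chainFace_of_le k D M n i.castSucc (by simp; omega)]
    rfl
  ext1 φ
  refine LinearMap.ext fun x => ?_
  simp [h, hochB', coface]

theorem hochB_eq (n : ℕ) : hochB k H D M n = ((cnBd k n).lTensor M +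
    (-1 : k) ^ (n + 1) • twist M (cnLast (H := H) k n)).dualMap := by
  have h : hochB k H D M n = hochB' k H D M n +
      (-1 : k) ^ (n + 1) • coface k H D M n (Fin.last (n + 1)) := by
    rw [hochB, Fin.sum_univ_castSucc]
    rfl
  rw [h, hochB'_eq, coface, chainFace_of_lt k D M n (Fin.last (n + 1)) (by simp)]
  ext1 φ
  refine LinearMap.ext fun x => ?_
  simp

theorem hochB_hochB (n : ℕ) (φ : Cochain k D M n) :
    hochB k H D M (n + 1) (hochB k H D M n φ) = 0 := by
  have h : ((cnBd k n).lTensor M + (-1 : k) ^ (n + 1) • twist M (cnLast (H := H) k n)) ∘ₗ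
      ((cnBd k (n + 1)).lTensor M +
        (-1 : k) ^ (n + 1 + 1) • twist M (cnLast (H := H) k (n + 1))) =
      (0 : Chain k D M (n + 2) →ₗ[k] Chain k D M n) := by
    have key : (cnLast (H := H) k n).compl₂ (cnBd (D := D) k (n + 1)) =
        (cnLast k (n + 1)).compr₂ (cnBd k n) +
          (-1 : k) ^ (n + 1) • conv (cnLast k n) (cnLast k (n + 1)) := by
      ext1 h
      refine LinearMap.ext fun x => ?_
      simpa using cnLast_cnBd k n h x
    simp only [LinearMap.add_comp, LinearMap.comp_add, LinearMap.smul_comp, LinearMap.comp_smul,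
      ← LinearMap.lTensor_comp, cnBd_cnBd, twist_comp_lTensor, lTensor_comp_twist,
      twist_comp_twist, key, twist_add, twist_smul, LinearMap.lTensor_zero, pow_succ]
    rcases neg_one_pow_eq_or k n with h | h <;> simp only [h] <;> module
  rw [hochB_eq, hochB_eq]
  refine LinearMap.ext fun x => ?_
  exact (congrArg φ (LinearMap.congr_fun h x)).trans (map_zero φ)

theorem hochB'_hochB' (n : ℕ) (φ : Cochain k D M n) :
    hochB' k H D M (n + 1) (hochB' k H D M n φ) = 0 := by
  have h : (cnBd (D := D) k n).lTensor M ∘ₗ (cnBd k (n + 1)).lTensor M = 0 := by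
    rw [← LinearMap.lTensor_comp, cnBd_cnBd, LinearMap.lTensor_zero]
  rw [hochB'_eq, hochB'_eq]
  refine LinearMap.ext fun x => ?_
  exact (congrArg φ (LinearMap.congr_fun h x)).trans (map_zero φ)

/-- The signed cofaces `(-1)ⁱ δᵢ`, indexed by natural numbers, and zero for `i > n + 1`. -/
def signedCoface (n i : ℕ) : Cochain k D M n →ₗ[k] Cochain k D M (n + 1) :=
  if h : i < n + 2 then (-1 : k) ^ i • coface k H D M n ⟨i, h⟩ else 0

theorem hochB_eq_sum (n : ℕ) (φ : Cochain k D M n) : hochB k H D M n φ =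
    ∑ i ∈ Finset.range (n + 2), signedCoface (H := H) k D M n i φ := by
  rw [hochB, LinearMap.sum_apply, ← Fin.sum_univ_eq_sum_range
    (fun i => signedCoface (H := H) k D M n i φ)]
  simp [signedCoface]

theorem hochB'_eq_sum (n : ℕ) (φ : Cochain k D M n) : hochB' k H D M n φ =
    ∑ i ∈ Finset.range (n + 1), signedCoface (H := H) k D M n i φ := by
  rw [hochB', LinearMap.sum_apply, ← Fin.sum_univ_eq_sum_range
    (fun i => signedCoface (H := H) k D M n i φ)]
  refine Finset.sum_congr rfl fun i _ => ?_
  rw [signedCoface, dif_pos (by omega)]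
  rfl

theorem lam_signedCoface_succ (n i : ℕ) (hi : i ≤ n) (φ : Cochain k D M n) :
    lam k H D M (n + 1) (signedCoface (H := H) k D M n (i + 1) φ) =
      signedCoface (H := H) k D M n i (lam k H D M n φ) := by
  rw [signedCoface, dif_pos (by omega), signedCoface, dif_pos (by omega)]
  simp only [lam, LinearMap.smul_apply, map_smul]
  have := cocyc_coface_succ n ⟨i, by omega⟩ φ (H := H)
  simp only [Fin.succ_mk, Fin.castSucc_mk] at this
  rw [this]
  simp only [pow_succ, smul_smul]
  congr 1
  ring

theorem lam_signedCoface_zero (n : ℕ) (φ : Cochain k D M n) :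
    lam k H D M (n + 1) (signedCoface (H := H) k D M n 0 φ) =
      signedCoface (H := H) k D M n (n + 1) φ := by
  rw [signedCoface, dif_pos (by omega), signedCoface, dif_pos (by omega)]
  simp only [lam, LinearMap.smul_apply, pow_zero, one_smul]
  congr 1
  exact coface_zero_cocyc n φ

theorem one_sub_lam_hochB (n : ℕ) (φ : Cochain k D M n) :
    (1 - lam k H D M (n + 1)) (hochB k H D M n φ) =
      hochB' k H D M n ((1 - lam k H D M n) φ) := by
  simp only [hochB_eq_sum, hochB'_eq_sum, LinearMap.sub_apply, Module.End.one_apply]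
  exact sum_sub_cyclic (lam_signedCoface_succ k D M n) (lam_signedCoface_zero k D M n) φ

theorem hochB_normN (n : ℕ) (φ : Cochain k D M n) :
    hochB k H D M n (normN k H D M n φ) = normN k H D M (n + 1) (hochB' k H D M n φ) := by
  simp only [hochB_eq_sum, hochB'_eq_sum, normN, LinearMap.sum_apply]
  exact sum_norm_cyclic (lam_signedCoface_succ k D M n) (lam_signedCoface_zero k D M n) φ

variable {k D M}

theorem lam_mem {n : ℕ} {φ : Cochain k D M n} (hφ : φ ∈ HCochain k H D M n) :
    lam k H D M n φ ∈ HCochain k H D M n :=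
  Submodule.smul_mem _ _ (cocyc_mem hφ)

theorem lam_pow_mem {n : ℕ} {φ : Cochain k D M n} (hφ : φ ∈ HCochain k H D M n) (j : ℕ) :
    (lam k H D M n ^ j) φ ∈ HCochain k H D M n := by
  induction j with
  | zero => exact hφ
  | succ j ih => rw [pow_succ', Module.End.mul_apply]; exact lam_mem ih

theorem lam_pow {n : ℕ} {φ : Cochain k D M n} (hφ : φ ∈ HCochain k H D M n) :
    (lam k H D M n ^ (n + 1)) φ = φ := by
  rw [lam, smul_pow, LinearMap.smul_apply, cocyc_pow hφ, ← pow_mul,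
    Even.neg_one_pow (Nat.even_mul_succ_self n), one_smul]

theorem hochB_mem {n : ℕ} {φ : Cochain k D M n} (hφ : φ ∈ HCochain k H D M n) :
    hochB k H D M n φ ∈ HCochain k H D M (n + 1) := by
  rw [hochB, LinearMap.sum_apply]
  exact Submodule.sum_mem _ fun i _ => Submodule.smul_mem _ _ (coface_mem i hφ)

theorem hochB'_mem {n : ℕ} {φ : Cochain k D M n} (hφ : φ ∈ HCochain k H D M n) :
    hochB' k H D M n φ ∈ HCochain k H D M (n + 1) := by
  rw [hochB', LinearMap.sum_apply]
  exact Submodule.sum_mem _ fun i _ => Submodule.smul_mem _ _ (coface_mem i.castSucc hφ)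

variable (k D M)

theorem isComplex_hoch : IsComplex (HCochain k H D M) (hochB k H D M) :=
  fun n φ hφ => ⟨hochB_mem hφ, hochB_hochB k D M n φ⟩

theorem isDoubleComplex_cyclic :
    IsDoubleComplex (cyS k H D M) (cyV k H D M) (cyH k H D M) where
  v_mem p q φ hφ := by
    unfold cyV
    split_ifs
    · exact hochB_mem hφ
    · exact Submodule.neg_mem _ (hochB'_mem hφ)
  h_mem p q φ hφ := by
    unfold cyH
    split_ifs
    · exact Submodule.sub_mem _ hφ (lam_mem hφ)
    · rw [normN, LinearMap.sum_apply]
      exact Submodule.sum_mem _ fun i _ => lam_pow_mem hφ i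
  v_v p q φ hφ := by
    unfold cyV
    split_ifs
    · exact hochB_hochB k D M q φ
    · simp [hochB'_hochB' k D M q φ]
  h_h p q φ hφ := by
    unfold cyH
    by_cases hp : Even p
    · rw [if_pos hp, if_neg (by simpa [Nat.even_add_one] using hp), normN, LinearMap.sum_apply,
        LinearMap.sub_apply, Module.End.one_apply, sum_pow_sub_apply, lam_pow hφ, sub_self]
    · rw [if_neg hp, if_pos (by simpa [Nat.even_add_one] using hp), normN, LinearMap.sum_apply,
        LinearMap.sub_apply, Module.End.one_apply, sum_pow_sub_map, lam_pow hφ, sub_self]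
  v_h p q φ hφ := by
    unfold cyV cyH
    by_cases hp : Even p
    · simp only [Nat.even_add_one, hp, not_true_eq_false, if_true, if_false]
      rw [one_sub_lam_hochB, LinearMap.neg_apply, neg_add_cancel]
    · simp only [Nat.even_add_one, hp, not_false_eq_true, if_true, if_false]
      rw [hochB_normN, LinearMap.neg_apply, map_neg, add_neg_cancel]

end Complexes

/-! ### Homotopies -/

section Invariant

variable {k : Type u} [Field k] {D : Type u} [SmallCategory D] [Preadditive D] [Linear k D]
  {H : Type v} [Ring H] [HopfAlgebra k H] [HCategory k H D]

theorem act_comp_of_invariant {X Y Z : D} {u : X ⟶ Y}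
    (hu : ∀ h : H, HCategory.act (k := k) X Y h u = Coalgebra.counit (R := k) h • u) (f : Y ⟶ Z)
    (h : H) : HCategory.act (k := k) X Z h (u ≫ f) = u ≫ HCategory.act (k := k) Y Z h f := by
  conv_rhs => rw [← sum_counit_smul_left (k := k) h]
  simp [HCategory.act_comp, hu, Preadditive.comp_sum]

theorem strAct_cons_of_invariant (n : ℕ) {X Y Z : D} {u : Y ⟶ X}
    (hu : ∀ h : H, HCategory.act (k := k) Y X h u = Coalgebra.counit (R := k) h • u) (h : H)
    (p : Str k n Y Z) : strAct k H (n + 1) X Z h (strCons k n X Y Z (u ⊗ₜ p)) =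
      strCons k n X Y Z (u ⊗ₜ strAct k H n Y Z h p) := by
  conv_rhs => rw [← Coalgebra.sum_counit_smul (R := k) (ℛ k h)]
  simp [strAct_cons, hu, TensorProduct.tmul_sum, ← TensorProduct.smul_tmul']

theorem strAct_strMul_of_invariant (n : ℕ) {X Y Z : D} {u : Y ⟶ X}
    (hu : ∀ h : H, HCategory.act (k := k) Y X h u = Coalgebra.counit (R := k) h • u) (h : H)
    (p : Str k n Y Z) : strAct k H n X Z h (strMul k n X Y Z u p) =
      strMul k n X Y Z u (strAct k H n Y Z h p) := by
  conv_rhs => rw [← Coalgebra.sum_counit_smul (R := k) (ℛ k h)]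
  simp [strAct_strMul, hu]

theorem strAct_snoc_of_invariant (n : ℕ) {X Y Z : D} {u : Z ⟶ Y}
    (hu : ∀ h : H, HCategory.act (k := k) Z Y h u = Coalgebra.counit (R := k) h • u) (h : H)
    (p : Str k n X Y) : strAct k H (n + 1) X Z h (strSnoc k n X Y Z p u) =
      strSnoc k n X Y Z (strAct k H n X Y h p) u := by
  conv_rhs => rw [← sum_counit_smul_left (k := k) h]
  simp only [strAct_snoc, hu, map_sum, map_smul, LinearMap.sum_apply, LinearMap.smul_apply]

end Invariant

section Homotopy

variable (k : Type u) [Field k] {D : Type u} [SmallCategory D] [Preadditive D] [Linear k D]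
  {ι : Type*} [Fintype ι] (e ε : ∀ X : D, ι → (X ⟶ X))

/-- The homotopy attached to families of endomorphisms with `∑ e_q ε_q = 1` (a composite of
functions, written `ε_q ≫ e_q` below). It is the alternating
sum over `i` of
`∑ f⁰ e_{q₀} ⊗ ε_{q₀} f¹ e_{q₁} ⊗ ⋯ ⊗ ε_{qᵢ₋₁} fⁱ e_{qᵢ} ⊗ ε_{qᵢ} ⊗ fⁱ⁺¹ ⊗ ⋯ ⊗ fⁿ`,
written recursively in the first arrow. -/
def strHomotopy : (n : ℕ) → (X Z : D) → Str k n X Z →ₗ[k] Str k (n + 1) X Z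
  | 0, X, Z => ∑ q, strCons k 0 X Z Z ∘ₗ
      (TensorProduct.mk k (Z ⟶ X) (Str k 0 Z Z)).flip ((strZero k Z Z).symm (ε Z q)) ∘ₗ
        Linear.leftComp k X (e Z q) ∘ₗ (strZero k X Z).toLinearMap
  | n + 1, X, Z => strLift k fun Y => ∑ q, strCons k (n + 1) X Y Z ∘ₗ
      TensorProduct.map (Linear.leftComp k X (e Y q))
        (strCons k n Y Y Z ∘ₗ TensorProduct.mk k (Y ⟶ Y) (Str k n Y Z) (ε Y q) -
          strMul k (n + 1) Y Y Z (ε Y q) ∘ₗ strHomotopy n Y Z)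

/-- `f⁰ ⊗ ⋯ ⊗ fⁿ ↦ ∑ f⁰ e_{q₀} ⊗ ε_{q₀} f¹ e_{q₁} ⊗ ⋯ ⊗ ε_{qₙ₋₁} fⁿ e_c`. -/
def strConj (c : ι) : (n : ℕ) → (X Z : D) → Str k n X Z →ₗ[k] Str k n X Z
  | 0, X, Z => (strZero k X Z).symm.toLinearMap ∘ₗ Linear.leftComp k X (e Z c) ∘ₗ
      (strZero k X Z).toLinearMap
  | n + 1, X, Z => strLift k fun Y => ∑ q, strCons k n X Y Z ∘ₗ
      TensorProduct.map (Linear.leftComp k X (e Y q)) (strMul k n Y Y Z (ε Y q) ∘ₗ strConj c n Y Z)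

theorem strHomotopy_zero {X Z : D} (f : Z ⟶ X) :
    strHomotopy k e ε 0 X Z ((strZero k X Z).symm f) =
      ∑ q, strCons k 0 X Z Z ((e Z q ≫ f) ⊗ₜ (strZero k Z Z).symm (ε Z q)) := by
  simp [strHomotopy]

theorem strHomotopy_cons (n : ℕ) {X Y Z : D} (f : Y ⟶ X) (p : Str k n Y Z) :
    strHomotopy k e ε (n + 1) X Z (strCons k n X Y Z (f ⊗ₜ p)) =
      ∑ q, strCons k (n + 1) X Y Z ((e Y q ≫ f) ⊗ₜ (strCons k n Y Y Z (ε Y q ⊗ₜ p) -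
        strMul k (n + 1) Y Y Z (ε Y q) (strHomotopy k e ε n Y Z p))) := by
  simp [strHomotopy]

theorem strConj_zero (c : ι) {X Z : D} (f : Z ⟶ X) :
    strConj k e ε c 0 X Z ((strZero k X Z).symm f) = (strZero k X Z).symm (e Z c ≫ f) := by
  simp [strConj]

theorem strConj_cons (c : ι) (n : ℕ) {X Y Z : D} (f : Y ⟶ X) (p : Str k n Y Z) :
    strConj k e ε c (n + 1) X Z (strCons k n X Y Z (f ⊗ₜ p)) =
      ∑ q, strCons k n X Y Z ((e Y q ≫ f) ⊗ₜ
        strMul k n Y Y Z (ε Y q) (strConj k e ε c n Y Z p)) := by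
  simp [strConj]

/-- The last summand of the homotopy. -/
def strHomotopyLast (n : ℕ) (X Z : D) : Str k n X Z →ₗ[k] Str k (n + 1) X Z :=
  ∑ c, (strSnoc k n X Z Z).flip (ε Z c) ∘ₗ strConj k e ε c n X Z

theorem strHomotopyLast_apply (n : ℕ) {X Z : D} (x : Str k n X Z) :
    strHomotopyLast k e ε n X Z x = ∑ c, strSnoc k n X Z Z (strConj k e ε c n X Z x) (ε Z c) := by
  simp [strHomotopyLast]

theorem strHomotopyLast_cons (n : ℕ) {X Y Z : D} (f : Y ⟶ X) (p : Str k n Y Z) :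
    strHomotopyLast k e ε (n + 1) X Z (strCons k n X Y Z (f ⊗ₜ p)) =
      ∑ q, strCons k (n + 1) X Y Z ((e Y q ≫ f) ⊗ₜ
        strMul k (n + 1) Y Y Z (ε Y q) (strHomotopyLast k e ε n Y Z p)) := by
  simp only [strHomotopyLast_apply, strConj_cons, map_sum, LinearMap.sum_apply, strSnoc_cons,
    strMul_snoc, TensorProduct.tmul_sum]
  exact Finset.sum_comm

theorem strHomotopy_zero_eq {X Z : D} (x : Str k 0 X Z) :
    strHomotopy k e ε 0 X Z x = strHomotopyLast k e ε 0 X Z x := by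
  induction x using str_zero_induction with
  | h f => simp [strHomotopy_zero, strHomotopyLast_apply, strConj_zero]

/-- Appending an arrow to a string adds one summand to the homotopy. -/
theorem strHomotopy_snoc (n : ℕ) {X Y Z : D} (p : Str k n X Y) (f : Z ⟶ Y) :
    strHomotopy k e ε (n + 1) X Z (strSnoc k n X Y Z p f) =
      strSnoc k (n + 1) X Y Z (strHomotopy k e ε n X Y p) f +
        (-1 : k) ^ (n + 1) • strHomotopyLast k e ε (n + 1) X Z (strSnoc k n X Y Z p f) := by
  induction n generalizing X with
  | zero =>
    induction p using str_zero_induction with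
    | h g =>
      rw [strSnoc_zero, strHomotopy_cons, strHomotopyLast_cons, ← strHomotopy_zero_eq,
        strHomotopy_zero k e ε g]
      simp only [map_sum, LinearMap.sum_apply, strSnoc_cons, strSnoc_zero, TensorProduct.tmul_sub,
        map_sub, Finset.sum_sub_distrib, zero_add, pow_one, neg_smul, one_smul]
      exact sub_eq_add_neg _ _
  | succ n ih =>
    induction p using str_cons_induction with
    | add x y hx hy =>
      simp only [map_add, LinearMap.add_apply, hx, hy, smul_add]
      exact add_add_add_comm _ _ _ _
    | cons W g p =>
      simp only [strSnoc_cons, strHomotopy_cons, strHomotopyLast_cons, ih, map_sum,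
        LinearMap.sum_apply, Finset.smul_sum, ← Finset.sum_add_distrib]
      refine Finset.sum_congr rfl fun q _ => ?_
      simp only [strSnoc_cons, map_sub, map_add, map_smul, LinearMap.sub_apply,
        TensorProduct.tmul_sub, TensorProduct.tmul_add, TensorProduct.tmul_smul, strMul_snoc,
        pow_succ _ (n + 1)]
      module

theorem strHomotopy_mul (n : ℕ) {X Y Z : D} (u : Y ⟶ X) (x : Str k n Y Z) :
    strHomotopy k e ε n X Z (strMul k n X Y Z u x) =
      strMul k (n + 1) X Y Z u (strHomotopy k e ε n Y Z x) := by
  cases n with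
  | zero =>
    induction x using str_zero_induction with
    | h f => simp [strHomotopy_zero]
  | succ n =>
    induction x using str_cons_induction with
    | add x y hx hy => simp only [map_add, hx, hy]
    | cons W f p => simp [strHomotopy_cons]

variable {e ε}

theorem sum_comp_comp (hsum : ∀ X : D, ∑ q, ε X q ≫ e X q = 𝟙 X) {X Y : D} (f : Y ⟶ X) :
    ∑ q, ε Y q ≫ e Y q ≫ f = f := by
  simp only [← Category.assoc, ← Preadditive.sum_comp, hsum, Category.id_comp]

theorem strBd_homotopy_zero (hsum : ∀ X : D, ∑ q, ε X q ≫ e X q = 𝟙 X) {X Z : D}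
    (x : Str k 0 X Z) : strBd k 0 X Z (strHomotopy k e ε 0 X Z x) = x := by
  induction x using str_zero_induction with
  | h f =>
    simp only [strHomotopy_zero, map_sum, strBd_zero_cons, strMul_zero]
    rw [← map_sum, sum_comp_comp hsum]

/-- The homotopy contracts the bar complex of strings; the map `strConj` only appears once the
last face is taken into account. -/
theorem strBd_homotopy (hsum : ∀ X : D, ∑ q, ε X q ≫ e X q = 𝟙 X) (n : ℕ) {X Z : D}
    (x : Str k (n + 1) X Z) :
    strBd k (n + 1) X Z (strHomotopy k e ε (n + 1) X Z x) +
      strHomotopy k e ε n X Z (strBd k n X Z x) = x := by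
  -- the part of `dh` in which the first two arrows are composed
  have key : ∀ (n : ℕ) {X Y Z : D} (f : Y ⟶ X) (p : Str k n Y Z),
      ∑ q, strMul k (n + 1) X Y Z (e Y q ≫ f) (strCons k n Y Y Z (ε Y q ⊗ₜ p) -
        strMul k (n + 1) Y Y Z (ε Y q) (strHomotopy k e ε n Y Z p)) =
      strCons k n X Y Z (f ⊗ₜ p) - strMul k (n + 1) X Y Z f (strHomotopy k e ε n Y Z p) := by
    intro n X Y Z f p
    simp only [map_sub, strMul_cons, strMul_strMul, Finset.sum_sub_distrib, ← map_sum,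
      ← TensorProduct.sum_tmul, ← LinearMap.sum_apply, sum_comp_comp hsum]
  induction n generalizing X with
  | zero =>
    induction x using str_cons_induction with
    | add x y hx hy =>
      simp only [map_add]
      rw [add_add_add_comm, hx, hy]
    | cons Y f p =>
      simp only [strHomotopy_cons, map_sum, strBd_cons, Finset.sum_sub_distrib, key]
      simp [strBd_zero_cons, strBd_mul, strBd_homotopy_zero k hsum, strHomotopy_mul]
  | succ n ih =>
    induction x using str_cons_induction with
    | add x y hx hy =>
      simp only [map_add]
      rw [add_add_add_comm, hx, hy]
    | cons Y f p =>
      have hp := eq_sub_of_add_eq (ih p)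
      simp only [strHomotopy_cons, map_sum, strBd_cons, Finset.sum_sub_distrib, key]
      simp only [map_sub, strBd_cons, strBd_mul, hp, strHomotopy_mul, strHomotopy_cons,
        TensorProduct.tmul_sub, Finset.sum_sub_distrib]
      abel

variable {H : Type v} [Ring H] [HopfAlgebra k H] [HCategory k H D]

theorem strHomotopy_act
    (he : ∀ X q (h : H), HCategory.act (k := k) X X h (e X q) =
      Coalgebra.counit (R := k) h • e X q)
    (hε : ∀ X q (h : H), HCategory.act (k := k) X X h (ε X q) =
      Coalgebra.counit (R := k) h • ε X q) (n : ℕ) {X Z : D} (h : H) (x : Str k n X Z) :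
    strHomotopy k e ε n X Z (strAct k H n X Z h x) =
      strAct k H (n + 1) X Z h (strHomotopy k e ε n X Z x) := by
  induction n generalizing X h with
  | zero =>
    induction x using str_zero_induction with
    | h f =>
      simp only [strAct_zero, strHomotopy_zero, map_sum]
      refine Finset.sum_congr rfl fun q _ => ?_
      rw [← strSnoc_zero, ← strSnoc_zero, strAct_snoc_of_invariant 0 (hε _ _), strAct_zero,
        act_comp_of_invariant (he _ _)]
  | succ n ih =>
    induction x using str_cons_induction with
    | add x y hx hy => simp only [map_add, hx, hy]
    | cons Y f p =>
      simp only [strHomotopy_cons, strAct_cons k n h, strAct_cons k (n + 1) h, map_sum,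
        act_comp_of_invariant (he _ _), map_sub, strAct_cons_of_invariant n (hε _ _),
        strAct_strMul_of_invariant (n + 1) (hε _ _), ih]
      exact Finset.sum_comm

variable (e ε) in
/-- The homotopy on the additive cyclic nerve. -/
def cnHomotopy (n : ℕ) : CN k D n →ₗ[k] CN k D (n + 1) :=
  cnLift k fun X => cnOf k (n + 1) X ∘ₗ strHomotopy k e ε n X X

theorem cnHomotopy_of (n : ℕ) {X : D} (x : Str k n X X) :
    cnHomotopy k e ε n (cnOf k n X x) = cnOf k (n + 1) X (strHomotopy k e ε n X X x) := by
  simp [cnHomotopy]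

variable (e ε) in
/-- `f⁰ ⊗ ⋯ ⊗ fⁿ ↦ ∑ ε_c f⁰ e_{q₀} ⊗ ε_{q₀} f¹ e_{q₁} ⊗ ⋯ ⊗ ε_{qₙ₋₁} fⁿ e_c`. -/
def cnConj (n : ℕ) : CN k D n →ₗ[k] CN k D n :=
  cnLift k fun X => cnOf k n X ∘ₗ ∑ c, strMul k n X X X (ε X c) ∘ₗ strConj k e ε c n X X

theorem cnConj_of (n : ℕ) {X : D} (x : Str k n X X) :
    cnConj k e ε n (cnOf k n X x) =
      cnOf k n X (∑ c, strMul k n X X X (ε X c) (strConj k e ε c n X X x)) := by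
  simp [cnConj]

theorem cnLast_homotopyLast
    (hε : ∀ X q (h : H), HCategory.act (k := k) X X h (ε X q) =
      Coalgebra.counit (R := k) h • ε X q) (n : ℕ) {X : D} (h : H) (x : Str k n X X) :
    cnLast k n h (cnOf k (n + 1) X (strHomotopyLast k e ε n X X x)) =
      Coalgebra.counit (R := k) h • cnConj k e ε n (cnOf k n X x) := by
  simp [strHomotopyLast_apply, cnLast_snoc, hε, cnConj_of, Finset.smul_sum]

theorem cnLast_homotopy_zero
    (hε : ∀ X q (h : H), HCategory.act (k := k) X X h (ε X q) =
      Coalgebra.counit (R := k) h • ε X q) (h : H) (x : CN k D 0) :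
    cnLast k 0 h (cnHomotopy k e ε 0 x) =
      Coalgebra.counit (R := k) h • cnConj k e ε 0 x := by
  induction x using cn_induction with
  | zero => simp
  | add x y hx hy => simp only [map_add, hx, hy, smul_add]
  | of X x => rw [cnHomotopy_of, strHomotopy_zero_eq, cnLast_homotopyLast k hε]

/-- The twisted last face commutes with the homotopy, up to the contribution of its last summand.
The twist disappears there, since `H` acts on `ε_c` through the counit. -/
theorem cnLast_homotopy
    (hε : ∀ X q (h : H), HCategory.act (k := k) X X h (ε X q) =
      Coalgebra.counit (R := k) h • ε X q) (n : ℕ) (h : H) (x : CN k D (n + 1)) :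
    cnLast k (n + 1) h (cnHomotopy k e ε (n + 1) x) =
      cnHomotopy k e ε n (cnLast k n h x) +
        (-1 : k) ^ (n + 1) • Coalgebra.counit (R := k) h • cnConj k e ε (n + 1) x := by
  induction x using cn_snoc_induction with
  | zero => simp
  | add x y hx hy =>
    simp only [map_add, hx, hy, smul_add]
    exact add_add_add_comm _ _ _ _
  | snoc X Y p f =>
    rw [cnHomotopy_of, strHomotopy_snoc, map_add, map_add, map_smul, map_smul,
      cnLast_homotopyLast k hε, cnLast_snoc, cnLast_snoc, cnHomotopy_of, strHomotopy_mul]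

theorem cnHomotopy_act
    (he : ∀ X q (h : H), HCategory.act (k := k) X X h (e X q) =
      Coalgebra.counit (R := k) h • e X q)
    (hε : ∀ X q (h : H), HCategory.act (k := k) X X h (ε X q) =
      Coalgebra.counit (R := k) h • ε X q) (n : ℕ) (h : H) (x : CN k D n) :
    cnHomotopy k e ε n (cnAct k H n h x) = cnAct k H (n + 1) h (cnHomotopy k e ε n x) := by
  induction x using cn_induction with
  | zero => simp
  | add x y hx hy => simp only [map_add, hx, hy]
  | of X x => simp only [cnAct_of, cnHomotopy_of, strHomotopy_act k he hε]

theorem cnBd_homotopy_zero (hsum : ∀ X : D, ∑ q, ε X q ≫ e X q = 𝟙 X) :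
    cnBd k 0 ∘ₗ cnHomotopy k e ε 0 = LinearMap.id :=
  cn_hom_ext fun X x => by simp [cnHomotopy_of, cnBd_of, strBd_homotopy_zero k hsum]

theorem cnBd_homotopy (hsum : ∀ X : D, ∑ q, ε X q ≫ e X q = 𝟙 X) (n : ℕ) :
    cnBd k (n + 1) ∘ₗ cnHomotopy k e ε (n + 1) + cnHomotopy k e ε n ∘ₗ cnBd k n =
      LinearMap.id :=
  cn_hom_ext fun X x => by
    simp only [LinearMap.add_apply, LinearMap.comp_apply, cnHomotopy_of, cnBd_of, ← map_add,
      strBd_homotopy k hsum, LinearMap.id_apply]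

variable [BijectiveAntipode k H] {M : Type w} [AddCommGroup M] [Module k M] [SAYDModule k H M]

theorem hochB_homotopy_zero (hsum : ∀ X : D, ∑ q, ε X q ≫ e X q = 𝟙 X)
    (hε : ∀ X q (h : H), HCategory.act (k := k) X X h (ε X q) =
      Coalgebra.counit (R := k) h • ε X q) (φ : Cochain k D M 0) :
    hochB k H D M 0 φ ∘ₗ (cnHomotopy k e ε 0).lTensor M =
      φ - φ ∘ₗ (cnConj k e ε 0).lTensor M := by
  have h₁ : (cnLast (H := H) k 0).compl₂ (cnHomotopy k e ε 0) =
      (Coalgebra.counit (R := k) (A := H)).smulRight (cnConj k e ε 0) := by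
    ext1 h
    refine LinearMap.ext fun x => ?_
    simpa using cnLast_homotopy_zero k hε h x
  have h₂ : ((cnBd k 0).lTensor M + (-1 : k) ^ (0 + 1) • twist M (cnLast (H := H) k 0)) ∘ₗ
      (cnHomotopy k e ε 0).lTensor M = LinearMap.id - (cnConj k e ε 0).lTensor M := by
    rw [LinearMap.add_comp, LinearMap.smul_comp, ← LinearMap.lTensor_comp, twist_comp_lTensor,
      h₁, twist_counit, cnBd_homotopy_zero k hsum, LinearMap.lTensor_id]
    module
  rw [hochB_eq]
  refine LinearMap.ext fun x => ?_
  exact (congrArg φ (LinearMap.congr_fun h₂ x)).trans (map_sub φ _ _)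

/-- The homotopy on `M ⊗ CN` connects the identity with the map `cnConj`. -/
theorem hochB_homotopy (hsum : ∀ X : D, ∑ q, ε X q ≫ e X q = 𝟙 X)
    (hε : ∀ X q (h : H), HCategory.act (k := k) X X h (ε X q) =
      Coalgebra.counit (R := k) h • ε X q) (n : ℕ) (φ : Cochain k D M (n + 1)) :
    hochB k H D M (n + 1) φ ∘ₗ (cnHomotopy k e ε (n + 1)).lTensor M +
      hochB k H D M n (φ ∘ₗ (cnHomotopy k e ε n).lTensor M) =
        φ - φ ∘ₗ (cnConj k e ε (n + 1)).lTensor M := by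
  have h₁ : (cnLast (H := H) k (n + 1)).compl₂ (cnHomotopy k e ε (n + 1)) =
      (cnLast (H := H) k n).compr₂ (cnHomotopy k e ε n) + (-1 : k) ^ (n + 1) •
        (Coalgebra.counit (R := k) (A := H)).smulRight (cnConj k e ε (n + 1)) := by
    ext1 h
    refine LinearMap.ext fun x => ?_
    simpa using cnLast_homotopy k hε n h x
  have h₂ : ((cnBd k (n + 1)).lTensor M +
        (-1 : k) ^ (n + 1 + 1) • twist M (cnLast (H := H) k (n + 1))) ∘ₗ
      (cnHomotopy k e ε (n + 1)).lTensor M + (cnHomotopy k e ε n).lTensor M ∘ₗ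
        ((cnBd k n).lTensor M + (-1 : k) ^ (n + 1) • twist M (cnLast (H := H) k n)) =
      LinearMap.id - (cnConj k e ε (n + 1)).lTensor M := by
    rw [LinearMap.add_comp, LinearMap.smul_comp, ← LinearMap.lTensor_comp, twist_comp_lTensor,
      h₁, twist_add, twist_smul, twist_counit, LinearMap.comp_add, LinearMap.comp_smul,
      ← LinearMap.lTensor_comp, lTensor_comp_twist, ← LinearMap.lTensor_id M (CN k D (n + 1)),
      ← cnBd_homotopy k hsum n, LinearMap.lTensor_add, pow_succ _ (n + 1)]
    rcases neg_one_pow_eq_or k (n + 1) with h | h <;> simp only [h] <;> module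
  rw [hochB_eq, hochB_eq]
  refine LinearMap.ext fun x => ?_
  exact (map_add φ _ _).symm.trans ((congrArg φ (LinearMap.congr_fun h₂ x)).trans (map_sub φ _ _))

end Homotopy

section BarContraction

variable (k : Type u) [Field k] {D : Type u} [SmallCategory D] [Preadditive D] [Linear k D]
  {H : Type v} [Ring H] [HopfAlgebra k H] [HCategory k H D]

/-- `f⁰ ⊗ ⋯ ⊗ fⁿ ↦ id ⊗ f⁰ ⊗ ⋯ ⊗ fⁿ`. -/
def cnExtraDegen (n : ℕ) : CN k D n →ₗ[k] CN k D (n + 1) :=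
  cnLift k fun X => cnOf k (n + 1) X ∘ₗ strCons k n X X X ∘ₗ
    TensorProduct.mk k (X ⟶ X) (Str k n X X) (𝟙 X)

theorem cnExtraDegen_of (n : ℕ) {X : D} (x : Str k n X X) :
    cnExtraDegen k n (cnOf k n X x) = cnOf k (n + 1) X (strCons k n X X X (𝟙 X ⊗ₜ x)) := by
  simp [cnExtraDegen]

theorem cnExtraDegen_act (n : ℕ) (h : H) (x : CN k D n) :
    cnExtraDegen k n (cnAct k H n h x) = cnAct k H (n + 1) h (cnExtraDegen k n x) := by
  induction x using cn_induction with
  | zero => simp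
  | add x y hx hy => simp only [map_add, hx, hy]
  | of X x => simp only [cnAct_of, cnExtraDegen_of, strAct_cons_one]

theorem cnBd_extraDegen_zero : cnBd k 0 ∘ₗ cnExtraDegen k 0 = (LinearMap.id : CN k D 0 →ₗ[k] _) :=
  cn_hom_ext fun X x => by simp [cnExtraDegen_of, cnBd_of, strBd_zero_cons]

theorem cnBd_extraDegen (n : ℕ) :
    cnBd k (n + 1) ∘ₗ cnExtraDegen k (n + 1) + cnExtraDegen k n ∘ₗ cnBd k n =
      (LinearMap.id : CN k D (n + 1) →ₗ[k] _) :=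
  cn_hom_ext fun X x => by
    simp only [LinearMap.add_apply, LinearMap.comp_apply, cnExtraDegen_of, cnBd_of, ← map_add,
      strBd_cons, strMul_one, sub_add_cancel, LinearMap.id_apply]

variable [BijectiveAntipode k H] {M : Type w} [AddCommGroup M] [Module k M] [SAYDModule k H M]

theorem hochB'_extraDegen_zero (φ : Cochain k D M 0) :
    hochB' k H D M 0 φ ∘ₗ (cnExtraDegen k 0).lTensor M = φ := by
  have h : (cnBd (D := D) k 0).lTensor M ∘ₗ (cnExtraDegen k 0).lTensor M = LinearMap.id := by
    rw [← LinearMap.lTensor_comp, cnBd_extraDegen_zero, LinearMap.lTensor_id]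
  rw [hochB'_eq]
  exact LinearMap.ext fun x => congrArg φ (LinearMap.congr_fun h x)

theorem hochB'_extraDegen (n : ℕ) (φ : Cochain k D M (n + 1)) :
    hochB' k H D M (n + 1) φ ∘ₗ (cnExtraDegen k (n + 1)).lTensor M +
      hochB' k H D M n (φ ∘ₗ (cnExtraDegen k n).lTensor M) = φ := by
  have h : (cnBd (D := D) k (n + 1)).lTensor M ∘ₗ (cnExtraDegen k (n + 1)).lTensor M +
      (cnExtraDegen k n).lTensor M ∘ₗ (cnBd k n).lTensor M = LinearMap.id := by
    rw [← LinearMap.lTensor_comp, ← LinearMap.lTensor_comp, ← LinearMap.lTensor_add,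
      cnBd_extraDegen, LinearMap.lTensor_id]
  rw [hochB'_eq, hochB'_eq]
  exact LinearMap.ext fun x =>
    (map_add φ _ _).symm.trans (congrArg φ (LinearMap.congr_fun h x))

end BarContraction

/-! ### Morphisms of the linearization -/

section MatrixHoms

variable {k : Type u} [Field k] {D : Type u} [SmallCategory D] [Preadditive D] [Linear k D] {r : ℕ}

/-- The morphism `f ⊗ B` of `D ⊗ M_r(k)`. -/
def matMk {X Y : MatCat k D r} (f : X.obj ⟶ Y.obj) (B : Matrix (Fin r) (Fin r) k) : X ⟶ Y :=
  (matHom X Y).symm (f ⊗ₜ B)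

theorem mat_hom_induction {X Y : MatCat k D r} {P : (X ⟶ Y) → Prop} (zero : P 0)
    (add : ∀ f g, P f → P g → P (f + g)) (mk : ∀ f B, P (matMk f B)) (f : X ⟶ Y) : P f := by
  obtain ⟨t, rfl⟩ := (matHom X Y).symm.surjective f
  induction t with
  | zero => rw [map_zero]; exact zero
  | tmul f B => exact mk f B
  | add a b ha hb => rw [map_add]; exact add _ _ ha hb

theorem matMk_comp {X Y Z : MatCat k D r} (f : X.obj ⟶ Y.obj) (g : Y.obj ⟶ Z.obj)
    (B C : Matrix (Fin r) (Fin r) k) :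
    (matMk f B ≫ matMk g C : X ⟶ Z) = matMk (f ≫ g) (C * B) := rfl

theorem id_eq_matMk (X : MatCat k D r) : 𝟙 X = matMk (𝟙 X.obj) 1 := rfl

theorem matMk_smul {X Y : MatCat k D r} (c : k) (f : X.obj ⟶ Y.obj)
    (B : Matrix (Fin r) (Fin r) k) :
    (matMk (c • f) B : X ⟶ Y) = c • matMk f B := by
  simp [matMk, ← TensorProduct.smul_tmul']

theorem matMk_sum {X Y : MatCat k D r} (f : X.obj ⟶ Y.obj)
    (B : Fin r → Matrix (Fin r) (Fin r) k) :
    (matMk f (∑ q, B q) : X ⟶ Y) = ∑ q, matMk f (B q) := by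
  simp [matMk, TensorProduct.tmul_sum]

/-- The matrix entry `f ⊗ B ↦ B_dc f` of a morphism. -/
def homEntry (d c : Fin r) (X Y : MatCat k D r) : (X ⟶ Y) →ₗ[k] (X.obj ⟶ Y.obj) :=
  (TensorProduct.rid k (X.obj ⟶ Y.obj)).toLinearMap ∘ₗ
    (Matrix.entryLinearMap k k d c).lTensor (X.obj ⟶ Y.obj) ∘ₗ (matHom X Y).toLinearMap

theorem homEntry_mk (d c : Fin r) {X Y : MatCat k D r} (f : X.obj ⟶ Y.obj)
    (B : Matrix (Fin r) (Fin r) k) : homEntry d c X Y (matMk f B) = B d c • f := by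
  simp [homEntry, matMk]

/-- The entries of a composite are given by the matrix product. -/
theorem homEntry_comp (d c : Fin r) {X Y Z : MatCat k D r} (f : X ⟶ Y) (g : Y ⟶ Z) :
    homEntry d c X Z (f ≫ g) = ∑ q, homEntry q c X Y f ≫ homEntry d q Y Z g := by
  induction f using mat_hom_induction with
  | zero => simp
  | add f f' hf hf' =>
    simp only [Preadditive.add_comp, map_add, hf, hf', Finset.sum_add_distrib]
  | mk f B =>
    induction g using mat_hom_induction with
    | zero => simp
    | add g g' hg hg' =>
      simp only [Preadditive.comp_add, map_add, hg, hg', Finset.sum_add_distrib]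
    | mk g C =>
      simp only [matMk_comp, homEntry_mk, Matrix.mul_apply, Finset.sum_smul, Linear.smul_comp,
        Linear.comp_smul, smul_smul]

theorem homEntry_id (d c : Fin r) (X : MatCat k D r) :
    homEntry d c X X (𝟙 X) = if d = c then 𝟙 X.obj else 0 := by
  rw [id_eq_matMk, homEntry_mk, Matrix.one_apply, ite_smul, one_smul, zero_smul]

theorem homEntry_incHom (p d c : Fin r) {X Y : D} (f : X ⟶ Y) :
    homEntry d c ⟨X⟩ ⟨Y⟩ (incHom (k := k) p X Y f) = if p = d ∧ p = c then f else 0 := by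
  change homEntry d c ⟨X⟩ ⟨Y⟩ (matMk (k := k) f (Matrix.single p p 1)) = _
  rw [homEntry_mk, Matrix.single_apply, ite_smul, one_smul, zero_smul]

theorem incHom_comp (p : Fin r) {X Y Z : D} (f : X ⟶ Y) (g : Y ⟶ Z) :
    (incHom p X Z (f ≫ g) : (⟨X⟩ : MatCat k D r) ⟶ ⟨Z⟩) = incHom p X Y f ≫ incHom p Y Z g := by
  change matMk (f ≫ g) (Matrix.single p p 1) = matMk (f ≫ g) (Matrix.single p p (1 : k) *
    Matrix.single p p 1)
  simp

/-- The column endomorphism `id ⊗ E_qp`, in the role of `e_q` in the homotopy. -/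
def matCol (p : Fin r) (X : MatCat k D r) (q : Fin r) : X ⟶ X :=
  matMk (𝟙 X.obj) (Matrix.single q p 1)

/-- The row endomorphism `id ⊗ E_pq`, in the role of `ε_q` in the homotopy. -/
def matRow (p : Fin r) (X : MatCat k D r) (q : Fin r) : X ⟶ X :=
  matMk (𝟙 X.obj) (Matrix.single p q 1)

theorem sum_matRow_comp_matCol (p : Fin r) (X : MatCat k D r) :
    ∑ q, matRow p X q ≫ matCol p X q = 𝟙 X := by
  simp only [matRow, matCol, matMk_comp, Matrix.single_mul_single_same, mul_one, ← matMk_sum,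
    Category.comp_id, id_eq_matMk X]
  congr 1
  ext i j
  simp [Matrix.sum_apply, Matrix.single_apply, Matrix.one_apply, ite_and]

theorem matCol_comp_matRow (p q d : Fin r) {X Y : MatCat k D r} (f : X ⟶ Y) :
    (matCol p X q ≫ f) ≫ matRow p Y d = incHom p X.obj Y.obj (homEntry d q X Y f) := by
  induction f using mat_hom_induction with
  | zero => simp
  | add f f' hf hf' => simp only [Preadditive.comp_add, Preadditive.add_comp, map_add, hf, hf']
  | mk f B =>
    rw [homEntry_mk]
    change matMk ((𝟙 X.obj ≫ f) ≫ 𝟙 Y.obj) (Matrix.single p d 1 * (B * Matrix.single q p 1)) =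
      matMk (B d q • f) (Matrix.single p p 1)
    rw [matMk_smul, ← mul_assoc, Matrix.single_mul_mul_single, Category.id_comp,
      Category.comp_id]
    simp only [matMk, one_mul, mul_one, ← map_smul, ← TensorProduct.tmul_smul,
      Matrix.smul_single, smul_eq_mul]

section Action

variable {H : Type v} [Ring H] [HopfAlgebra k H] [HCategory k H D]

theorem act_matMk {X Y : MatCat k D r} (h : H) (f : X.obj ⟶ Y.obj)
    (B : Matrix (Fin r) (Fin r) k) :
    HCategory.act (k := k) X Y h (matMk f B) =
      matMk (HCategory.act (k := k) X.obj Y.obj h f) B := rfl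

theorem homEntry_act (d c : Fin r) {X Y : MatCat k D r} (h : H) (f : X ⟶ Y) :
    homEntry d c X Y (HCategory.act (k := k) X Y h f) =
      HCategory.act (k := k) X.obj Y.obj h (homEntry d c X Y f) := by
  induction f using mat_hom_induction with
  | zero => simp
  | add f f' hf hf' => simp only [map_add, hf, hf']
  | mk f B => rw [act_matMk, homEntry_mk, homEntry_mk, map_smul]

theorem incHom_act (p : Fin r) {X Y : D} (h : H) (f : X ⟶ Y) :
    (incHom p X Y (HCategory.act (k := k) X Y h f) : (⟨X⟩ : MatCat k D r) ⟶ ⟨Y⟩) =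
      HCategory.act (k := k) (⟨X⟩ : MatCat k D r) ⟨Y⟩ h (incHom p X Y f) := rfl

theorem act_matCol (p : Fin r) (X : MatCat k D r) (q : Fin r) (h : H) :
    HCategory.act (k := k) X X h (matCol p X q) =
      Coalgebra.counit (R := k) h • matCol p X q := by
  rw [matCol, act_matMk, HCategory.act_id, matMk_smul]

theorem act_matRow (p : Fin r) (X : MatCat k D r) (q : Fin r) (h : H) :
    HCategory.act (k := k) X X h (matRow p X q) =
      Coalgebra.counit (R := k) h • matRow p X q := by
  rw [matRow, act_matMk, HCategory.act_id, matMk_smul]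

end Action

end MatrixHoms

/-! ### Strings of matrices: inclusion and trace -/

section MatrixStrings

variable {k : Type u} [Field k] {D : Type u} [SmallCategory D] [Preadditive D] [Linear k D] {r : ℕ}

/-- The matrix entry `(f⁰ ⊗ B⁰) ⊗ ⋯ ⊗ (fⁿ ⊗ Bⁿ) ↦ (B⁰ ⋯ Bⁿ)_dc f⁰ ⊗ ⋯ ⊗ fⁿ` of a string. -/
def strEntry (d c : Fin r) (n : ℕ) (X Z : MatCat k D r) :
    Str k n X Z →ₗ[k] Str k n X.obj Z.obj :=
  (TensorProduct.rid k (Str k n X.obj Z.obj)).toLinearMap ∘ₗ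
    (Matrix.entryLinearMap k k d c).lTensor (Str k n X.obj Z.obj) ∘ₗ strMat n X Z

theorem strEntry_zero (d c : Fin r) {X Z : MatCat k D r} (f : Z ⟶ X) :
    strEntry d c 0 X Z ((strZero k X Z).symm f) =
      (strZero k X.obj Z.obj).symm (homEntry d c Z X f) := by
  induction f using mat_hom_induction with
  | zero => simp
  | add f f' hf hf' => simp only [map_add, hf, hf']
  | mk f B => rw [homEntry_mk]; simp [strEntry, strMat, matMk]

theorem strMat_cons_mk (n : ℕ) {X Y Z : MatCat k D r} (f : Y.obj ⟶ X.obj)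
    (B : Matrix (Fin r) (Fin r) k) (p : Str k n Y Z) :
    strMat (n + 1) X Z (strCons k n X Y Z (matMk f B ⊗ₜ p)) =
      TensorProduct.map (strCons k n X.obj Y.obj Z.obj ∘ₗ TensorProduct.mk k _ _ f)
        (LinearMap.mulLeft k B) (strMat n Y Z p) := by
  simp only [strMat, strLift_cons, LinearMap.comp_apply, TensorProduct.map_tmul, matMk,
    LinearEquiv.coe_coe, LinearEquiv.apply_symm_apply]
  generalize strMat n Y Z p = t
  induction t with
  | zero => simp
  | tmul x C => simp
  | add a b ha hb => simp only [TensorProduct.tmul_add, map_add, ha, hb]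

/-- The entries of a string are given by the matrix product. -/
theorem strEntry_cons (d c : Fin r) (n : ℕ) {X Y Z : MatCat k D r} (f : Y ⟶ X)
    (p : Str k n Y Z) :
    strEntry d c (n + 1) X Z (strCons k n X Y Z (f ⊗ₜ p)) =
      ∑ q, strCons k n X.obj Y.obj Z.obj (homEntry d q Y X f ⊗ₜ strEntry q c n Y Z p) := by
  induction f using mat_hom_induction with
  | zero => simp
  | add f f' hf hf' =>
    simp only [TensorProduct.add_tmul, map_add, hf, hf', Finset.sum_add_distrib]
  | mk f B =>
    simp only [strEntry, LinearMap.comp_apply, strMat_cons_mk, homEntry_mk]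
    generalize strMat n Y Z p = t
    induction t with
    | zero => simp
    | tmul x C =>
      simp [Matrix.mul_apply, Finset.sum_smul, ← TensorProduct.smul_tmul', smul_smul, mul_comm]
    | add a b ha hb =>
      simp only [TensorProduct.tmul_add, map_add, ha, hb, Finset.sum_add_distrib]

theorem strEntry_snoc (d c : Fin r) (n : ℕ) {X Y Z : MatCat k D r} (p : Str k n X Y)
    (f : Z ⟶ Y) :
    strEntry d c (n + 1) X Z (strSnoc k n X Y Z p f) =
      ∑ q, strSnoc k n X.obj Y.obj Z.obj (strEntry d q n X Y p) (homEntry q c Z Y f) := by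
  induction n generalizing X d with
  | zero =>
    induction p using str_zero_induction with
    | h g => simp only [strSnoc_zero, strEntry_cons, strEntry_zero]
  | succ n ih =>
    induction p using str_cons_induction with
    | add x y hx hy =>
      simp only [map_add, LinearMap.add_apply, hx, hy, Finset.sum_add_distrib]
    | cons W g p =>
      simp only [strSnoc_cons, strEntry_cons, ih, TensorProduct.tmul_sum, map_sum,
        LinearMap.sum_apply]
      exact Finset.sum_comm

theorem strEntry_mul (d c : Fin r) (n : ℕ) {X Y Z : MatCat k D r} (f : Y ⟶ X)
    (p : Str k n Y Z) :
    strEntry d c n X Z (strMul k n X Y Z f p) =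
      ∑ q, strMul k n X.obj Y.obj Z.obj (homEntry d q Y X f) (strEntry q c n Y Z p) := by
  cases n with
  | zero =>
    induction p using str_zero_induction with
    | h g => simp only [strMul_zero, strEntry_zero, homEntry_comp, map_sum]
  | succ n =>
    induction p using str_cons_induction with
    | add x y hx hy => simp only [map_add, hx, hy, Finset.sum_add_distrib]
    | cons W g p =>
      simp only [strMul_cons, strEntry_cons, homEntry_comp, TensorProduct.sum_tmul, map_sum]
      exact Finset.sum_comm

theorem strEntry_face (d c : Fin r) (n i : ℕ) {X Z : MatCat k D r} (x : Str k (n + 1) X Z) :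
    strEntry d c n X Z (strFace k n i X Z x) =
      strFace k n i X.obj Z.obj (strEntry d c (n + 1) X Z x) := by
  induction n generalizing X i d with
  | zero =>
    induction x using str_cons_induction with
    | add x y hx hy => simp only [map_add, hx, hy]
    | cons Y f p =>
      rcases i with _ | i
      · simp only [strFace_zero_cons, strEntry_mul, strEntry_cons, map_sum]
      · simp [strFace]
  | succ n ih =>
    induction x using str_cons_induction with
    | add x y hx hy => simp only [map_add, hx, hy]
    | cons Y f p =>
      rcases i with _ | i
      · simp only [strFace_zero_cons, strEntry_mul, strEntry_cons, map_sum]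
      · simp only [strFace_succ_cons, strEntry_cons, map_sum, ih]

theorem strEntry_degen (d c : Fin r) (n i : ℕ) {X Z : MatCat k D r} (x : Str k n X Z) :
    strEntry d c (n + 1) X Z (strDegen k n i X Z x) =
      strDegen k n i X.obj Z.obj (strEntry d c n X Z x) := by
  induction n generalizing X i d with
  | zero =>
    rcases i with _ | i
    · induction x using str_zero_induction with
      | h f =>
        simp [strDegen_zero_zero, strEntry_cons, strEntry_zero, homEntry_id, apply_ite]
    · simp [strDegen]
  | succ n ih =>
    induction x using str_cons_induction with
    | add x y hx hy => simp only [map_add, hx, hy]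
    | cons Y f p =>
      rcases i with _ | i
      · simp only [strDegen_zero_cons, strEntry_cons, map_sum, homEntry_id]
        refine Finset.sum_congr rfl fun q _ => ?_
        rw [Finset.sum_eq_single q (fun q' _ hq => by simp [Ne.symm hq]) (by simp), if_pos rfl]
      · simp only [strDegen_succ_cons, strEntry_cons, map_sum, ih]

theorem strInc_zero (p : Fin r) {X Z : D} (f : Z ⟶ X) :
    strInc (k := k) p 0 X Z ((strZero k X Z).symm f) =
      (strZero k (⟨X⟩ : MatCat k D r) ⟨Z⟩).symm (incHom p Z X f) := by
  simp [strInc]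

theorem strInc_cons (p : Fin r) (n : ℕ) {X Y Z : D} (f : Y ⟶ X) (x : Str k n Y Z) :
    strInc p (n + 1) X Z (strCons k n X Y Z (f ⊗ₜ x)) =
      strCons k n (⟨X⟩ : MatCat k D r) ⟨Y⟩ ⟨Z⟩ (incHom p Y X f ⊗ₜ strInc p n Y Z x) := by
  simp [strInc]

theorem strInc_snoc (p : Fin r) (n : ℕ) {X Y Z : D} (x : Str k n X Y) (f : Z ⟶ Y) :
    strInc p (n + 1) X Z (strSnoc k n X Y Z x f) =
      strSnoc k n (⟨X⟩ : MatCat k D r) ⟨Y⟩ ⟨Z⟩ (strInc p n X Y x) (incHom p Z Y f) := by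
  induction n generalizing X with
  | zero =>
    induction x using str_zero_induction with
    | h g => simp only [strSnoc_zero, strInc_cons, strInc_zero]
  | succ n ih =>
    induction x using str_cons_induction with
    | add x y hx hy => simp only [map_add, LinearMap.add_apply, hx, hy]
    | cons W g x => simp only [strSnoc_cons, strInc_cons, ih]

theorem strInc_mul (p : Fin r) (n : ℕ) {X Y Z : D} (f : Y ⟶ X) (x : Str k n Y Z) :
    strInc p n X Z (strMul k n X Y Z f x) =
      strMul k n (⟨X⟩ : MatCat k D r) ⟨Y⟩ ⟨Z⟩ (incHom p Y X f) (strInc p n Y Z x) := by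
  cases n with
  | zero =>
    induction x using str_zero_induction with
    | h g => simp only [strMul_zero, strInc_zero, incHom_comp]
  | succ n =>
    induction x using str_cons_induction with
    | add x y hx hy => simp only [map_add, hx, hy]
    | cons W g x => simp only [strMul_cons, strInc_cons, incHom_comp]

theorem strInc_face (p : Fin r) (n i : ℕ) {X Z : D} (x : Str k (n + 1) X Z) :
    strInc p n X Z (strFace k n i X Z x) =
      strFace k n i (⟨X⟩ : MatCat k D r) ⟨Z⟩ (strInc p (n + 1) X Z x) := by
  induction n generalizing X i with
  | zero =>
    induction x using str_cons_induction with
    | add x y hx hy => simp only [map_add, hx, hy]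
    | cons Y f x =>
      rcases i with _ | i
      · simp only [strFace_zero_cons, strInc_mul, strInc_cons]
      · simp [strFace]
  | succ n ih =>
    induction x using str_cons_induction with
    | add x y hx hy => simp only [map_add, hx, hy]
    | cons Y f x =>
      rcases i with _ | i
      · simp only [strFace_zero_cons, strInc_mul, strInc_cons]
      · simp only [strFace_succ_cons, strInc_cons, ih]

/-- Only the entry `(p, p)` of a string in the image of the inclusion survives. -/
theorem strEntry_inc (p d c : Fin r) (n : ℕ) {X Z : D} (x : Str k n X Z) :
    strEntry d c n ⟨X⟩ ⟨Z⟩ (strInc p n X Z x) = if p = d ∧ p = c then x else 0 := by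
  induction n generalizing X d with
  | zero =>
    induction x using str_zero_induction with
    | h f => rw [strInc_zero, strEntry_zero, homEntry_incHom]; split_ifs <;> simp
  | succ n ih =>
    induction x using str_cons_induction with
    | add x y hx hy => rw [map_add, map_add, hx, hy]; split_ifs <;> simp
    | cons Y f x =>
      rw [strInc_cons, strEntry_cons]
      rw [Finset.sum_congr rfl fun q _ => by rw [homEntry_incHom, ih],
        Finset.sum_eq_single p (fun q _ hq => by simp [Ne.symm hq]) (by simp)]
      rcases eq_or_ne p d with rfl | hd
      · rcases eq_or_ne p c with rfl | hc
        · simp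
        · simp [hc]
      · simp [hd]

/-- Multiplying a string of matrices by rows and columns gives its entries, placed in the corner
`(p, p)`. -/
theorem strMul_strConj (p d c : Fin r) (n : ℕ) {X Z : MatCat k D r} (x : Str k n X Z) :
    strMul k n X X Z (matRow p X d) (strConj k (matCol p) (matRow p) c n X Z x) =
      strInc p n X.obj Z.obj (strEntry d c n X Z x) := by
  induction n generalizing X d with
  | zero =>
    induction x using str_zero_induction with
    | h f => rw [strConj_zero, strMul_zero, matCol_comp_matRow, strEntry_zero, strInc_zero]
  | succ n ih =>
    induction x using str_cons_induction with
    | add x y hx hy => simp only [map_add, hx, hy]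
    | cons Y f x =>
      simp only [strConj_cons, strEntry_cons, map_sum, strMul_cons, ih, matCol_comp_matRow,
        strInc_cons]

section Action

variable {H : Type v} [Ring H] [HopfAlgebra k H] [HCategory k H D]

theorem strEntry_act (d c : Fin r) (n : ℕ) {X Z : MatCat k D r} (h : H) (x : Str k n X Z) :
    strEntry d c n X Z (strAct k H n X Z h x) =
      strAct k H n X.obj Z.obj h (strEntry d c n X Z x) := by
  induction n generalizing X d h with
  | zero =>
    induction x using str_zero_induction with
    | h f => simp only [strAct_zero, strEntry_zero, homEntry_act]
  | succ n ih =>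
    induction x using str_cons_induction with
    | add x y hx hy => simp only [map_add, hx, hy]
    | cons Y f p =>
      simp only [strAct_cons, strEntry_cons, map_sum, homEntry_act, ih]
      exact Finset.sum_comm

theorem strInc_act (p : Fin r) (n : ℕ) {X Z : D} (h : H) (x : Str k n X Z) :
    strInc p n X Z (strAct k H n X Z h x) =
      strAct k H n (⟨X⟩ : MatCat k D r) ⟨Z⟩ h (strInc p n X Z x) := by
  induction n generalizing X h with
  | zero =>
    induction x using str_zero_induction with
    | h f => simp only [strAct_zero, strInc_zero, incHom_act]
  | succ n ih =>
    induction x using str_cons_induction with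
    | add x y hx hy => simp only [map_add, hx, hy]
    | cons Y f x => simp only [strAct_cons, strInc_cons, map_sum, incHom_act, ih]

end Action

end MatrixStrings

section MatrixNerve

variable (k : Type u) [Field k] (D : Type u) [SmallCategory D] [Preadditive D] [Linear k D]
  {r : ℕ}

/-- The inclusion on the additive cyclic nerve. -/
def cnInc (p : Fin r) (n : ℕ) : CN k D n →ₗ[k] CN k (MatCat k D r) n :=
  cnLift k fun X => cnOf k n (⟨X⟩ : MatCat k D r) ∘ₗ strInc p n X X

theorem cnInc_of (p : Fin r) (n : ℕ) {X : D} (x : Str k n X X) :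
    cnInc k D p n (cnOf k n X x) = cnOf k n (⟨X⟩ : MatCat k D r) (strInc p n X X x) := by
  simp [cnInc]

/-- The trace on the additive cyclic nerve. -/
def cnTr (r n : ℕ) : CN k (MatCat k D r) n →ₗ[k] CN k D n :=
  cnLift k fun X : MatCat k D r => cnOf k n X.obj ∘ₗ
    (TensorProduct.rid k (Str k n X.obj X.obj)).toLinearMap ∘ₗ
      (Matrix.traceLinearMap (Fin r) k k).lTensor (Str k n X.obj X.obj) ∘ₗ strMat n X X

theorem cnTr_of (n : ℕ) {X : MatCat k D r} (x : Str k n X X) :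
    cnTr k D r n (cnOf k n X x) = cnOf k n X.obj (∑ d, strEntry d d n X X x) := by
  simp only [cnTr, cnLift_of, LinearMap.comp_apply, strEntry]
  congr 1
  generalize strMat n X X x = t
  induction t with
  | zero => simp
  | tmul x B => simp [Matrix.trace, Finset.sum_smul]
  | add a b ha hb => simp only [map_add, ha, hb, Finset.sum_add_distrib]

theorem cnTr_inc (p : Fin r) (n : ℕ) : cnTr k D r n ∘ₗ cnInc k D p n = LinearMap.id :=
  cn_hom_ext fun X x => by
    rw [LinearMap.comp_apply, cnInc_of, cnTr_of,
      Finset.sum_congr rfl fun d _ => strEntry_inc p d d n x]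
    simp

/-- The map appearing in the homotopy attached to rows and columns is `inc ∘ tr`. -/
theorem cnConj_matCol_matRow (p : Fin r) (n : ℕ) :
    cnConj k (matCol p) (matRow p) n = cnInc k D p n ∘ₗ cnTr k D r n :=
  cn_hom_ext fun X x => by
    simp only [cnConj_of, strMul_strConj, LinearMap.comp_apply, cnTr_of, cnInc_of, map_sum]

variable {k D} {H : Type v} [Ring H] [HopfAlgebra k H] [HCategory k H D]

theorem cnInc_act (p : Fin r) (n : ℕ) (h : H) (x : CN k D n) :
    cnInc k D p n (cnAct k H n h x) = cnAct k H n h (cnInc k D p n x) := by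
  induction x using cn_induction with
  | zero => simp
  | add x y hx hy => simp only [map_add, hx, hy]
  | of X x => simp only [cnAct_of, cnInc_of, strInc_act]

theorem cnInc_face (p : Fin r) (n i : ℕ) (x : CN k D (n + 1)) :
    cnInc k D p n (cnFace k n i x) = cnFace k n i (cnInc k D p (n + 1) x) := by
  induction x using cn_induction with
  | zero => simp
  | add x y hx hy => simp only [map_add, hx, hy]
  | of X x => simp only [cnFace_of, cnInc_of, strInc_face]

theorem cnInc_rot (p : Fin r) (n : ℕ) (h : H) (x : CN k D n) :
    cnInc k D p n (cnRot k H n h x) = cnRot k H n h (cnInc k D p n x) := by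
  cases n with
  | zero => exact cnInc_act p 0 h x
  | succ n =>
    induction x using cn_snoc_induction with
    | zero => simp
    | add x y hx hy => simp only [map_add, hx, hy]
    | snoc X Y x f =>
      rw [cnRot_snoc, cnInc_of, cnInc_of, strInc_cons, strInc_snoc, cnRot_snoc, incHom_act]

theorem cnTr_act (n : ℕ) (h : H) (x : CN k (MatCat k D r) n) :
    cnTr k D r n (cnAct k H n h x) = cnAct k H n h (cnTr k D r n x) := by
  induction x using cn_induction with
  | zero => simp
  | add x y hx hy => simp only [map_add, hx, hy]
  | of X x => simp only [cnAct_of, cnTr_of, strEntry_act, map_sum]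

theorem cnTr_face (n i : ℕ) (x : CN k (MatCat k D r) (n + 1)) :
    cnTr k D r n (cnFace k n i x) = cnFace k n i (cnTr k D r (n + 1) x) := by
  induction x using cn_induction with
  | zero => simp
  | add x y hx hy => simp only [map_add, hx, hy]
  | of X x => simp only [cnFace_of, cnTr_of, strEntry_face, map_sum]

theorem cnTr_degen (n i : ℕ) (x : CN k (MatCat k D r) n) :
    cnTr k D r (n + 1) (cnDegen k n i x) = cnDegen k n i (cnTr k D r n x) := by
  induction x using cn_induction with
  | zero => simp
  | add x y hx hy => simp only [map_add, hx, hy]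
  | of X x => simp only [cnDegen_of, cnTr_of, strEntry_degen, map_sum]

/-- The trace commutes with the rotation, since `trace (B⁰ ⋯ Bⁿ) = trace (Bⁿ B⁰ ⋯ Bⁿ⁻¹)`. -/
theorem cnTr_rot (n : ℕ) (h : H) (x : CN k (MatCat k D r) n) :
    cnTr k D r n (cnRot k H n h x) = cnRot k H n h (cnTr k D r n x) := by
  cases n with
  | zero => exact cnTr_act 0 h x
  | succ n =>
    induction x using cn_snoc_induction with
    | zero => simp
    | add x y hx hy => simp only [map_add, hx, hy]
    | snoc X Y x f =>
      simp only [cnRot_snoc, cnTr_of, strEntry_cons, strEntry_snoc, map_sum, homEntry_act]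
      exact Finset.sum_comm

end MatrixNerve

/-! ### Maps of nerves, and the maps on cochains -/

section NerveMaps

variable {k : Type u} [Field k] {D D' : Type u} [SmallCategory D] [Preadditive D] [Linear k D]
  [SmallCategory D'] [Preadditive D'] [Linear k D']
  (H : Type v) [Ring H] [HopfAlgebra k H] [HCategory k H D] [HCategory k H D']

/-- `g` is a map of additive cyclic nerves compatible with the action of `H`, with the faces that
compose two arrows, and with the twisted rotations. (The maps `cnFace k n i` with `i > n` vanish, so
the condition on the faces is only about `i ≤ n`.) -/
structure IsNerveMap (g : ∀ n, CN k D' n →ₗ[k] CN k D n) : Prop where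
  act : ∀ n (h : H) x, g n (cnAct k H n h x) = cnAct k H n h (g n x)
  face : ∀ n i x, g n (cnFace k n i x) = cnFace k n i (g (n + 1) x)
  rot : ∀ n (h : H) x, g n (cnRot k H n h x) = cnRot k H n h (g n x)

variable {H} {M : Type w} [AddCommGroup M] [Module k M] [SAYDModule k H M]
  {g : ∀ n, CN k D' n →ₗ[k] CN k D n}

theorem IsNerveMap.mem (hg : IsNerveMap H g) {n : ℕ} {φ : Cochain k D M n}
    (hφ : φ ∈ HCochain k H D M n) : ((g n).lTensor M).dualMap φ ∈ HCochain k H D' M n :=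
  lTensor_mem_HCochain (g n) (hg.act n) hφ

variable [BijectiveAntipode k H]

theorem IsNerveMap.coface (hg : IsNerveMap H g) (n : ℕ) (i : Fin (n + 2)) (φ : Cochain k D M n) :
    ((g (n + 1)).lTensor M).dualMap (coface k H D M n i φ) =
      coface k H D' M n i (((g n).lTensor M).dualMap φ) := by
  have h : chainFace k H D M n i ∘ₗ (g (n + 1)).lTensor M =
      (g n).lTensor M ∘ₗ chainFace k H D' M n i := by
    by_cases hi : (i : ℕ) ≤ n
    · rw [chainFace_of_le k D M n i hi, chainFace_of_le k D' M n i hi, ← LinearMap.lTensor_comp,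
        ← LinearMap.lTensor_comp]
      congr 1
      exact LinearMap.ext fun x => (hg.face n i x).symm
    · rw [chainFace_of_lt k D M n i (by omega), chainFace_of_lt k D' M n i (by omega),
        twist_comp_lTensor, lTensor_comp_twist]
      congr 1
      ext1 h
      refine LinearMap.ext fun x => ?_
      simp [cnLast, hg.face, hg.rot]
  exact LinearMap.ext fun x => congrArg φ (LinearMap.congr_fun h x)

theorem IsNerveMap.cocyc (hg : IsNerveMap H g) (n : ℕ) (φ : Cochain k D M n) :
    ((g n).lTensor M).dualMap (cocyc k H D M n φ) =
      cocyc k H D' M n (((g n).lTensor M).dualMap φ) := by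
  have h : chainT k H D M n ∘ₗ (g n).lTensor M = (g n).lTensor M ∘ₗ chainT k H D' M n := by
    rw [chainT_eq_twist, chainT_eq_twist, twist_comp_lTensor, lTensor_comp_twist]
    congr 1
    ext1 h
    exact LinearMap.ext fun x => (hg.rot n h x).symm
  exact LinearMap.ext fun x => congrArg φ (LinearMap.congr_fun h x)

theorem IsNerveMap.hochB (hg : IsNerveMap H g) (n : ℕ) (φ : Cochain k D M n) :
    ((g (n + 1)).lTensor M).dualMap (hochB k H D M n φ) =
      hochB k H D' M n (((g n).lTensor M).dualMap φ) := by
  simp only [HopfCyclic.hochB, LinearMap.sum_apply, LinearMap.smul_apply, map_sum, map_smul,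
    hg.coface]

theorem IsNerveMap.hochB' (hg : IsNerveMap H g) (n : ℕ) (φ : Cochain k D M n) :
    ((g (n + 1)).lTensor M).dualMap (hochB' k H D M n φ) =
      hochB' k H D' M n (((g n).lTensor M).dualMap φ) := by
  simp only [HopfCyclic.hochB', LinearMap.sum_apply, LinearMap.smul_apply, map_sum, map_smul,
    hg.coface]

theorem IsNerveMap.lam (hg : IsNerveMap H g) (n : ℕ) (φ : Cochain k D M n) :
    ((g n).lTensor M).dualMap (lam k H D M n φ) =
      lam k H D' M n (((g n).lTensor M).dualMap φ) := by
  simp only [HopfCyclic.lam, LinearMap.smul_apply, map_smul, hg.cocyc]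

theorem IsNerveMap.normN (hg : IsNerveMap H g) (n : ℕ) (φ : Cochain k D M n) :
    ((g n).lTensor M).dualMap (normN k H D M n φ) =
      normN k H D' M n (((g n).lTensor M).dualMap φ) := by
  have hpow : ∀ j, ((g n).lTensor M).dualMap ((HopfCyclic.lam k H D M n ^ j) φ) =
      (HopfCyclic.lam k H D' M n ^ j) (((g n).lTensor M).dualMap φ) := by
    intro j
    induction j with
    | zero => rfl
    | succ j ih => rw [pow_succ', Module.End.mul_apply, hg.lam, ih, pow_succ', Module.End.mul_apply]
  simp only [HopfCyclic.normN, LinearMap.sum_apply, map_sum, hpow]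

variable (M)

theorem IsNerveMap.isComplexMap (hg : IsNerveMap H g) :
    IsComplexMap (HCochain k H D M) (HopfCyclic.hochB k H D M) (HCochain k H D' M)
      (HopfCyclic.hochB k H D' M) (fun n => ((g n).lTensor M).dualMap) where
  mem _ _ hφ := hg.mem hφ
  comm n φ _ := hg.hochB n φ

theorem IsNerveMap.isDoubleComplexMap (hg : IsNerveMap H g) :
    IsDoubleComplexMap (cyS k H D M) (cyV k H D M) (cyH k H D M) (cyS k H D' M) (cyV k H D' M)
      (cyH k H D' M) (fun _ q => ((g q).lTensor M).dualMap) where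
  mem _ _ _ hφ := hg.mem hφ
  comm_v p q φ _ := by
    unfold cyV
    split_ifs
    · exact hg.hochB q φ
    · rw [LinearMap.neg_apply, LinearMap.neg_apply, map_neg, hg.hochB']
  comm_h p q φ _ := by
    unfold cyH
    split_ifs
    · rw [LinearMap.sub_apply, LinearMap.sub_apply, map_sub, hg.lam, Module.End.one_apply,
        Module.End.one_apply]
    · exact hg.normN q φ

end NerveMaps

section MatrixCochains

variable (k : Type u) [Field k] {H : Type v} [Ring H] [HopfAlgebra k H] (D : Type u)
  [SmallCategory D] [Preadditive D] [Linear k D] [HCategory k H D] {r : ℕ}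

theorem isNerveMap_inc (p : Fin r) : IsNerveMap H (cnInc k D p) where
  act := cnInc_act p
  face := cnInc_face p
  rot := cnInc_rot p

theorem isNerveMap_tr (r : ℕ) : IsNerveMap H (cnTr k D r) where
  act := cnTr_act
  face := cnTr_face
  rot := cnTr_rot

variable {k D} {M : Type w} [AddCommGroup M] [Module k M]

theorem cochainInc_tr (p : Fin r) (n : ℕ) (φ : Cochain k D M n) :
    cochainInc k D M p n (cochainTr k D M r n φ) = φ := by
  have h : (cnTr k D r n).lTensor M ∘ₗ (cnInc k D p n).lTensor M = LinearMap.id := by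
    rw [← LinearMap.lTensor_comp, cnTr_inc, LinearMap.lTensor_id]
  exact LinearMap.ext fun x => congrArg φ (LinearMap.congr_fun h x)

theorem comp_cnConj_eq (p : Fin r) (n : ℕ) (φ : Cochain k (MatCat k D r) M n) :
    φ ∘ₗ (cnConj k (matCol p) (matRow p) n).lTensor M =
      cochainTr k D M r n (cochainInc k D M p n φ) := by
  rw [cnConj_matCol_matRow, LinearMap.lTensor_comp]
  rfl

variable [BijectiveAntipode k H] [SAYDModule k H M]

theorem isCocyclicMap_tr : IsCocyclicMap k H D M (MatCat k D r) (cochainTr k D M r) where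
  mem _ _ hφ := (isNerveMap_tr k D r).mem hφ
  comm_coface n i φ _ := (isNerveMap_tr k D r).coface n i φ
  comm_codegen n i φ _ := by
    have h : chainDegen k D M n i ∘ₗ (cnTr k D r n).lTensor M =
        (cnTr k D r (n + 1)).lTensor M ∘ₗ chainDegen k (MatCat k D r) M n i := by
      rw [chainDegen_eq, chainDegen_eq, ← LinearMap.lTensor_comp, ← LinearMap.lTensor_comp]
      congr 1
      exact LinearMap.ext fun x => (cnTr_degen n i x).symm
    exact LinearMap.ext fun x => congrArg φ (LinearMap.congr_fun h x)
  comm_cocyc n φ _ := (isNerveMap_tr k D r).cocyc n φ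

/-- On Hochschild cocycles, `tr ∘ inc` is homotopic to the identity. -/
theorem sub_tr_inc_mem_coboundaries (p : Fin r) (n : ℕ) {φ : Cochain k (MatCat k D r) M n}
    (hφ : φ ∈ cocycles (HCochain k H (MatCat k D r) M) (hochB k H (MatCat k D r) M) n) :
    φ - cochainTr k D M r n (cochainInc k D M p n φ) ∈
      coboundaries (HCochain k H (MatCat k D r) M) (hochB k H (MatCat k D r) M) n := by
  obtain ⟨hφ, hφ'⟩ := hφ
  rw [SetLike.mem_coe, LinearMap.mem_ker] at hφ'
  rw [← comp_cnConj_eq]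
  cases n with
  | zero =>
    have := hochB_homotopy_zero (H := H) k (sum_matRow_comp_matCol p) (act_matRow p) φ
    rw [hφ', LinearMap.zero_comp] at this
    rw [← this]
    exact Submodule.zero_mem _
  | succ n =>
    have := hochB_homotopy (H := H) k (sum_matRow_comp_matCol p) (act_matRow p) n φ
    rw [hφ', LinearMap.zero_comp, zero_add] at this
    rw [← this]
    exact Submodule.mem_map_of_mem (lTensor_mem_HCochain _
      (cnHomotopy_act k (act_matCol p) (act_matRow p) n) hφ)

variable (k H D M) in
/-- The columns of odd index of the cyclic double complex are acyclic. -/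
theorem cocycles_hochB'_le (n : ℕ) :
    cocycles (HCochain k H D M) (hochB' k H D M) n ≤
      coboundaries (HCochain k H D M) (hochB' k H D M) n := by
  rintro φ ⟨hφ, hφ'⟩
  rw [SetLike.mem_coe, LinearMap.mem_ker] at hφ'
  cases n with
  | zero =>
    have := hochB'_extraDegen_zero (H := H) k φ
    rw [hφ', LinearMap.zero_comp] at this
    rw [← this]
    exact Submodule.zero_mem _
  | succ n =>
    have := hochB'_extraDegen (H := H) k n φ
    rw [hφ', LinearMap.zero_comp, zero_add] at this
    rw [← this]
    exact Submodule.mem_map_of_mem (lTensor_mem_HCochain _ (cnExtraDegen_act k n) hφ)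

/-- In the columns of the cyclic double complex of `D ⊗ M_r(k)`, cocycles that vanish on the image
of the inclusion are coboundaries. -/
theorem mem_coboundaries_column (p₀ : Fin r) (p q : ℕ) {φ : Cochain k (MatCat k D r) M q}
    (hφ : φ ∈ cocycles (cyS k H (MatCat k D r) M p) (cyV k H (MatCat k D r) M p) q)
    (hinc : cochainInc k D M p₀ q φ = 0) :
    φ ∈ coboundaries (cyS k H (MatCat k D r) M p) (cyV k H (MatCat k D r) M p) q := by
  by_cases hp : Even p
  · have hv : cyV k H (MatCat k D r) M p = hochB k H (MatCat k D r) M :=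
      funext fun q => if_pos hp
    rw [hv] at hφ ⊢
    have := sub_tr_inc_mem_coboundaries p₀ q hφ
    rwa [hinc, map_zero, sub_zero] at this
  · have hv : cyV k H (MatCat k D r) M p = fun q => -hochB' k H (MatCat k D r) M q :=
      funext fun q => if_neg hp
    rw [hv] at hφ ⊢
    have h : φ ∈ cocycles (HCochain k H (MatCat k D r) M) (hochB' k H (MatCat k D r) M) q := by
      refine ⟨hφ.1, ?_⟩
      have := hφ.2
      rw [SetLike.mem_coe, LinearMap.mem_ker, LinearMap.neg_apply, neg_eq_zero] at this
      exact this
    have := cocycles_hochB'_le k H (MatCat k D r) M q h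
    cases q with
    | zero => exact this
    | succ q =>
      obtain ⟨ψ, hψ, rfl⟩ := this
      exact ⟨-ψ, neg_mem hψ, by rw [LinearMap.neg_apply, map_neg, neg_neg]⟩

end MatrixCochains

/-! ### Total complexes -/

section AbstractComplexes

variable {k : Type u} [Field k]

/-- If `g ∘ f` is the identity on cocycles up to coboundaries, then `f` and `g` induce maps on
cohomology with composite the identity. -/
theorem cohomologyMap_comp_eq_id {C C' : ℕ → Type w} [∀ n, AddCommGroup (C n)]
    [∀ n, Module k (C n)] [∀ n, AddCommGroup (C' n)] [∀ n, Module k (C' n)]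
    {S : ∀ n, Submodule k (C n)} {d : ∀ n, C n →ₗ[k] C (n + 1)}
    {S' : ∀ n, Submodule k (C' n)} {d' : ∀ n, C' n →ₗ[k] C' (n + 1)}
    {f : ∀ n, C n →ₗ[k] C' n} {g : ∀ n, C' n →ₗ[k] C n}
    (hf : IsComplexMap S d S' d' f) (hg : IsComplexMap S' d' S d g) (n : ℕ)
    (h : ∀ x ∈ cocycles S d n, x - g n (f n x) ∈ coboundaries S d n) :
    hg.cohomologyMap n ∘ₗ hf.cohomologyMap n = LinearMap.id := by
  refine Submodule.linearMap_qext _ (LinearMap.ext fun x => ?_)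
  exact ((Submodule.Quotient.eq ((coboundaries S d n).submoduleOf (cocycles S d n))
    (x := x)).2 (h x x.2)).symm

variable {C C' : ℕ → ℕ → Type w} [∀ p q, AddCommGroup (C p q)] [∀ p q, Module k (C p q)]
  [∀ p q, AddCommGroup (C' p q)] [∀ p q, Module k (C' p q)]
  {S : ∀ p q, Submodule k (C p q)} {v : ∀ p q, C p q →ₗ[k] C p (q + 1)}
  {h : ∀ p q, C p q →ₗ[k] C (p + 1) q}

theorem IsDoubleComplex.totD_mem (hS : IsDoubleComplex S v h) {n : ℕ} {x : ∀ p q, C p q}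
    (hx : x ∈ totSub S n) : totD v h n x ∈ totSub S (n + 1) := by
  obtain ⟨hx, hx'⟩ := hx
  refine ⟨fun p q => Submodule.add_mem _ ?_ ?_, fun p q hpq => ?_⟩
  · cases q with
    | zero => exact Submodule.zero_mem _
    | succ q => exact hS.v_mem p q _ (hx p q)
  · cases p with
    | zero => exact Submodule.zero_mem _
    | succ p => exact hS.h_mem p q _ (hx p q)
  · rcases p with _ | p <;> rcases q with _ | q
    · simp [totD, totV, totH]
    · simp [totD, totV, totH, hx' 0 q (by omega)]
    · simp [totD, totV, totH, hx' p 0 (by omega)]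
    · simp [totD, totV, totH, hx' (p + 1) q (by omega), hx' p (q + 1) (by omega)]

theorem IsDoubleComplex.totD_totD (hS : IsDoubleComplex S v h) (n m : ℕ) {x : ∀ p q, C p q}
    (hx : ∀ p q, x p q ∈ S p q) : totD v h m (totD v h n x) = 0 := by
  funext p q
  rcases p with _ | _ | p <;> rcases q with _ | _ | q <;>
    simp [totD, totV, totH, hS.v_v _ _ _ (hx _ _), hS.h_h _ _ _ (hx _ _),
      hS.v_h _ _ _ (hx _ _)]

/-- If the columns are acyclic, a cocycle of the total complex that vanishes in the columns of index
less than `j` can be modified by a coboundary to vanish in column `j` as well. -/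
theorem exists_sub_totD_eq_zero
    (hv : ∀ p q, cocycles (S p) (v p) q ≤ coboundaries (S p) (v p) q) {m j : ℕ}
    {w : ∀ p q, C p q} (hw : w ∈ totSub S (m + 1)) (hd : totD v h (m + 1) w = 0)
    (hj : ∀ p < j, ∀ q, w p q = 0) :
    ∃ y ∈ totSub S m, ∀ p < j + 1, ∀ q, (w - totD v h m y) p q = 0 := by
  obtain ⟨hw, hw'⟩ := hw
  have hcoc : ∀ q, w j q ∈ cocycles (S j) (v j) q := by
    refine fun q => ⟨hw j q, ?_⟩
    have h₀ := congrFun (congrFun hd j) (q + 1)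
    cases j with
    | zero => simpa [totD, totV, totH] using h₀
    | succ j => simpa [totD, totV, totH, hj j (by omega)] using h₀
  rcases Nat.lt_or_ge m j with hmj | hmj
  · refine ⟨0, Submodule.zero_mem _, fun p hp q => ?_⟩
    rw [map_zero, sub_zero]
    rcases Nat.lt_succ_iff_lt_or_eq.1 hp with hp | rfl
    · exact hj p hp q
    · cases q with
      | zero => exact (Submodule.mem_bot k).1 (hv p 0 (hcoc 0))
      | succ q => exact hw' p (q + 1) (by omega)
  · obtain ⟨q, rfl⟩ := Nat.exists_eq_add_of_le hmj
    obtain ⟨y, hy, hyw⟩ := hv j (q + 1) (hcoc (q + 1))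
    refine ⟨Pi.single j (Pi.single q y), ⟨fun p' q' => ?_, fun p' q' hpq => ?_⟩,
      fun p hp q' => ?_⟩
    · rcases eq_or_ne p' j with rfl | hp
      · rcases eq_or_ne q' q with rfl | hq
        · simpa using hy
        · simp [hq]
      · simp [hp]
    · rcases eq_or_ne p' j with rfl | hp
      · have hq : q' ≠ q := by omega
        simp [hq]
      · simp [hp]
    · have hH : totH h (Pi.single j (Pi.single q y)) p q' = 0 := by
        cases p with
        | zero => rfl
        | succ p =>
          have hpj : p ≠ j := by omega
          simp [totH, hpj]
      rcases Nat.lt_succ_iff_lt_or_eq.1 hp with hp | rfl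
      · have hV : totV v (Pi.single j (Pi.single q y)) p q' = 0 := by
          cases q' with
          | zero => rfl
          | succ q' => simp [totV, hp.ne]
        simp [totD, hH, hV, hj p hp]
      · cases q' with
        | zero => simp [totD, hH, totV, hw' p 0 (by omega)]
        | succ q' =>
          rcases eq_or_ne q' q with rfl | hq
          · simp [totD, hH, totV, hyw]
          · simp [totD, hH, totV, hq, hw' p (q' + 1) (by omega)]

/-- A first quadrant double complex with acyclic columns has an acyclic total complex. -/
theorem IsDoubleComplex.cocycles_totSub_le (hS : IsDoubleComplex S v h)
    (hv : ∀ p q, cocycles (S p) (v p) q ≤ coboundaries (S p) (v p) q) (n : ℕ) :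
    cocycles (totSub S) (totD v h) n ≤ coboundaries (totSub S) (totD v h) n := by
  rintro z ⟨hz, hz'⟩
  rw [SetLike.mem_coe, LinearMap.mem_ker] at hz'
  cases n with
  | zero =>
    rw [coboundaries, Submodule.mem_bot]
    funext p q
    by_cases hpq : p + q = 0
    · obtain ⟨rfl, rfl⟩ : p = 0 ∧ q = 0 := by omega
      refine (Submodule.mem_bot k).1 (hv 0 0 ⟨hz.1 0 0, ?_⟩)
      simpa [totD, totV, totH] using congrFun (congrFun hz' 0) 1
    · exact hz.2 p q hpq
  | succ m =>
    have key : ∀ j, ∃ y ∈ totSub S m, ∀ p < j, ∀ q, (z - totD v h m y) p q = 0 := by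
      intro j
      induction j with
      | zero => exact ⟨0, Submodule.zero_mem _, fun p hp => absurd hp (Nat.not_lt_zero p)⟩
      | succ j ih =>
        obtain ⟨y, hy, hyz⟩ := ih
        obtain ⟨y', hy', hyz'⟩ := exists_sub_totD_eq_zero hv
          (Submodule.sub_mem _ hz (hS.totD_mem hy))
          (by rw [map_sub, hz', hS.totD_totD _ _ hy.1, sub_zero]) hyz
        refine ⟨y + y', Submodule.add_mem _ hy hy', ?_⟩
        rwa [map_add, ← sub_sub]
    obtain ⟨y, hy, hyz⟩ := key (m + 2)
    refine ⟨y, hy, (sub_eq_zero.1 ?_).symm⟩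
    funext p q
    rcases Nat.lt_or_ge p (m + 2) with hp | hp
    · exact hyz p hp q
    · exact (Submodule.sub_mem _ hz (hS.totD_mem hy)).2 p q (by omega)

variable {S' : ∀ p q, Submodule k (C' p q)} {v' : ∀ p q, C' p q →ₗ[k] C' p (q + 1)}
  {h' : ∀ p q, C' p q →ₗ[k] C' (p + 1) q} {f : ∀ p q, C p q →ₗ[k] C' p q}
  {g : ∀ p q, C' p q →ₗ[k] C p q}

/-- The kernel of a morphism of double complexes. -/
theorem IsDoubleComplexMap.isDoubleComplex_ker (hf : IsDoubleComplexMap S v h S' v' h' f)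
    (hS : IsDoubleComplex S v h) :
    IsDoubleComplex (fun p q => S p q ⊓ LinearMap.ker (f p q)) v h where
  v_mem p q x hx := ⟨hS.v_mem p q x hx.1, by
    rw [SetLike.mem_coe, LinearMap.mem_ker, hf.comm_v p q x hx.1, LinearMap.mem_ker.1 hx.2,
      map_zero]⟩
  h_mem p q x hx := ⟨hS.h_mem p q x hx.1, by
    rw [SetLike.mem_coe, LinearMap.mem_ker, hf.comm_h p q x hx.1, LinearMap.mem_ker.1 hx.2,
      map_zero]⟩
  v_v p q x hx := hS.v_v p q x hx.1
  h_h p q x hx := hS.h_h p q x hx.1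
  v_h p q x hx := hS.v_h p q x hx.1

/-- Let `f` be a morphism of double complexes with a section `g`. If in each column the cocycles in
the kernel of `f` are coboundaries, then `g ∘ f` is the identity up to coboundaries on the cocycles
of the total complex. -/
theorem IsDoubleComplexMap.sub_mem_coboundaries (hf : IsDoubleComplexMap S v h S' v' h' f)
    (hg : IsDoubleComplexMap S' v' h' S v h g) (hS : IsDoubleComplex S v h)
    (hfg : ∀ p q, ∀ x ∈ S' p q, f p q (g p q x) = x)
    (hv : ∀ p q, ∀ x ∈ cocycles (S p) (v p) q, f p q x = 0 → x ∈ coboundaries (S p) (v p) q)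
    (n : ℕ) {z : ∀ p q, C p q} (hz : z ∈ cocycles (totSub S) (totD v h) n) :
    z - totMap g n (totMap f n z) ∈ coboundaries (totSub S) (totD v h) n := by
  have hK := hf.isDoubleComplex_ker hS
  have hfs : ∀ p q, ∀ x ∈ S p q, f p q (x - g p q (f p q x)) = 0 := fun p q x hx => by
    rw [map_sub, hfg p q _ (hf.mem p q x hx), sub_self]
  -- `1 - g f` projects onto the kernel, so the columns of the kernel are acyclic
  have hcol : ∀ p q, cocycles (fun q => S p q ⊓ LinearMap.ker (f p q)) (v p) q ≤
      coboundaries (fun q => S p q ⊓ LinearMap.ker (f p q)) (v p) q := by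
    rintro p q x ⟨⟨hx, hfx⟩, hvx⟩
    have hb := hv p q x ⟨hx, hvx⟩ hfx
    cases q with
    | zero => exact hb
    | succ q =>
      obtain ⟨y, hy, rfl⟩ := hb
      refine ⟨y - g p q (f p q y),
        ⟨Submodule.sub_mem _ hy (hg.mem p q _ (hf.mem p q y hy)), hfs p q y hy⟩, ?_⟩
      rw [map_sub, ← hg.comm_v p q _ (hf.mem p q y hy), ← hf.comm_v p q y hy,
        LinearMap.mem_ker.1 hfx, map_zero, sub_zero]
  have hgf := hg.isComplexMap.mem_cocycles n _ (hf.isComplexMap.mem_cocycles n z hz)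
  have hw := Submodule.sub_mem _ hz hgf
  have hwK := hK.cocycles_totSub_le hcol n (x := z - totMap g n (totMap f n z))
    ⟨⟨fun p q => ⟨hw.1.1 p q, hfs p q _ (hz.1.1 p q)⟩, hw.1.2⟩, hw.2⟩
  cases n with
  | zero => exact hwK
  | succ n =>
    obtain ⟨y, hy, hyw⟩ := hwK
    exact ⟨y, ⟨fun p q => (hy.1 p q).1, hy.2⟩, hyw⟩

end AbstractComplexes

end HopfCyclic

open HopfCyclic in
theorem mainTheorem7 {k : Type u} [Field k] [CharZero k]
    {H : Type v} [Ring H] [HopfAlgebra k H] [BijectiveAntipode k H]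
    (D : Type u) [SmallCategory D] [Preadditive D] [Linear k D] [HCategory k H D]
    (M : Type w) [AddCommGroup M] [Module k M] [SAYDModule k H M]
    (r : ℕ) (hr : 0 < r) :
    -- the structure maps restrict to `H`-linear cochains
    StructureMapsRestrict k H D M ∧ StructureMapsRestrict k H (MatCat k D r) M ∧
    -- the Hochschild complexes and the cyclic double complexes are (double) complexes
    IsComplex (HCochain k H D M) (hochB k H D M) ∧
    IsComplex (HCochain k H (MatCat k D r) M) (hochB k H (MatCat k D r) M) ∧
    IsDoubleComplex (cyS k H D M) (cyV k H D M) (cyH k H D M) ∧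
    IsDoubleComplex (cyS k H (MatCat k D r) M) (cyV k H (MatCat k D r) M)
      (cyH k H (MatCat k D r) M) ∧
    -- the trace induces a morphism of cocyclic modules
    IsCocyclicMap k H D M (MatCat k D r) (cochainTr k D M r) ∧
    -- the inclusion and the trace induce morphisms of Hochschild complexes and of cyclic
    -- double complexes
    ∃ (incHoch : IsComplexMap (HCochain k H (MatCat k D r) M) (hochB k H (MatCat k D r) M)
          (HCochain k H D M) (hochB k H D M) (cochainInc k D M ⟨0, hr⟩))
      (trHoch : IsComplexMap (HCochain k H D M) (hochB k H D M)
          (HCochain k H (MatCat k D r) M) (hochB k H (MatCat k D r) M) (cochainTr k D M r))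
      (incCy : IsDoubleComplexMap (cyS k H (MatCat k D r) M) (cyV k H (MatCat k D r) M)
          (cyH k H (MatCat k D r) M) (cyS k H D M) (cyV k H D M) (cyH k H D M)
          (fun _ q => cochainInc k D M ⟨0, hr⟩ q))
      (trCy : IsDoubleComplexMap (cyS k H D M) (cyV k H D M) (cyH k H D M)
          (cyS k H (MatCat k D r) M) (cyV k H (MatCat k D r) M) (cyH k H (MatCat k D r) M)
          (fun _ q => cochainTr k D M r q)),
      -- the induced maps on Hochschild cohomology are mutually inverse
      (∀ n : ℕ,
        (incHoch.cohomologyMap n ∘ₗ trHoch.cohomologyMap n :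
          HH k H D M n →ₗ[k] HH k H D M n) = LinearMap.id ∧
        (trHoch.cohomologyMap n ∘ₗ incHoch.cohomologyMap n :
          HH k H (MatCat k D r) M n →ₗ[k] HH k H (MatCat k D r) M n) = LinearMap.id) ∧
      -- the induced maps on Hopf-cyclic cohomology are mutually inverse
      (∀ n : ℕ,
        (incCy.isComplexMap.cohomologyMap n ∘ₗ trCy.isComplexMap.cohomologyMap n :
          HC k H D M n →ₗ[k] HC k H D M n) = LinearMap.id ∧
        (trCy.isComplexMap.cohomologyMap n ∘ₗ incCy.isComplexMap.cohomologyMap n :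
          HC k H (MatCat k D r) M n →ₗ[k] HC k H (MatCat k D r) M n) = LinearMap.id) := by
  have hinc := isNerveMap_inc k D (H := H) ⟨0, hr⟩
  have htr := isNerveMap_tr k D (H := H) r
  refine ⟨structureMapsRestrict, structureMapsRestrict,
    isComplex_hoch k D M, isComplex_hoch k (MatCat k D r) M, isDoubleComplex_cyclic k D M,
    isDoubleComplex_cyclic k (MatCat k D r) M, isCocyclicMap_tr, hinc.isComplexMap M,
    htr.isComplexMap M, hinc.isDoubleComplexMap M, htr.isDoubleComplexMap M, fun n => ⟨?_, ?_⟩,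
    fun n => ⟨?_, ?_⟩⟩
  · refine cohomologyMap_comp_eq_id (htr.isComplexMap M) (hinc.isComplexMap M) n fun φ _ => ?_
    change φ - cochainInc k D M ⟨0, hr⟩ n (cochainTr k D M r n φ) ∈ _
    rw [cochainInc_tr, sub_self]
    exact Submodule.zero_mem _
  · exact cohomologyMap_comp_eq_id (hinc.isComplexMap M) (htr.isComplexMap M) n fun φ hφ =>
      sub_tr_inc_mem_coboundaries ⟨0, hr⟩ n hφ
  · refine cohomologyMap_comp_eq_id (htr.isDoubleComplexMap M).isComplexMap
      (hinc.isDoubleComplexMap M).isComplexMap n fun x _ => ?_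
    change x - (fun p q => cochainInc k D M ⟨0, hr⟩ q (cochainTr k D M r q (x p q))) ∈ _
    simp only [cochainInc_tr, sub_self]
    exact Submodule.zero_mem _
  · exact cohomologyMap_comp_eq_id (hinc.isDoubleComplexMap M).isComplexMap
      (htr.isDoubleComplexMap M).isComplexMap n fun x hx =>
      (hinc.isDoubleComplexMap M).sub_mem_coboundaries (htr.isDoubleComplexMap M)
        (isDoubleComplex_cyclic k (MatCat k D r) M) (fun _ q φ _ => cochainInc_tr ⟨0, hr⟩ q φ)
        (fun p q _ hφ => mem_coboundaries_column ⟨0, hr⟩ p q hφ) n hx
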